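/- Let $k$ be an algebraically closed field with $\operatorname{char} k\neq 2$. Let $Q$ be the quiver with vertices $1,2$ and arrows $\alpha_1:1\to 2$, $\alpha_2:2\to 1$, let $R_Q$ be the arrow ideal of $kQ$ and $A=kQ/R_Q^2$. Thus $A$ has basis $e_1,e_2,\alpha_1,\alpha_2$, with $e_i\alpha_ie_{i+1}=\alpha_i$ (indices mod $2$) and $\alpha_i\alpha_{i+1}=0$. Equip $A$ with the Frobenius form $\langle a,b\rangle=tr(ab)$, where $tr(\alpha_i)=1$, $tr(e_i)=0$, with the dual bases $(u_j)=(e_1,e_2,\alpha_1,\alpha_2)$, $(v_j)=(\alpha_2,\alpha_1,e_1,e_2)$, $\langle v_i,u_j\rangle=\delta_{ij}$. Its Nakayama automorphism $\nu$ ($\langle a,b\rangle=\langle b,\nu(a)\rangle$) is $e_i\mapsto e_{i+1}$, $\alpha_i\mapsto\alpha_{i+1}$. Write $\overline A=A/k1$ and $A_{\nu^{-1}}$ for $A$ with the bimodule structure $a\cdot m\cdot b=am\nu^{-1}(b)$. Let $\widehat{\mathrm{HH}}^\bullet(A)$ be the complete (Tate–Hochschild) cohomology, i.e. the cohomology of the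 complex $$\cdots\to C_1(A,A_{\nu^{-1}})\xrightarrow{\partial} A_{\nu^{-1}}\xrightarrow{\ m\mapsto\sum_j u_jmv_j\ }A\xrightarrow{\delta}C^1(A,A)\to\cdots$$ with the normalized Hochschild cochains $C^r(A,A)=\mathrm{Hom}_k(\overline A^{\otimes r},A)$ in degree $r\ge 0$ and the normalized Hochschild chains $C_p(A,A_{\nu^{-1}})=A\otimes\overline A^{\otimes p}$ in degree $-p-1$. Let $\star$ be the product on $\widehat{\mathrm{HH}}^\bullet(A)$ induced by the following operations, for cochains $f\in C^m(A,A)$, $g\in C^n(A,A)$ and chains $x=a_0\otimes\overline a_1\otimes\cdots\otimes\overline a_p$, $y=b_0\otimes\overline b_1\otimes\cdots\otimes\overline b_q$: $f\star g$ is the cup product; if $m\le p$, then $x\star f=a_0\nu^{-1}(f(\overline a_1,\dots,\overline a_m))\otimes\overline a_{m+1}\otimes\cdots\otimes\overline a_p$ and $f\star x=f(\overline a_{p-m+1},\dots,\overline a_p)a_0\otimes\overline a_1\otimes\cdots\otimes\overline a_{p-m}$; if $m=s+p+1>p$, then $(f\star x)(\overline c_1,\dots,\overline c_s)=\sum_j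 f(\overline c_1,\dots,\overline c_s,\overline{u_j\nu(a_0)},\overline a_1,\dots,\overline a_p)v_j$ and $(x\star f)(\overline c_1,\dots,\overline c_s)=\sum_j u_j\nu(a_0)f(\overline a_1,\dots,\overline a_p,\overline v_j,\overline c_1,\dots,\overline c_s)$; and $x\star y=\sum_j v_jb_0\otimes\overline b_1\otimes\cdots\otimes\overline b_q\otimes\overline{u_j\nu(a_0)}\otimes\overline a_1\otimes\cdots\otimes\overline a_p$. Let $A_\mu=\ker(\nu-\mu\,\mathrm{id})$. The invariant subcomplex consists of the cochains $f$ with $f(\overline a_1,\dots,\overline a_r)\in A_{\mu_1\cdots\mu_r}$ whenever $a_i\in A_{\mu_i}$, and of the span of the chains $a_0\otimes\overline a_1\otimes\cdots\otimes\overline a_p$ with $a_i\in A_{\mu_i}$ and $\mu_0\mu_1\cdots\mu_p=1$. The BV differential $\widehat\Delta_r:\widehat{\mathrm{HH}}^r(A)\to\widehat{\mathrm{HH}}^{r-1}(A)$ is the operator induced, by means of representatives in the invariant subcomplex, for $r\ge1$ by $$\langle\Delta(f)(\overline a_1,\dots,\overline a_{r-1}),a_r\rangle=\sum_{i=1}^r(-1)^{i(r-1)}\langle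 f(\overline a_i,\dots,\overline a_{r},\overline{\nu (a_1)},\dots,\overline{\nu (a_{i-1})}),1\rangle,$$ by $0$ for $r=0$, and for $r=-p-1\le-1$ by $(-1)^rB$ with $$B(a_0\otimes\overline a_1\otimes\cdots\otimes\overline a_p)=\sum_{i=1}^{p+1}(-1)^{ip}\,1\otimes\overline a_i\otimes\cdots\otimes\overline a_p\otimes\overline a_0\otimes\overline{\nu^{-1}(a_1)}\otimes\cdots\otimes\overline{\nu^{-1}(a_{i-1})}.$$ For homogeneous $x,y$ of degrees $|x|,|y|$ put $$\{x,y\}=(-1)^{|x||y|+|x|+|y|}\bigl((-1)^{|x|+1}\widehat\Delta(x\star y)+(-1)^{|x|}\widehat\Delta(x)\star y+x\star\widehat\Delta(y)\bigr).$$ Let $\alpha\in\widehat{\mathrm{HH}}^2(A)$ be the class of the cochain $\alpha_i\otimes\alpha_{i+1}\mapsto e_i$ $(i=1,2)$, zero on all other pairs of basis elements; $\beta\in\widehat{\mathrm{HH}}^1(A)$ the class of the cochain $\alpha_1\mapsto\alpha_1$, zero on the other basis elements; and $\alpha^{-1}\in\widehat{\mathrm{HH}}^{-2}(A)$ the class of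 $e_1\otimes\overline\alpha_2+e_2\otimes\overline\alpha_1$. Then $\star$ and $\widehat\Delta$ are well defined on $\widehat{\mathrm{HH}}^\bullet(A)$ and uniquely determined by the above, $\alpha\star\alpha^{-1}=\alpha^{-1}\star\alpha=1$, and for every $n\in\mathbb Z$ the spaces $\widehat{\mathrm{HH}}^{2n}(A)$ and $\widehat{\mathrm{HH}}^{2n+1}(A)$ are one-dimensional, spanned by $\alpha^n$ and $\alpha^n\beta$ respectively. The BV differential is given by $$\widehat\Delta_{2n+1}(\alpha^n\beta)=\frac{2n+1}{2}\,\alpha^n,\qquad \widehat\Delta_{2n}(\alpha^n)=0\qquad(n\in\mathbb Z).$$ Among the generators $\alpha,\beta,\alpha^{-1}$, the only nonzero brackets are $\{\alpha,\beta\}=\alpha$ and $\{\beta,\alpha^{-1}\}=\alpha^{-1}$, together with their opposites $\{\beta,\alpha\}=-\alpha$ and $\{\alpha^{-1},\beta\}=-\alpha^{-1}$. The brackets they induce on all basis elements are, for $m,n\in\mathbb Z$, $$\{\alpha^m,\alpha^n\}=0,\quad\{\alpha^m,\alpha^n\beta\}=m\,\alpha^{m+n},\quad\{\alpha^m\beta,\alpha^n\}=-n\,\alpha^{m+n},\quad\{\alpha^m\beta,\alpha^n\beta\}=(m-n)\,\alpha^{m+n}\beta.$$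 -/

import Mathlib

open scoped TensorProduct DirectSum

noncomputable section

namespace TateHochschild

universe u

/-! ## Frobenius algebras and their complete cohomology -/

/-- A Frobenius algebra structure on `A`: an associative bilinear form with a pair of dual bases
`(u i)`, `(v i)` (so the form is non-degenerate) and its Nakayama automorphism `ν`. -/
structure FrobeniusData (k A ι : Type*) [Field k] [Ring A] [Algebra k A] [DecidableEq ι] where
  form : A →ₗ[k] A →ₗ[k] k
  form_mul : ∀ a b c : A, form (a * b) c = form a (b * c)
  u : Module.Basis ι k A
  v : ι → A
  form_v_u : ∀ i j, form (v i) (u j) = if i = j then 1 else 0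
  ν : A ≃ₐ[k] A
  form_ν : ∀ a b : A, form a b = form b (ν a)

/-- `Ā = A / k·1`. -/
abbrev Bar (k A : Type*) [Field k] [Ring A] [Algebra k A] : Type _ :=
  A ⧸ Submodule.span k {(1 : A)}

/-- The class in `Ā` of an element of `A`. -/
abbrev toBar (k : Type*) {A : Type*} [Field k] [Ring A] [Algebra k A] (a : A) : Bar k A :=
  (Submodule.span k {(1 : A)}).mkQ a

/-- Functions of `r` arguments in `A` with values in `A`. -/
abbrev Fun (A : Type*) (r : ℕ) : Type _ := (Fin r → A) → A

/-- The free vector space on the tuples `(a₀, …, a_p)` of elements of `A`. -/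
abbrev Tup (k A : Type*) [Field k] (p : ℕ) : Type _ := (Fin (p + 1) → A) →₀ k

section General

variable (k : Type u) {A : Type u} {ι : Type*} [Field k] [Ring A] [Algebra k A]

/-- A multilinear map on `Ā × ⋯ × Ā`, seen as a function on `A × ⋯ × A`. -/
def inflate (r : ℕ) : MultilinearMap k (fun _ : Fin r => Bar k A) A →ₗ[k] Fun A r where
  toFun g := fun a => g fun j => toBar k (a j)
  map_add' _ _ := rfl
  map_smul' _ _ := rfl

/-- The normalized Hochschild cochains `C^r(A, A) = Hom(Ā^{⊗ r}, A)`, seen as functions on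
`A × ⋯ × A`. -/
def cochains (A : Type u) [Ring A] [Algebra k A] (r : ℕ) : Submodule k (Fun A r) :=
  LinearMap.range (inflate k (A := A) r)

/-- The normalized Hochschild chains `C_p(A, A_{ν⁻¹}) = A ⊗ Ā^{⊗ p}`. -/
abbrev Chain (A : Type u) [Ring A] [Algebra k A] (p : ℕ) : Type u :=
  A ⊗[k] (⨂[k] _ : Fin p, Bar k A)

/-- The surjection `(a₀, …, a_p) ↦ a₀ ⊗ ā₁ ⊗ ⋯ ⊗ ā_p` from the free vector space on tuples onto the
space `A ⊗ Ā^{⊗ p}` of normalized Hochschild chains. -/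
def toChain (A : Type u) [Ring A] [Algebra k A] (p : ℕ) :
    Tup k A p →ₗ[k] Chain k A p :=
  Finsupp.linearCombination k fun a =>
    a 0 ⊗ₜ[k] PiTensorProduct.tprod k fun j : Fin p => toBar k (a j.succ)

/-- The relations between tuples: `Chain k A p` is the quotient of `Tup k A p` by them. -/
def relations (A : Type u) [Ring A] [Algebra k A] (p : ℕ) : Submodule k (Tup k A p) :=
  LinearMap.ker (toChain k A p)

/-- The Hochschild coboundary `δ^r`. -/
def coboundary (r : ℕ) : Fun A r →ₗ[k] Fun A (r + 1) where
  toFun f := fun a =>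
    a 0 * f (fun j => a j.succ)
      + ∑ i : Fin r, (-1 : k) ^ ((i : ℕ) + 1) • f (Fin.contractNth i.castSucc (· * ·) a)
      + (-1 : k) ^ (r + 1) • (f (fun j => a j.castSucc) * a (Fin.last r))
  map_add' f g := by
    funext a
    simp only [Pi.add_apply, mul_add, add_mul, smul_add, Finset.sum_add_distrib]
    abel
  map_smul' c f := by
    funext a
    simp only [Pi.smul_apply, RingHom.id_apply, smul_add, Finset.smul_sum, mul_smul_comm,
      smul_mul_assoc, smul_comm c]

variable {k} [Fintype ι] [DecidableEq ι] (F : FrobeniusData k A ι)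

/-- The Hochschild boundary `∂_{p+1} : C_{p+1}(A, A_{ν⁻¹}) → C_p(A, A_{ν⁻¹})` on tuples, where
`m ∈ A_{ν⁻¹}` is multiplied by `a` as `a · m = a m` and `m · a = m ν⁻¹(a)`. -/
def boundary (p : ℕ) : Tup k A (p + 1) →ₗ[k] Tup k A p :=
  Finsupp.linearCombination k fun a =>
    Finsupp.single (Fin.cons (a 0 * F.ν.symm (a 1)) fun j : Fin p => a j.succ.succ) 1
      + ∑ i : Fin p, Finsupp.single
          (Fin.contractNth i.succ.castSucc (· * ·) a) ((-1 : k) ^ ((i : ℕ) + 1))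
      + Finsupp.single (Fin.cons (a (Fin.last (p + 1)) * a 0) fun j : Fin p => a j.succ.castSucc)
          ((-1 : k) ^ (p + 1))

/-- The norm map `μ : A_{ν⁻¹} → A`, `m ↦ ∑ i, u_i m v_i`, joining the two halves of the complete
complex. -/
def norm : Tup k A 0 →ₗ[k] Fun A 0 :=
  Finsupp.linearCombination k fun a => fun _ => ∑ i, F.u i * a 0 * F.v i

/-- Cocycles of the complete complex in degree `r ≥ 0`. -/
def cocycles (k A : Type u) [Field k] [Ring A] [Algebra k A] (r : ℕ) : Submodule k (Fun A r) :=
  cochains k A r ⊓ LinearMap.ker (coboundary k r)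

/-- Coboundaries of the complete complex in degree `r ≥ 0`. -/
def coboundaries : ∀ r : ℕ, Submodule k (Fun A r)
  | 0 => LinearMap.range (norm F)
  | r + 1 => (cochains k A r).map (coboundary k r)

/-- The combinations of tuples that represent a cocycle of the complete complex in degree
`-p-1 < 0`, that is, whose image under the norm map (`p = 0`) or whose Hochschild boundary (`p > 0`)
vanishes. -/
def cycles : ∀ p : ℕ, Submodule k (Tup k A p)
  | 0 => LinearMap.ker (norm F)
  | p + 1 => (relations k A p).comap (boundary F p)

/-- Cocycles of the complete complex in degree `-p-1 < 0`. -/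
def chainCycles (p : ℕ) : Submodule k (Chain k A p) :=
  (cycles F p).map (toChain k A p)

/-- Coboundaries of the complete complex in degree `-p-1 < 0`. -/
def chainBoundaries (p : ℕ) : Submodule k (Chain k A p) :=
  (LinearMap.range (boundary F p)).map (toChain k A p)

/-- The complete cohomology group in degree `r`: the cohomology of the complete complex
`⋯ → C_1(A, A_{ν⁻¹}) → A_{ν⁻¹} → A → C^1(A, A) → ⋯`, with `C^r(A, A)` in degree `r ≥ 0` and
`C_p(A, A_{ν⁻¹})` in degree `-p-1`. It is realized as the image of the cocycles in the quotient of the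
term of the complex by the coboundaries. -/
def HH : ℤ → Type u
  | .ofNat r => (cocycles k A r).map (coboundaries F r).mkQ
  | .negSucc p => (chainCycles F p).map (chainBoundaries F p).mkQ

instance : ∀ r : ℤ, AddCommGroup (HH F r)
  | .ofNat r => inferInstanceAs
      (AddCommGroup ((cocycles k A r).map (coboundaries F r).mkQ))
  | .negSucc p => inferInstanceAs
      (AddCommGroup ((chainCycles F p).map (chainBoundaries F p).mkQ))

instance : ∀ r : ℤ, Module k (HH F r)
  | .ofNat r => inferInstanceAs
      (Module k ((cocycles k A r).map (coboundaries F r).mkQ))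
  | .negSucc p => inferInstanceAs
      (Module k ((chainCycles F p).map (chainBoundaries F p).mkQ))

/-- The complete cohomology `⨁ r, HH^r`. -/
abbrev Complete : Type u := ⨁ r : ℤ, HH F r

/-- The subspace `HH^r` of the complete cohomology. -/
def degree (r : ℤ) : Submodule k (Complete F) :=
  LinearMap.range (DirectSum.lof k ℤ (HH F) r)

/-- The class in degree `r ≥ 0` of a cocycle. -/
def cls {r : ℕ} (f : Fun A r) (hf : f ∈ cocycles k A r) : Complete F :=
  DirectSum.lof k ℤ (HH F) (.ofNat r)
    ⟨(coboundaries F r).mkQ f, Submodule.mem_map_of_mem hf⟩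

/-- The class in degree `-p-1` of the cocycle represented by a combination of tuples. -/
def negCls {p : ℕ} (x : Tup k A p) (hx : x ∈ cycles F p) : Complete F :=
  DirectSum.lof k ℤ (HH F) (.negSucc p)
    ⟨(chainBoundaries F p).mkQ (toChain k A p x),
      Submodule.mem_map_of_mem (Submodule.mem_map_of_mem hx)⟩

/-! ## The `⋆`-product -/

/-- `f ⋆ g` for `f ∈ C^m(A, A)` and `g ∈ C^n(A, A)`: the cup product. -/
def cup {m n : ℕ} (f : Fun A m) (g : Fun A n) : Fun A (m + n) := fun a =>
  f (fun i => a (Fin.castAdd n i)) * g (fun j => a (Fin.natAdd m j))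

/-- `α ⋆ f = a₀ ν⁻¹(f(a₁, …, a_m)) ⊗ a_{m+1} ⊗ ⋯ ⊗ a_{m+q}` for `α = a₀ ⊗ ⋯ ⊗ a_{m+q}`. -/
def capRight {m q : ℕ} (x : Tup k A (m + q)) (f : Fun A m) : Tup k A q :=
  x.sum fun a c => Finsupp.single
    (Fin.cons (a 0 * F.ν.symm (f fun i => a (Fin.castAdd q i).succ))
      fun j : Fin q => a (Fin.natAdd m j).succ) c

/-- `f ⋆ α = f(a_{q+1}, …, a_{q+m}) a₀ ⊗ a₁ ⊗ ⋯ ⊗ a_q` for `α = a₀ ⊗ ⋯ ⊗ a_{q+m}`. -/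
def capLeft {m q : ℕ} (f : Fun A m) (x : Tup k A (q + m)) : Tup k A q :=
  x.sum fun a c => Finsupp.single
    (Fin.cons ((f fun i => a (Fin.natAdd q i).succ) * a 0)
      fun j : Fin q => a (Fin.castAdd m j).succ) c

/-- `(f ⋆ α)(b₁, …, b_s) = ∑ i, f(b₁, …, b_s, u_i ν(a₀), a₁, …, a_p) v_i` for
`α = a₀ ⊗ ⋯ ⊗ a_p`. -/
def mixLeft {s p : ℕ} (f : Fun A (s + (p + 1))) (x : Tup k A p) : Fun A s := fun b =>
  x.sum fun a c => c • ∑ i,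
    f (Fin.append b (Fin.cons (F.u i * F.ν (a 0)) (Fin.tail a) : Fin (p + 1) → A)) * F.v i

/-- `(α ⋆ f)(b₁, …, b_s) = ∑ i, u_i ν(a₀) f(a₁, …, a_p, v_i, b₁, …, b_s)` for
`α = a₀ ⊗ ⋯ ⊗ a_p`. -/
def mixRight {s p : ℕ} (x : Tup k A p) (f : Fun A (p + (s + 1))) : Fun A s := fun b =>
  x.sum fun a c => c • ∑ i,
    F.u i * F.ν (a 0) * f (Fin.append (Fin.tail a) (Fin.cons (F.v i) b : Fin (s + 1) → A))

/-- `α ⋆ β = ∑ i, v_i b₀ ⊗ b₁ ⊗ ⋯ ⊗ b_q ⊗ u_i ν(a₀) ⊗ a₁ ⊗ ⋯ ⊗ a_p` for `α = a₀ ⊗ ⋯ ⊗ a_p` and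
`β = b₀ ⊗ ⋯ ⊗ b_q`. -/
def negMul {p q : ℕ} (x : Tup k A p) (y : Tup k A q) : Tup k A (q + (p + 1)) :=
  x.sum fun a c => y.sum fun b d => ∑ i, Finsupp.single
    (Fin.cons (F.v i * b 0)
      (Fin.append (Fin.tail b) (Fin.cons (F.u i * F.ν (a 0)) (Fin.tail a) : Fin (p + 1) → A)))
    (c * d)

/-- `S` is the product `⋆` on the complete cohomology: the bilinear map induced by the `⋆`-product
of (co)chains. -/
structure IsStarProduct (S : Complete F →ₗ[k] Complete F →ₗ[k] Complete F) : Prop where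
  cup : ∀ {m n : ℕ} (f : Fun A m) (hf : f ∈ cocycles k A m) (g : Fun A n)
    (hg : g ∈ cocycles k A n),
    ∃ h : cup f g ∈ cocycles k A (m + n), S (cls F f hf) (cls F g hg) = cls F (cup f g) h
  capRight : ∀ {m q : ℕ} (x : Tup k A (m + q)) (hx : x ∈ cycles F (m + q)) (f : Fun A m)
    (hf : f ∈ cocycles k A m),
    ∃ h : capRight F x f ∈ cycles F q,
      S (negCls F x hx) (cls F f hf) = negCls F (capRight F x f) h
  capLeft : ∀ {m q : ℕ} (f : Fun A m) (hf : f ∈ cocycles k A m) (x : Tup k A (q + m))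
    (hx : x ∈ cycles F (q + m)),
    ∃ h : capLeft f x ∈ cycles F q,
      S (cls F f hf) (negCls F x hx) = negCls F (capLeft f x) h
  mixLeft : ∀ {s p : ℕ} (f : Fun A (s + (p + 1))) (hf : f ∈ cocycles k A (s + (p + 1)))
    (x : Tup k A p) (hx : x ∈ cycles F p),
    ∃ h : mixLeft F f x ∈ cocycles k A s,
      S (cls F f hf) (negCls F x hx) = cls F (mixLeft F f x) h
  mixRight : ∀ {s p : ℕ} (x : Tup k A p) (hx : x ∈ cycles F p) (f : Fun A (p + (s + 1)))
    (hf : f ∈ cocycles k A (p + (s + 1))),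
    ∃ h : mixRight F x f ∈ cocycles k A s,
      S (negCls F x hx) (cls F f hf) = cls F (mixRight F x f) h
  negMul : ∀ {p q : ℕ} (x : Tup k A p) (hx : x ∈ cycles F p) (y : Tup k A q)
    (hy : y ∈ cycles F q),
    ∃ h : negMul F x y ∈ cycles F (q + (p + 1)),
      S (negCls F x hx) (negCls F y hy) = negCls F (negMul F x y) h

/-! ## The Batalin-Vilkovisky differential -/

/-- `(w_i, …, w_n, σ(w_0), …, σ(w_{i-1}))` for `w = (w_0, …, w_n)`. -/
def twistedRotate {n : ℕ} (σ : A → A) (i : Fin (n + 1)) (w : Fin (n + 1) → A) : Fin (n + 1) → A :=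
  fun t => if (t : ℕ) + (i : ℕ) < n + 1 then w (t + i) else σ (w (t + i))

/-- The operator `Δ^ν_{r+1}` on cochains, determined by
`⟨Δ(f)(a_1, …, a_r), x⟩ = ∑_{i=1}^{r+1} (-1)^{i r} ⟨f(a_i, …, a_r, x, ν a_1, …, ν a_{i-1}), 1⟩`. -/
def bvCochain {r : ℕ} (f : Fun A (r + 1)) : Fun A r := fun a =>
  ∑ j, (∑ i : Fin (r + 1), (-1 : k) ^ (((i : ℕ) + 1) * r) *
    F.form (f (twistedRotate F.ν i (Fin.snoc a (F.u j)))) 1) • F.v j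

/-- The twisted Connes operator `B^{ν⁻¹}_p` on tuples:
`a₀ ⊗ ⋯ ⊗ a_p ↦ ∑_{i=1}^{p+1} (-1)^{i p} 1 ⊗ a_i ⊗ ⋯ ⊗ a_p ⊗ a₀ ⊗ ν⁻¹a₁ ⊗ ⋯ ⊗ ν⁻¹a_{i-1}`. -/
def connes {p : ℕ} (x : Tup k A p) : Tup k A (p + 1) :=
  x.sum fun a c => ∑ i : Fin (p + 1), Finsupp.single
    (Fin.cons 1 (twistedRotate F.ν.symm i (Fin.snoc (Fin.tail a) (a 0))))
    (c * (-1 : k) ^ (((i : ℕ) + 1) * p))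

/-- The subspace `C^r_{(1)}(A, A)` of cochains: `f` maps `Ā_{μ_1} ⊗ ⋯ ⊗ Ā_{μ_r}` into
`A_{μ_1 ⋯ μ_r}`, where `A_μ` is the eigenspace of `ν` for `μ`. -/
def IsInvariant {r : ℕ} (f : Fun A r) : Prop :=
  ∀ (μ : Fin r → k) (a : Fin r → A), (∀ i, F.ν (a i) = μ i • a i) →
    F.ν (f a) = (∏ i, μ i) • f a

/-- The subspace `C_p^{(1)}(A, A_{ν⁻¹})` of chains, spanned by the `A_{μ_0} ⊗ Ā_{μ_1} ⊗ ⋯ ⊗ Ā_{μ_p}`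
with `μ_0 μ_1 ⋯ μ_p = 1`. -/
def invariantTuples (p : ℕ) : Submodule k (Tup k A p) :=
  relations k A p ⊔ Submodule.span k
    {x | ∃ (μ : Fin (p + 1) → k) (a : Fin (p + 1) → A),
      (∀ i, F.ν (a i) = μ i • a i) ∧ ∏ i, μ i = 1 ∧ x = Finsupp.single a 1}

/-- `Δ` is the operator on the complete cohomology induced, through the subcomplex `D^•_{(1)}(A, A)`
of the complete complex, by `Δ^ν_r` in degrees `r ≥ 1`, by `0` in degree `0`, and by
`(-1)^r B^{ν⁻¹}_{-r-1}` in degrees `r ≤ -1`. -/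
structure IsBVOperator (Δ : Complete F →ₗ[k] Complete F) : Prop where
  pos : ∀ {r : ℕ} (f : Fun A (r + 1)) (hf : f ∈ cocycles k A (r + 1)), IsInvariant F f →
    ∃ h : bvCochain F f ∈ cocycles k A r, Δ (cls F f hf) = cls F (bvCochain F f) h
  zero : ∀ (f : Fun A 0) (hf : f ∈ cocycles k A 0), Δ (cls F f hf) = 0
  neg : ∀ {p : ℕ} (x : Tup k A p) (hx : x ∈ cycles F p), x ∈ invariantTuples F p →
    ∃ h : (-1 : k) ^ (p + 1) • connes F x ∈ cycles F (p + 1),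
      Δ (negCls F x hx) = negCls F ((-1 : k) ^ (p + 1) • connes F x) h

/-- The bracket `{x, y}` defined by a product `S` and an operator `Δ`, for `x` of degree `m` and `y`
of degree `n`. -/
def bracket (S : Complete F →ₗ[k] Complete F →ₗ[k] Complete F) (Δ : Complete F →ₗ[k] Complete F)
    (m n : ℤ) (x y : Complete F) : Complete F :=
  (m * n + m + n).negOnePow •
    ((m + 1).negOnePow • Δ (S x y) + m.negOnePow • S (Δ x) y + S x (Δ y))

end General

/-! ## The radical square zero algebra of the oriented 2-cycle -/

/-- The algebra `k Q / R_Q²` of the quiver `Q` with two vertices and arrows `α_i : i → i + 1`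
(indices modulo 2), `R_Q` the arrow ideal. Its basis consists of the paths of length `0` and `1`, with
coordinates `e i` on the vertex `e_i` and `arr i` on the arrow `α_i`. -/
@[ext]
structure TwoCycle (k : Type u) : Type u where
  e : Fin 2 → k
  arr : Fin 2 → k

namespace TwoCycle

variable (k : Type u)

/-- The coordinates of an element. -/
def equivCoord : TwoCycle k ≃ (Fin 2 → k) × (Fin 2 → k) where
  toFun x := (x.e, x.arr)
  invFun y := ⟨y.1, y.2⟩
  left_inv _ := rfl
  right_inv _ := rfl

variable [Field k]

instance : AddCommGroup (TwoCycle k) := (equivCoord k).addCommGroup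

instance : Module k (TwoCycle k) := (equivCoord k).module k

variable {k}

@[simp] lemma zero_e : (0 : TwoCycle k).e = 0 := rfl
@[simp] lemma zero_arr : (0 : TwoCycle k).arr = 0 := rfl
@[simp] lemma add_e (x y : TwoCycle k) : (x + y).e = x.e + y.e := rfl
@[simp] lemma add_arr (x y : TwoCycle k) : (x + y).arr = x.arr + y.arr := rfl
@[simp] lemma neg_e (x : TwoCycle k) : (-x).e = -x.e := rfl
@[simp] lemma neg_arr (x : TwoCycle k) : (-x).arr = -x.arr := rfl
@[simp] lemma smul_e (c : k) (x : TwoCycle k) : (c • x).e = c • x.e := rfl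
@[simp] lemma smul_arr (c : k) (x : TwoCycle k) : (c • x).arr = c • x.arr := rfl

/-- Multiplication is concatenation of paths, with `e_i α_i e_{i+1} = α_i`, and paths of length at
least two are zero. -/
instance : Mul (TwoCycle k) where
  mul x y := ⟨fun i => x.e i * y.e i, fun i => x.e i * y.arr i + x.arr i * y.e (i + 1)⟩

/-- The unit is `e_1 + e_2`. -/
instance : One (TwoCycle k) where
  one := ⟨fun _ => 1, fun _ => 0⟩

@[simp] lemma mul_e (x y : TwoCycle k) (i : Fin 2) : (x * y).e i = x.e i * y.e i := rfl
@[simp] lemma mul_arr (x y : TwoCycle k) (i : Fin 2) :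
    (x * y).arr i = x.e i * y.arr i + x.arr i * y.e (i + 1) := rfl
@[simp] lemma one_e (i : Fin 2) : (1 : TwoCycle k).e i = 1 := rfl
@[simp] lemma one_arr (i : Fin 2) : (1 : TwoCycle k).arr i = 0 := rfl

instance : Ring (TwoCycle k) :=
  { (inferInstance : AddCommGroup (TwoCycle k)), (inferInstance : Mul (TwoCycle k)),
    (inferInstance : One (TwoCycle k)) with
    left_distrib := fun x y z => by ext i <;> simp <;> ring
    right_distrib := fun x y z => by ext i <;> simp <;> ring
    zero_mul := fun x => by ext i <;> simp
    mul_zero := fun x => by ext i <;> simp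
    mul_assoc := fun x y z => by ext i <;> simp <;> ring
    one_mul := fun x => by ext i <;> simp
    mul_one := fun x => by ext i <;> simp }

instance : Algebra k (TwoCycle k) :=
  Algebra.ofModule (fun c x y => by ext i <;> simp <;> ring)
    (fun c x y => by ext i <;> simp <;> ring)

variable (k)

/-- The idempotent `e_i`. -/
def idem (i : Fin 2) : TwoCycle k := ⟨Pi.single i 1, 0⟩

/-- The arrow `α_i`. -/
def arrow (i : Fin 2) : TwoCycle k := ⟨0, Pi.single i 1⟩

/-- The linear form sending `α_1`, `α_2` (a basis of the socle) to `1` and `e_1`, `e_2` to `0`. -/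
def tr : TwoCycle k →ₗ[k] k where
  toFun x := x.arr 0 + x.arr 1
  map_add' x y := by simp; ring
  map_smul' c x := by simp; ring

/-- The basis `(e_1, e_2, α_1, α_2)`. -/
def basis : Module.Basis (Fin 2 ⊕ Fin 2) k (TwoCycle k) :=
  Module.Basis.ofEquivFun
    { toFun := fun x => Sum.elim x.e x.arr
      invFun := fun y => ⟨fun i => y (.inl i), fun i => y (.inr i)⟩
      left_inv := fun _ => rfl
      right_inv := fun y => by funext i; cases i <;> rfl
      map_add' := fun x y => by funext i; cases i <;> rfl
      map_smul' := fun c x => by funext i; cases i <;> rfl }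

lemma basis_inl (i : Fin 2) : basis k (.inl i) = idem k i := by
  apply (basis k).equivFun.injective
  funext j
  rw [Module.Basis.equivFun_self]
  change _ = Sum.elim (idem k i).e (idem k i).arr j
  rcases j with j | j <;> simp [idem, Pi.single_apply, eq_comm]

lemma basis_inr (i : Fin 2) : basis k (.inr i) = arrow k i := by
  apply (basis k).equivFun.injective
  funext j
  rw [Module.Basis.equivFun_self]
  change _ = Sum.elim (arrow k i).e (arrow k i).arr j
  rcases j with j | j <;> simp [arrow, Pi.single_apply, eq_comm]

/-- The automorphism `e_i ↦ e_{i+1}`, `α_i ↦ α_{i+1}`. -/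
def nakayama : TwoCycle k ≃ₐ[k] TwoCycle k :=
  AlgEquiv.ofLinearEquiv
    { toFun := fun x => ⟨fun i => x.e (i + 1), fun i => x.arr (i + 1)⟩
      invFun := fun x => ⟨fun i => x.e (i + 1), fun i => x.arr (i + 1)⟩
      left_inv := fun x => by ext i <;> fin_cases i <;> rfl
      right_inv := fun x => by ext i <;> fin_cases i <;> rfl
      map_add' := fun _ _ => rfl
      map_smul' := fun _ _ => rfl }
    rfl (fun _ _ => rfl)

@[simp] lemma nakayama_e (x : TwoCycle k) (i : Fin 2) : (nakayama k x).e i = x.e (i + 1) := rfl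
@[simp] lemma nakayama_arr (x : TwoCycle k) (i : Fin 2) :
    (nakayama k x).arr i = x.arr (i + 1) := rfl
@[simp] lemma nakayama_symm_e (x : TwoCycle k) (i : Fin 2) :
    ((nakayama k).symm x).e i = x.e (i + 1) := rfl
@[simp] lemma nakayama_symm_arr (x : TwoCycle k) (i : Fin 2) :
    ((nakayama k).symm x).arr i = x.arr (i + 1) := rfl

/-- The Frobenius structure of `k Q / R_Q²`: the form `⟨a, b⟩ = tr(ab)` with the dual bases
`(e_1, e_2, α_1, α_2)` and `(α_2, α_1, e_1, e_2)`. -/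
def frobeniusData : FrobeniusData k (TwoCycle k) (Fin 2 ⊕ Fin 2) where
  form := (LinearMap.mul k (TwoCycle k)).compr₂ (tr k)
  form_mul a b c := by simp [mul_assoc]
  u := basis k
  v := Sum.elim (fun i => arrow k (i + 1)) (fun i => idem k i)
  form_v_u i j := by
    rcases i with i | i <;> rcases j with j | j <;> fin_cases i <;> fin_cases j <;>
      simp [basis_inl, basis_inr, idem, arrow, tr]
  ν := nakayama k
  form_ν a b := by
    simp [tr]
    ring

/-- The cochain of degree `0` given by `1 ∈ A`. -/
def oneCochain : Fun (TwoCycle k) 0 := fun _ => 1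

/-- The cochain of degree `2` with `α_i ⊗ α_{i+1} ↦ e_i`, vanishing on all other pairs of basis
elements of `A`. -/
def alphaCochain : Fun (TwoCycle k) 2 := fun a =>
  ∑ i : Fin 2, ((a 0).arr i * (a 1).arr (i + 1)) • idem k i

/-- The cochain of degree `1` with `α_1 ↦ α_1`, vanishing on the other basis elements of `A`. -/
def betaCochain : Fun (TwoCycle k) 1 := fun a => (a 0).arr 0 • arrow k 0

/-- The chain `e_1 ⊗ α_2 + e_2 ⊗ α_1` in `C_1(A, A_{ν⁻¹})`. -/
def gammaTuple : Tup k (TwoCycle k) 1 :=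
  ∑ i : Fin 2, Finsupp.single ![idem k i, arrow k (i + 1)] 1

/-- The coordinate of an arrow, as a function on `Ā`. -/
def barArr (i : Fin 2) : Bar k (TwoCycle k) →ₗ[k] k :=
  (Submodule.span k {(1 : TwoCycle k)}).liftQ
    { toFun := fun x => x.arr i, map_add' := fun _ _ => rfl, map_smul' := fun _ _ => rfl }
    (by
      rw [Submodule.span_le, Set.singleton_subset_iff]
      rfl)

@[simp] lemma barArr_toBar (i : Fin 2) (x : TwoCycle k) : barArr k i (toBar k x) = x.arr i := rfl

lemma oneCochain_mem : oneCochain k ∈ cocycles k (TwoCycle k) 0 := by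
  refine ⟨⟨MultilinearMap.constOfIsEmpty k _ 1, rfl⟩, ?_⟩
  change coboundary k 0 (oneCochain k) = 0
  funext a
  simp [coboundary, oneCochain, Fin.last]

lemma alphaCochain_mem : alphaCochain k ∈ cocycles k (TwoCycle k) 2 := by
  refine ⟨⟨∑ i : Fin 2, ((MultilinearMap.mkPiAlgebra k (Fin 2) k).compLinearMap
      ![barArr k i, barArr k (i + 1)]).smulRight (idem k i), ?_⟩, ?_⟩
  · funext a
    simp [inflate, alphaCochain, -Submodule.mkQ_apply]
  · change coboundary k _ _ = 0
    funext a
    ext j <;> fin_cases j <;>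
      simp [coboundary, alphaCochain, Fin.contractNth, Fin.sum_univ_two, idem] <;> ring

lemma betaCochain_mem : betaCochain k ∈ cocycles k (TwoCycle k) 1 := by
  refine ⟨⟨((MultilinearMap.mkPiAlgebra k (Fin 1) k).compLinearMap
      fun _ => barArr k 0).smulRight (arrow k 0), ?_⟩, ?_⟩
  · funext a
    simp [inflate, betaCochain, -Submodule.mkQ_apply]
  · change coboundary k _ _ = 0
    funext a
    ext j <;> fin_cases j <;>
      simp [coboundary, betaCochain, Fin.contractNth, arrow]
    ring

lemma gammaTuple_mem : gammaTuple k ∈ cycles (frobeniusData k) 1 := by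
  change boundary (frobeniusData k) 0 (gammaTuple k) ∈ LinearMap.ker (toChain k (TwoCycle k) 0)
  rw [LinearMap.mem_ker]
  have key : ∀ a : Fin 1 → TwoCycle k, ∀ c : k, toChain k (TwoCycle k) 0 (Finsupp.single a c) =
      c • (a 0 ⊗ₜ[k] PiTensorProduct.tprod k fun j : Fin 0 => j.elim0) := fun a c => by
    rw [toChain, Finsupp.linearCombination_single]
    congr 3
    exact Subsingleton.elim _ _
  have h0 : (frobeniusData k).ν.symm (arrow k 1) = arrow k 0 := by
    change (nakayama k).symm _ = _
    ext j <;> fin_cases j <;> simp [arrow]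
  have h1 : (frobeniusData k).ν.symm (arrow k 0) = arrow k 1 := by
    change (nakayama k).symm _ = _
    ext j <;> fin_cases j <;> simp [arrow]
  have m1 : ∀ i, idem k i * arrow k i = arrow k i := fun i => by
    ext j <;> fin_cases i <;> fin_cases j <;> simp [arrow, idem]
  have m2 : arrow k 1 * idem k 0 = arrow k 1 := by
    ext j <;> fin_cases j <;> simp [arrow, idem]
  have m3 : arrow k 0 * idem k 1 = arrow k 0 := by
    ext j <;> fin_cases j <;> simp [arrow, idem]
  simp [gammaTuple, boundary, Fin.sum_univ_two, key, h0, h1, m1, m2, m3]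

/-- The unit `1 ∈ HH^0`. -/
def one : Complete (frobeniusData k) := cls (frobeniusData k) (oneCochain k) (oneCochain_mem k)

/-- The generator `α ∈ HH^2`. -/
def alpha : Complete (frobeniusData k) := cls (frobeniusData k) (alphaCochain k) (alphaCochain_mem k)

/-- The generator `β ∈ HH^1`. -/
def beta : Complete (frobeniusData k) := cls (frobeniusData k) (betaCochain k) (betaCochain_mem k)

/-- The generator `α⁻¹ ∈ HH^{-2}`. -/
def alphaInv : Complete (frobeniusData k) := negCls (frobeniusData k) (gammaTuple k) (gammaTuple_mem k)

variable {k} in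
/-- The powers `α^n`, `n ∈ ℤ`, with respect to a product `S`. -/
def alphaPow
    (S : Complete (frobeniusData k) →ₗ[k] Complete (frobeniusData k) →ₗ[k] Complete (frobeniusData k)) :
    ℤ → Complete (frobeniusData k)
  | .ofNat n => (S (alpha k))^[n] (one k)
  | .negSucc n => (S (alphaInv k))^[n + 1] (one k)

end TwoCycle
end TateHochschild

end

open TateHochschild TateHochschild.TwoCycle

noncomputable section

namespace TateHochschild

universe u

/-! ## Cochains as functions on lists -/

section Lists

variable {k A : Type u} [Field k] [Ring A] [Algebra k A]

/-! The pairing `⟨f, a₀ ⊗ ⋯ ⊗ a_p⟩ = tr(f(a₁, …, a_p) a₀)` identifies `C^p(A, A)` with the dual of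
`C_p(A, A_{ν⁻¹})` and makes the Hochschild coboundary the transpose of the boundary
(`exists_chainFunctional`, `pairing_boundary`). For this algebra the norm map is zero
(`norm_eq_zero`), so the complete complex splits: the degrees `r ≥ 0` carry ordinary Hochschild
cohomology, and degree `-p-1` carries the Hochschild homology in degree `p`, whose dual is the
cohomology in degree `p`.

Each of these groups is a line. The homotopy of `listD_pathH` replaces a cocycle, up to a
coboundary, by its values on the two paths `α_i, α_{i+1}, …`, cut down to elements parallel to the
path: multiples of `e_i` in even degree, of `α_i` in odd degree. In even degree the cocycle
condition makes the two coefficients equal; in odd degree their difference is removed by a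
coboundary, since `2` is invertible (`exists_eq_smul_listRep`). Thus `rep r` spans the cohomology,
the cycle `cyc r` satisfies `⟨rep r, cyc r⟩ = 1`, and the pairing of a cocycle `f` with a cycle `x`
has rank one: `⟨f, x⟩ = ⟨f, cyc⟩ ⟨rep, x⟩` (`pairing_eq_mul`).

All operations are transposes of one another: the products of a chain with a shorter cochain are
adjoint to the cup product, those with a longer cochain to the product of chains, and `Δ` to the
twisted Connes operator `B`. The rank one formula therefore reduces each operation to one number,
computed on `rep` and `cyc`. In terms of the generators `gen n`, the product `gen m ⋆ gen n` is `gen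
(m + n)`, or `0` if `m` and `n` are both odd, and `Δ (gen n)` is `(n / 2) gen (n - 1)` for odd `n`
and `0` for even `n`. That the operations preserve cocycles and cycles follows from Leibniz rules
(`listD_listCup`, `sum_tr_listD`) and from the homotopy `∂B + B∂ = ν⁻¹ - 1` (`boundary_connes`),
whose right side vanishes on invariants.

Finally `α = gen 2`, `β = gen 1`, `α⁻¹ = gen (-2)`, and the brackets are arithmetic with these
constants. -/

/-- The restriction to tuples of length `r` of a function on lists. -/
def restrict (r : ℕ) (F : List A → A) : Fun A r := fun a => F (List.ofFn a)

/-- The extension by zero of a function on tuples to a function on lists. -/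
def extend {r : ℕ} (f : Fun A r) : List A → A := fun l =>
  if h : l.length = r then f fun i => l[(i : ℕ)]'(h ▸ i.isLt) else 0

lemma restrict_extend {r : ℕ} (f : Fun A r) : restrict r (extend f) = f := by
  funext a
  simp [restrict, extend]

lemma exists_ofFn {α : Type*} {r : ℕ} {l : List α} (h : l.length = r) :
    ∃ a : Fin r → α, l = List.ofFn a := by
  subst h
  exact ⟨fun i => l[i], by simp⟩

/-- A function on lists which is linear in every entry and vanishes if one entry is `1`. -/
structure IsNormalized (k : Type u) [Field k] [Algebra k A] (F : List A → A) : Prop where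
  add : ∀ l a b m, F (l ++ (a + b) :: m) = F (l ++ a :: m) + F (l ++ b :: m)
  smul : ∀ (c : k) l a m, F (l ++ (c • a) :: m) = c • F (l ++ a :: m)
  one : ∀ l m, F (l ++ 1 :: m) = 0

namespace IsNormalized

variable {F G : List A → A}

lemma head_add (hF : IsNormalized k F) (a b m) : F ((a + b) :: m) = F (a :: m) + F (b :: m) :=
  hF.add [] a b m

lemma head_smul (hF : IsNormalized k F) (c : k) (a m) : F ((c • a) :: m) = c • F (a :: m) :=
  hF.smul c [] a m

lemma head_one (hF : IsNormalized k F) (m) : F (1 :: m) = 0 := hF.one [] m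

lemma head_zero (hF : IsNormalized k F) (m) : F (0 :: m) = 0 := by
  simpa using hF.head_smul 0 0 m

lemma append_left (hF : IsNormalized k F) (w : List A) : IsNormalized k fun l => F (w ++ l) where
  add l a b m := by simpa using hF.add (w ++ l) a b m
  smul c l a m := by simpa using hF.smul c (w ++ l) a m
  one l m := by simpa using hF.one (w ++ l) m

lemma append_right (hF : IsNormalized k F) (w : List A) : IsNormalized k fun l => F (l ++ w) where
  add l a b m := by simpa using hF.add l a b (m ++ w)
  smul c l a m := by simpa using hF.smul c l a (m ++ w)
  one l m := by simpa using hF.one l (m ++ w)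

lemma cons (hF : IsNormalized k F) (a : A) : IsNormalized k fun l => F (a :: l) :=
  hF.append_left [a]

lemma comp (hF : IsNormalized k F) (φ : A →ₗ[k] A) : IsNormalized k fun l => φ (F l) where
  add l a b m := by simp [hF.add]
  smul c l a m := by simp [hF.smul]
  one l m := by simp [hF.one]

lemma mul_left (hF : IsNormalized k F) (b : A) : IsNormalized k fun l => b * F l :=
  hF.comp (LinearMap.mulLeft k b)

lemma mul_right (hF : IsNormalized k F) (b : A) : IsNormalized k fun l => F l * b :=
  hF.comp (LinearMap.mulRight k b)

lemma smul_fun (hF : IsNormalized k F) (c : k) : IsNormalized k fun l => c • F l :=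
  hF.comp (LinearMap.lsmul k A c)

lemma add_fun (hF : IsNormalized k F) (hG : IsNormalized k G) :
    IsNormalized k fun l => F l + G l where
  add l a b m := by simp only [hF.add, hG.add]; abel
  smul c l a m := by simp [hF.smul, hG.smul]
  one l m := by simp [hF.one, hG.one]

lemma sum {ι : Type*} (s : Finset ι) (F : ι → List A → A) (hF : ∀ i ∈ s, IsNormalized k (F i)) :
    IsNormalized k fun l => ∑ i ∈ s, F i l where
  add l a b m := by
    rw [← Finset.sum_add_distrib]; exact Finset.sum_congr rfl fun i hi => (hF i hi).add ..
  smul c l a m := by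
    rw [Finset.smul_sum]; exact Finset.sum_congr rfl fun i hi => (hF i hi).smul ..
  one l m := Finset.sum_eq_zero fun i hi => (hF i hi).one ..

end IsNormalized

lemma ofFn_update {α : Type*} {r : ℕ} [DecidableEq (Fin r)] (a : Fin r → α) (i : Fin r) (x : α) :
    List.ofFn (Function.update a i x) =
      (List.ofFn a).take i ++ x :: (List.ofFn a).drop (i + 1) := by
  have h : List.ofFn (Function.update a i x) = (List.ofFn a).set i x := by
    apply List.ext_getElem
    · simp
    · intro n h1 h2
      simp only [List.getElem_ofFn, List.getElem_set, Function.update_apply, Fin.ext_iff, eq_comm]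
  rw [h, List.set_eq_take_append_cons_drop, if_pos (by simp)]

/-- A multilinear map that vanishes when an entry is `1` factors through `Ā`: composed with a linear
section of `A → Ā` it does not change, because every entry changes by a multiple of `1`, and in the
multilinear expansion only the term without such a correction survives. -/
lemma restrict_mem_cochains (r : ℕ) {F : List A → A} (hF : IsNormalized k F) :
    restrict r F ∈ cochains k A r := by
  let m : MultilinearMap k (fun _ : Fin r => A) A :=
    { toFun := restrict r F
      map_update_add' := fun a i x y => by simp only [restrict, ofFn_update, hF.add]
      map_update_smul' := fun a i c x => by simp only [restrict, ofFn_update, hF.smul] }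
  have m_one : ∀ (a : Fin r → A) (i : Fin r), a i ∈ Submodule.span k {(1 : A)} → m a = 0 := by
    intro a i hi
    obtain ⟨c, hc⟩ := Submodule.mem_span_singleton.1 hi
    rw [← Function.update_eq_self i a, ← hc, m.map_update_smul]
    change c • F _ = 0
    rw [ofFn_update, hF.one, smul_zero]
  obtain ⟨σ, hσ⟩ := LinearMap.exists_rightInverse_of_surjective
    (Submodule.span k {(1 : A)}).mkQ (Submodule.range_mkQ _)
  refine ⟨m.compLinearMap fun _ => σ, ?_⟩
  funext a
  change m (fun j => σ (toBar k (a j))) = m a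
  have hd : (fun j => σ (toBar k (a j))) = a + fun j => σ (toBar k (a j)) - a j := by
    funext j; simp
  have hmem : ∀ j, σ (toBar k (a j)) - a j ∈ Submodule.span k {(1 : A)} := fun j => by
    refine (Submodule.Quotient.eq _).1 ?_
    exact LinearMap.congr_fun hσ _
  rw [hd, m.map_add_univ, Finset.sum_eq_single Finset.univ]
  · simp
  · intro s _ hs
    obtain ⟨i, hi⟩ : ∃ i, i ∉ s := by
      by_contra! h
      exact hs (Finset.eq_univ_iff_forall.2 h)
    refine m_one _ i ?_
    simpa [hi] using hmem i
  · simp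

lemma extend_isNormalized {r : ℕ} {f : Fun A r} (hf : f ∈ cochains k A r) :
    IsNormalized k (extend f) := by
  obtain ⟨g, rfl⟩ := hf
  have key : ∀ (l m : List A) (h : l.length < r), l.length + 1 + m.length = r → ∀ x,
      extend (inflate k r g) (l ++ x :: m) = g (Function.update
        (fun j : Fin r => toBar k ((l ++ 0 :: m).getD j 0)) ⟨l.length, h⟩ (toBar k x)) := by
    intro l m h hr x
    have hl : (l ++ x :: m).length = r := by simp; omega
    rw [extend, dif_pos hl]
    change g _ = _
    congr 1
    funext j
    rcases lt_trichotomy (j : ℕ) l.length with hj | hj | hj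
    · rw [Function.update_of_ne (by intro h; simp [h] at hj)]
      simp [hj, List.getD_eq_getElem?_getD, List.getElem?_append]
    · obtain rfl : j = ⟨l.length, h⟩ := Fin.ext hj
      simp
    · rw [Function.update_of_ne (by intro h; simp [h] at hj)]
      obtain ⟨n, hn⟩ : ∃ n, (j : ℕ) = l.length + 1 + n := ⟨j - l.length - 1, by omega⟩
      have hn' : n < m.length := by omega
      simp [List.getD_eq_getElem?_getD, hn,
        Nat.add_assoc, Nat.add_comm 1 n, hn']
  have key0 : ∀ (l m : List A) x, l.length + 1 + m.length ≠ r →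
      extend (inflate k r g) (l ++ x :: m) = 0 := by
    intro l m x h
    rw [extend, dif_neg]
    simp; omega
  refine ⟨fun l a b m => ?_, fun c l a m => ?_, fun l m => ?_⟩ <;>
    by_cases h : l.length + 1 + m.length = r
  · simp only [key l m (by omega) h, map_add, g.map_update_add]
  · simp only [key0 l m _ h, add_zero]
  · simp only [key l m (by omega) h, map_smul, g.map_update_smul]
  · simp only [key0 l m _ h, smul_zero]
  · rw [key l m (by omega) h]
    have : toBar k (1 : A) = 0 :=
      (Submodule.Quotient.mk_eq_zero _).2 (Submodule.mem_span_singleton_self 1)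
    rw [this]
    exact g.map_coord_zero ⟨l.length, by omega⟩ (by simp)
  · exact key0 l m _ h

/-- Lists allow induction on the first argument instead of index arithmetic in `Fin r`; this is the
bridge by which cochains are replaced by functions on lists. -/
lemma mem_cochains_iff {r : ℕ} {f : Fun A r} :
    f ∈ cochains k A r ↔ ∃ F, IsNormalized k F ∧ f = restrict r F :=
  ⟨fun hf => ⟨_, extend_isNormalized hf, (restrict_extend f).symm⟩,
    fun ⟨_, hF, h⟩ => h ▸ restrict_mem_cochains r hF⟩

/-- The Hochschild coboundary without its first term, for functions on lists. -/
def tailD (F : List A → A) : List A → A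
  | [] => 0
  | [a] => -(F [] * a)
  | a :: b :: l => -F (a * b :: l) - tailD (fun m => F (a :: m)) (b :: l)

/-- The Hochschild coboundary for functions on lists. -/
def listD (F : List A → A) : List A → A
  | [] => 0
  | a :: l => a * F l + tailD F (a :: l)

@[simp] lemma tailD_nil (F : List A → A) : tailD F [] = 0 := rfl

@[simp] lemma tailD_singleton (F : List A → A) (a : A) : tailD F [a] = -(F [] * a) := by
  simp [tailD]

lemma tailD_cons_cons (F : List A → A) (a b : A) (l : List A) :
    tailD F (a :: b :: l) = -F (a * b :: l) - tailD (fun m => F (a :: m)) (b :: l) := by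
  simp [tailD]

@[simp] lemma listD_nil (F : List A → A) : listD F [] = 0 := rfl

lemma listD_cons (F : List A → A) (a : A) (l : List A) :
    listD F (a :: l) = a * F l + tailD F (a :: l) := rfl

/-- The first contraction is the first term of the recursion; the others are contractions of the
tail with the first argument frozen, at the cost of one sign. -/
lemma tailD_ofFn (F : List A → A) {r : ℕ} (a : Fin (r + 1) → A) :
    tailD F (List.ofFn a) =
      ∑ i : Fin r, (-1 : k) ^ ((i : ℕ) + 1) • F (List.ofFn (Fin.contractNth i.castSucc (· * ·) a))
        + (-1 : k) ^ (r + 1) • (F (List.ofFn fun j => a j.castSucc) * a (Fin.last r)) := by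
  induction r generalizing F with
  | zero => simp [List.ofFn_succ]
  | succ r ih =>
    have h0 : List.ofFn (Fin.contractNth (Fin.castSucc 0) (· * ·) a) =
        a 0 * a 1 :: List.ofFn fun j : Fin r => a j.succ.succ := by
      rw [List.ofFn_succ]
      congr 1
    have hs : ∀ i : Fin r, List.ofFn (Fin.contractNth (Fin.castSucc i.succ) (· * ·) a) =
        a 0 :: List.ofFn (Fin.contractNth i.castSucc (· * ·) fun j => a j.succ) := fun i => by
      rw [List.ofFn_succ]
      congr 2
      funext j
      simp [Fin.contractNth]
    have ht : List.ofFn a = a 0 :: a 1 :: List.ofFn fun j : Fin r => a j.succ.succ := by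
      rw [List.ofFn_succ, List.ofFn_succ]; rfl
    have ht' : (a 1 :: List.ofFn fun j : Fin r => a j.succ.succ) =
        List.ofFn fun j : Fin (r + 1) => a j.succ := by
      rw [List.ofFn_succ]; rfl
    rw [ht, tailD_cons_cons, ht', ih, Fin.sum_univ_succ, h0]
    simp only [hs, Fin.val_succ, pow_succ (-1 : k) (_ + 1), Fin.val_zero]
    rw [List.ofFn_succ (f := fun j => a (Fin.castSucc j))]
    simp only [mul_neg, mul_one, neg_smul, Finset.sum_neg_distrib, zero_add, pow_one, one_smul,
      Fin.succ_last, Fin.castSucc_zero, Fin.castSucc_succ]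
    abel

lemma coboundary_restrict (r : ℕ) (F : List A → A) :
    coboundary k r (restrict r F) = restrict (r + 1) (listD F) := by
  funext a
  change a 0 * F _ + _ + _ = listD F (List.ofFn a)
  rw [List.ofFn_succ (f := a), listD_cons, ← List.ofFn_succ (f := a), tailD_ofFn (k := k), add_assoc]
  rfl

lemma listD_eq_zero {r : ℕ} {F : List A → A} (hF : restrict r F ∈ cocycles k A r) {l : List A}
    (hl : l.length = r + 1) : listD F l = 0 := by
  have h : restrict (r + 1) (listD F) = 0 := by
    rw [← coboundary_restrict (k := k)]; exact hF.2
  obtain ⟨a, rfl⟩ := exists_ofFn hl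
  exact congrFun h a

lemma mem_cocycles_iff {r : ℕ} {f : Fun A r} :
    f ∈ cocycles k A r ↔
      ∃ F, IsNormalized k F ∧ f = restrict r F ∧ ∀ l : List A, l.length = r + 1 → listD F l = 0 := by
  constructor
  · intro hf
    refine ⟨_, extend_isNormalized hf.1, (restrict_extend f).symm, fun l hl => ?_⟩
    exact listD_eq_zero (k := k) (by rwa [restrict_extend]) hl
  · rintro ⟨F, hF, rfl, h⟩
    refine ⟨restrict_mem_cochains r hF, ?_⟩
    rw [SetLike.mem_coe, LinearMap.mem_ker, coboundary_restrict]
    funext a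
    exact h _ (by simp)

end Lists

/-! ### Linearity of the Hochschild coboundary in the cochain. -/

section Linear

variable {k A : Type u} [Field k] [Ring A] [Algebra k A]

lemma tailD_add (F G : List A → A) (l : List A) :
    tailD (fun m => F m + G m) l = tailD F l + tailD G l := by
  induction l generalizing F G with
  | nil => simp
  | cons a l ih =>
    cases l with
    | nil => simp only [tailD_singleton, add_mul]; abel
    | cons b l => simp only [tailD_cons_cons, ih]; abel

lemma tailD_smul (c : k) (F : List A → A) (l : List A) :
    tailD (fun m => c • F m) l = c • tailD F l := by
  induction l generalizing F with
  | nil => simp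
  | cons a l ih =>
    cases l with
    | nil => simp
    | cons b l => simp only [tailD_cons_cons, ih, smul_sub, smul_neg]

lemma tailD_mul_left (b : A) (F : List A → A) (l : List A) :
    tailD (fun m => b * F m) l = b * tailD F l := by
  induction l generalizing F with
  | nil => simp
  | cons a l ih =>
    cases l with
    | nil => simp [mul_assoc]
    | cons c l => simp only [tailD_cons_cons, ih, mul_sub, mul_neg]

lemma tailD_neg (F : List A → A) (l : List A) : tailD (fun m => -F m) l = -tailD F l := by
  simpa using tailD_mul_left (-1) F l

lemma tailD_sub (F G : List A → A) (l : List A) :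
    tailD (fun m => F m - G m) l = tailD F l - tailD G l := by
  simp only [sub_eq_add_neg, tailD_add, tailD_neg]

lemma tailD_sum {ι : Type*} (s : Finset ι) (F : ι → List A → A) (l : List A) :
    tailD (fun m => ∑ i ∈ s, F i m) l = ∑ i ∈ s, tailD (F i) l := by
  classical
  induction s using Finset.induction_on with
  | empty => simpa using tailD_mul_left 0 (fun _ => 0) l
  | insert i s hi ih => simp only [Finset.sum_insert hi, tailD_add, ih]

lemma listD_smul (c : k) (F : List A → A) (l : List A) :
    listD (fun m => c • F m) l = c • listD F l := by
  cases l with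
  | nil => simp
  | cons a l => simp only [listD_cons, tailD_smul, mul_smul_comm, smul_add]

lemma listD_add (F G : List A → A) (l : List A) :
    listD (fun m => F m + G m) l = listD F l + listD G l := by
  cases l with
  | nil => simp
  | cons a l => simp only [listD_cons, tailD_add, mul_add]; abel

lemma listD_sum {ι : Type*} (s : Finset ι) (F : ι → List A → A) (l : List A) :
    listD (fun m => ∑ i ∈ s, F i m) l = ∑ i ∈ s, listD (F i) l := by
  cases l with
  | nil => simp
  | cons a l => simp only [listD_cons, tailD_sum, Finset.mul_sum, Finset.sum_add_distrib]

end Linear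

/-! ## The cup product -/

section Cup

variable {k A : Type u} [Field k] [Ring A] [Algebra k A]

/-- The cup product of functions on lists, the first of which is taken in degree `m`. -/
def listCup (m : ℕ) (F G : List A → A) : List A → A := fun l => F (l.take m) * G (l.drop m)

lemma cup_restrict (m n : ℕ) (F G : List A → A) :
    cup (restrict m F) (restrict n G) = restrict (m + n) (listCup m F G) := by
  funext a
  have h : List.ofFn a = (List.ofFn fun i => a (Fin.castAdd n i)) ++
      List.ofFn fun j => a (Fin.natAdd m j) := List.ofFn_add
  simp only [cup, restrict, listCup, h]
  rw [List.take_left' (by simp), List.drop_left' (by simp)]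

lemma IsNormalized.listCup (m : ℕ) {F G : List A → A} (hF : IsNormalized k F)
    (hG : IsNormalized k G) : IsNormalized k (listCup m F G) := by
  -- The varying entry lies in the argument of only one of the two factors, and which one depends on
  -- its position alone.
  have h : ∀ l n : List A,
      (∃ l', ∀ x, (l ++ x :: n).take m = l.take m ∧ (l ++ x :: n).drop m = l' ++ x :: n) ∨
      ∃ n' w, ∀ x, (l ++ x :: n).take m = l ++ x :: n' ∧ (l ++ x :: n).drop m = w := by
    intro l n
    rcases le_or_gt m l.length with h | h
    · exact .inl ⟨l.drop m, fun x =>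
        ⟨List.take_append_of_le_length h, List.drop_append_of_le_length h⟩⟩
    · obtain ⟨j, rfl⟩ : ∃ j, m = l.length + (j + 1) := ⟨m - l.length - 1, by omega⟩
      refine .inr ⟨n.take j, n.drop j, fun x => ⟨?_, ?_⟩⟩
      · rw [List.take_length_add_append, List.take_succ_cons]
      · rw [List.drop_length_add_append, List.drop_succ_cons]
  refine ⟨fun l a b n => ?_, fun c l a n => ?_, fun l n => ?_⟩ <;>
    rcases h l n with ⟨l', h⟩ | ⟨n', w, h⟩ <;>
    simp only [TateHochschild.listCup, (h _).1, (h _).2, hF.add, hG.add, mul_add, add_mul, hF.smul,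
      hG.smul, smul_mul_assoc, mul_smul_comm, hF.one, hG.one, mul_zero, zero_mul]

/-- At the cut, the last term of the coboundary of `F` and the first term of that of `G` are the
same product with opposite signs, so the Leibniz rule needs no correction there. The sign counts the
`m` arguments passed. -/
lemma tailD_listCup (m : ℕ) (F G : List A → A) {l : List A} (hl : m < l.length) :
    tailD (listCup m F G) l = tailD F (l.take (m + 1)) * G (l.drop (m + 1)) +
      (-1 : k) ^ m • (F (l.take m) * listD G (l.drop m)) := by
  induction m generalizing F l with
  | zero =>
    obtain ⟨a, l, rfl⟩ := List.exists_cons_of_length_pos hl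
    have : listCup 0 F G = fun m => F [] * G m := by funext m; simp [listCup]
    rw [this, tailD_mul_left]
    simp [listD_cons, mul_add, mul_assoc]
  | succ m ih =>
    obtain ⟨a, l, rfl⟩ := List.exists_cons_of_length_pos (by omega : 0 < l.length)
    obtain ⟨b, l, rfl⟩ := List.exists_cons_of_length_pos (by simp at hl; omega : 0 < l.length)
    have h : (fun n => listCup (m + 1) F G (a :: n)) = listCup m (fun n => F (a :: n)) G := by
      funext n; simp [listCup]
    rw [tailD_cons_cons, h, ih _ (by simpa using hl)]
    simp only [listCup, List.take_succ_cons, List.drop_succ_cons, tailD_cons_cons, pow_succ,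
      sub_mul, neg_mul, mul_neg, mul_one, neg_smul]
    abel

lemma listD_listCup (m : ℕ) (F G : List A → A) {l : List A} (hl : m < l.length) :
    listD (listCup m F G) l = listD F (l.take (m + 1)) * G (l.drop (m + 1)) +
      (-1 : k) ^ m • (F (l.take m) * listD G (l.drop m)) := by
  obtain ⟨a, l, rfl⟩ := List.exists_cons_of_length_pos (by omega : 0 < l.length)
  rw [listD_cons, tailD_listCup (k := k) m F G hl, List.take_succ_cons, listD_cons, add_mul,
    List.drop_succ_cons]
  simp only [listCup, mul_assoc, add_assoc]

lemma cup_mem_cocycles {m n : ℕ} {f : Fun A m} (hf : f ∈ cocycles k A m) {g : Fun A n}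
    (hg : g ∈ cocycles k A n) : cup f g ∈ cocycles k A (m + n) := by
  obtain ⟨F, hF, rfl, hF'⟩ := mem_cocycles_iff.1 hf
  obtain ⟨G, hG, rfl, hG'⟩ := mem_cocycles_iff.1 hg
  refine mem_cocycles_iff.2 ⟨_, hF.listCup m hG, cup_restrict m n F G, fun l hl => ?_⟩
  rw [listD_listCup (k := k) m F G (by omega), hF' _ (by simp; omega), hG' _ (by simp; omega)]
  simp

end Cup

/-! ## The contracting homotopy onto the radical part -/

namespace TwoCycle

variable {k : Type u} [Field k]

/-- The vertex reached from `i` after `n` arrows. -/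
def shift : Fin 2 → ℕ → Fin 2
  | i, 0 => i
  | i, n + 1 => shift (i + 1) n

@[simp] lemma shift_zero (i : Fin 2) : shift i 0 = i := rfl

@[simp] lemma shift_succ (i : Fin 2) (n : ℕ) : shift i (n + 1) = shift (i + 1) n := rfl

lemma two_add (i : Fin 2) : i + 1 + 1 = i := by fin_cases i <;> rfl

lemma shift_two_mul (i : Fin 2) (n : ℕ) : shift i (2 * n) = i := by
  induction n with
  | zero => rfl
  | succ n ih => rw [mul_add, mul_one, shift_succ, shift_succ, two_add, ih]

lemma shift_even (i : Fin 2) {n : ℕ} (hn : Even n) : shift i n = i := by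
  obtain ⟨m, rfl⟩ := hn.exists_two_nsmul
  simpa using shift_two_mul i m

lemma shift_odd (i : Fin 2) {n : ℕ} (hn : Odd n) : shift i n = i + 1 := by
  obtain ⟨m, rfl⟩ := hn
  exact shift_two_mul (i + 1) m

/-- The coefficient of the path `α_i α_{i+1} ⋯` in a list. -/
def pathCoeff : Fin 2 → List (TwoCycle k) → k
  | _, [] => 1
  | i, a :: l => a.arr i * pathCoeff (i + 1) l

variable (k) in
/-- The list `α_i, α_{i+1}, …` of length `n`. -/
def path : Fin 2 → ℕ → List (TwoCycle k)
  | _, 0 => []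
  | i, n + 1 => arrow k i :: path (i + 1) n

@[simp] lemma pathCoeff_nil (i : Fin 2) : pathCoeff i ([] : List (TwoCycle k)) = 1 := rfl

@[simp] lemma pathCoeff_cons (i : Fin 2) (a : TwoCycle k) (l : List (TwoCycle k)) :
    pathCoeff i (a :: l) = a.arr i * pathCoeff (i + 1) l := rfl

@[simp] lemma path_zero (i : Fin 2) : path k i 0 = [] := rfl

@[simp] lemma path_succ (i : Fin 2) (n : ℕ) : path k i (n + 1) = arrow k i :: path k (i + 1) n := rfl

@[simp] lemma length_path (i : Fin 2) (n : ℕ) : (path k i n).length = n := by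
  induction n generalizing i with
  | zero => rfl
  | succ n ih => simp [ih]

lemma pathCoeff_append (i : Fin 2) (l m : List (TwoCycle k)) :
    pathCoeff i (l ++ m) = pathCoeff i l * pathCoeff (shift i l.length) m := by
  induction l generalizing i with
  | nil => simp
  | cons a l ih =>
    simp only [List.cons_append, pathCoeff_cons, ih, mul_assoc, List.length_cons,
      shift_succ]

lemma isNormalized_pathCoeff (i : Fin 2) (x : TwoCycle k) :
    IsNormalized k fun l => pathCoeff i l • x where
  add l a b m := by simp [pathCoeff_append, add_mul, mul_add, add_smul]
  smul c l a m := by simp [pathCoeff_append, smul_smul]; congr 1; ring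
  one l m := by simp [pathCoeff_append]

@[simp] lemma idem_e_self (i : Fin 2) : (idem k i).e i = 1 := by simp [idem]
@[simp] lemma idem_arr (i : Fin 2) : (idem k i).arr = 0 := rfl
@[simp] lemma arrow_e (i : Fin 2) : (arrow k i).e = 0 := rfl
@[simp] lemma arrow_arr_self (i : Fin 2) : (arrow k i).arr i = 1 := by simp [arrow]
lemma idem_mul (i : Fin 2) (a : TwoCycle k) :
    idem k i * a = a.e i • idem k i + a.arr i • arrow k i := by
  ext j <;> fin_cases i <;> fin_cases j <;> simp [idem, arrow]

lemma arrow_mul (i : Fin 2) (a : TwoCycle k) : arrow k i * a = a.e (i + 1) • arrow k i := by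
  ext j <;> fin_cases i <;> fin_cases j <;> simp [arrow]

lemma mul_idem (i : Fin 2) (a : TwoCycle k) :
    a * idem k i = a.e i • idem k i + a.arr (i + 1) • arrow k (i + 1) := by
  ext j <;> fin_cases i <;> fin_cases j <;> simp [idem, arrow]

lemma mul_arrow (i : Fin 2) (a : TwoCycle k) : a * arrow k i = a.e i • arrow k i := by
  ext j <;> fin_cases i <;> fin_cases j <;> simp [arrow]

lemma sum_idem : ∑ i : Fin 2, idem k i = 1 := by
  ext j <;> fin_cases j <;> simp [Fin.sum_univ_two, idem]

/-- The Hochschild coboundary of cochains with left coefficients in the simple module at `i`. -/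
def vertexD (i : Fin 2) (F : List (TwoCycle k) → TwoCycle k) : List (TwoCycle k) → TwoCycle k
  | [] => 0
  | a :: l => a.e i • F l + tailD F (a :: l)

/-- The contracting homotopy for left coefficients in the simple module at `i`. -/
def vertexH : Fin 2 → (List (TwoCycle k) → TwoCycle k) → List (TwoCycle k) → TwoCycle k
  | i, F, [] => F [idem k i]
  | i, F, a :: l =>
    F (idem k i :: a :: l) - a.arr i • vertexH (i + 1) (fun m => F (arrow k i :: m)) l

/-- The evaluation at the path starting at `i`, as a function on lists. -/
def vertexP (i : Fin 2) (F : List (TwoCycle k) → TwoCycle k) : List (TwoCycle k) → TwoCycle k :=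
  fun l => pathCoeff i l • (F (path k i l.length) * idem k (shift i l.length))

lemma vertexH_congr (i : Fin 2) {F G : List (TwoCycle k) → TwoCycle k} {l : List (TwoCycle k)}
    (h : ∀ m : List (TwoCycle k), m.length = l.length + 1 → F m = G m) :
    vertexH i F l = vertexH i G l := by
  induction l generalizing i F G with
  | nil => exact h _ rfl
  | cons a l ih =>
    simp only [vertexH]
    rw [h _ rfl, ih (i + 1) fun m hm => h (arrow k i :: m) (by simp [hm])]

lemma vertexH_add (i : Fin 2) (F G : List (TwoCycle k) → TwoCycle k) (l : List (TwoCycle k)) :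
    vertexH i (fun m => F m + G m) l = vertexH i F l + vertexH i G l := by
  induction l generalizing i F G with
  | nil => rfl
  | cons a l ih => simp only [vertexH, ih, smul_add]; abel

lemma vertexH_mul_left (i : Fin 2) (b : TwoCycle k) (F : List (TwoCycle k) → TwoCycle k)
    (l : List (TwoCycle k)) : vertexH i (fun m => b * F m) l = b * vertexH i F l := by
  induction l generalizing i F with
  | nil => rfl
  | cons a l ih => simp only [vertexH, ih, mul_sub, mul_smul_comm]

lemma vertexH_neg (i : Fin 2) (F : List (TwoCycle k) → TwoCycle k) (l : List (TwoCycle k)) :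
    vertexH i (fun m => -F m) l = -vertexH i F l := by
  simpa using vertexH_mul_left i (-1) F l

lemma isNormalized_vertexH (i : Fin 2) {F : List (TwoCycle k) → TwoCycle k}
    (hF : IsNormalized k F) : IsNormalized k (vertexH i F) := by
  have head : ∀ (a : TwoCycle k) (l : List (TwoCycle k)),
    vertexH i F (a :: l) = F (idem k i :: a :: l)
      - a.arr i • vertexH (i + 1) (fun m => F (arrow k i :: m)) l := fun _ _ => rfl
  constructor
  · intro l
    induction l generalizing i F with
    | nil =>
      intro a b m
      simp only [List.nil_append, vertexH, (hF.cons _).head_add, add_arr, Pi.add_apply, add_smul]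
      abel
    | cons c l ih =>
      intro a b m
      simp only [List.cons_append, vertexH, ih (i + 1) (hF.cons _) (fun _ _ => rfl), smul_add]
      rw [← List.cons_append, ← List.cons_append, hF.add]
      simp only [List.cons_append]
      abel
  · intro c l
    induction l generalizing i F with
    | nil =>
      intro a m
      simp only [List.nil_append, vertexH, (hF.cons _).head_smul, smul_arr, Pi.smul_apply,
        smul_sub, smul_smul, smul_eq_mul]
    | cons b l ih =>
      intro a m
      simp only [List.cons_append, vertexH, ih (i + 1) (hF.cons _) (fun _ _ => rfl)]
      rw [← List.cons_append, ← List.cons_append, hF.smul, smul_sub, smul_comm]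
      simp only [List.cons_append]
  · intro l
    induction l generalizing i F with
    | nil => intro m; simp [vertexH, (hF.cons _).head_one]
    | cons b l ih =>
      intro m
      simp only [List.cons_append, vertexH, ih (i + 1) (hF.cons _) (fun _ _ => rfl)]
      rw [← List.cons_append, ← List.cons_append, hF.one]
      simp

/-- Inserting `e_i` in front would contract the complex if `e_i a` were always a multiple of `e_i`.
Since `e_i a = a.e i • e_i + a.arr i • α_i`, an error with `α_i` in the first slot remains. Freezing
`α_i` there turns the problem into the same one at the vertex `i + 1`, one argument shorter, so the
recursive term corrects the error; what is left at the end of the recursion is the value on the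
path. -/
lemma vertexD_vertexH (i : Fin 2) {F : List (TwoCycle k) → TwoCycle k} (hF : IsNormalized k F)
    (l : List (TwoCycle k)) :
    vertexD i (vertexH i F) l + vertexH i (vertexD i F) l = F l - vertexP i F l := by
  induction l generalizing i F with
  | nil => simp [vertexD, vertexH, vertexP, sub_eq_add_neg]
  | cons a l ih =>
    set Fα : List (TwoCycle k) → TwoCycle k := fun m => F (arrow k i :: m) with hFα
    -- The part of the homotopy beyond the bare insertion of `e_i`; on the empty list there is no
    -- first entry to be an arrow, hence the value `0`.
    let K : List (TwoCycle k) → TwoCycle k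
      | [] => 0
      | b :: m => b.arr i • vertexH (i + 1) Fα m
    have hK : vertexH i F = fun m => F (idem k i :: m) - K m := by
      funext m
      cases m <;> simp [vertexH, K, hFα]
    have tK : tailD K (a :: l) =
        -(a.e i • K l) - a.arr i • vertexD (i + 1) (vertexH (i + 1) Fα) l := by
      cases l with
      | nil => simp [K, vertexD]
      | cons b m =>
        rw [tailD_cons_cons]
        simp only [K, mul_arr, vertexD, tailD_smul, smul_add, add_smul, smul_smul]
        abel
    -- As `α_i` acts by zero on the simple module at `i` and `α_i b = b.e (i + 1) • α_i`, the
    -- coboundary at `i` with first argument `α_i` is minus the coboundary at `i + 1`.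
    have h1 : vertexH (i + 1) (fun m => vertexD i F (arrow k i :: m)) l =
        -vertexH (i + 1) (vertexD (i + 1) Fα) l := by
      rw [← vertexH_neg]
      refine vertexH_congr _ fun m hm => ?_
      obtain ⟨b, m, rfl⟩ := List.exists_cons_of_length_pos (by omega : 0 < m.length)
      simp [vertexD, tailD_cons_cons, arrow_mul, hF.head_smul, hFα]
      abel
    have h2 : vertexH i (vertexD i F) (a :: l) = F (a :: l) - a.e i • F (idem k i :: l)
        - a.arr i • Fα l - tailD (fun m => F (idem k i :: m)) (a :: l)
        + a.arr i • vertexH (i + 1) (vertexD (i + 1) Fα) l := by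
      rw [vertexH, h1]
      simp only [vertexD, tailD_cons_cons, idem_mul, hF.head_add, hF.head_smul, idem_e_self,
        one_smul, hFα]
      module
    have h3 : vertexP i F (a :: l) = a.arr i • vertexP (i + 1) Fα l := by
      simp [vertexP, hFα, smul_smul]
    have h4 : vertexD i (vertexH i F) (a :: l) = a.e i • F (idem k i :: l)
        + tailD (fun m => F (idem k i :: m)) (a :: l)
        + a.arr i • vertexD (i + 1) (vertexH (i + 1) Fα) l := by
      rw [vertexD, hK, tailD_sub, tK, smul_sub]
      abel
    have h5 := congrArg (a.arr i • ·) (ih (i + 1) (hF.cons (arrow k i)))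
    simp only [smul_add, smul_sub, ← hFα] at h5
    rw [h2, h3, h4]
    rw [← sub_eq_zero] at h5 ⊢
    rw [← h5]
    abel

/-- The contracting homotopy onto the paths. -/
def pathH (F : List (TwoCycle k) → TwoCycle k) : List (TwoCycle k) → TwoCycle k :=
  fun l => ∑ i : Fin 2, idem k i * vertexH i F l

lemma isNormalized_pathH {F : List (TwoCycle k) → TwoCycle k} (hF : IsNormalized k F) :
    IsNormalized k (pathH F) :=
  IsNormalized.sum _ _ fun i _ => (isNormalized_vertexH i hF).mul_left _

/-- The decomposition `1 = ∑ e_i` reduces coefficients in `A` to the simple modules. The difference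
is the action of the radical: `a e_i` contributes `a.arr (i + 1) • α_{i+1}`, while the homotopy at
the vertex `i`, applied to the coboundary of `F`, contributes `-a.arr i • α_i` times the homotopy at
`i + 1`; after reindexing these cancel. -/
lemma listD_pathH {F : List (TwoCycle k) → TwoCycle k} (hF : IsNormalized k F)
    (l : List (TwoCycle k)) :
    listD (pathH F) l + pathH (listD F) l = F l - ∑ i : Fin 2, idem k i * vertexP i F l := by
  have key : ∀ i : Fin 2, idem k i * vertexD i (vertexH i F) l
      + idem k i * vertexH i (vertexD i F) l = idem k i * F l - idem k i * vertexP i F l :=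
    fun i => by rw [← mul_add, ← mul_sub, vertexD_vertexH i hF]
  have h : listD (pathH F) l + pathH (listD F) l = ∑ i : Fin 2,
      (idem k i * vertexD i (vertexH i F) l + idem k i * vertexH i (vertexD i F) l) := by
    cases l with
    | nil =>
      simp only [pathH, listD_nil, zero_add, vertexD, mul_zero, vertexH, listD_cons, idem_e_self,
        one_smul, mul_add, ← mul_assoc]
      refine Finset.sum_congr rfl fun i _ => ?_
      rw [idem_mul]
      simp
    | cons a l =>
      have h1 : ∀ i, vertexH i (listD F) (a :: l) = vertexH i (vertexD i F) (a :: l)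
          + (idem k i - 1) * F (a :: l) - a.arr i • (arrow k i * vertexH (i + 1) F l) := by
        intro i
        have h2 : vertexH (i + 1) (fun m => listD F (arrow k i :: m)) l =
            vertexH (i + 1) (fun m => vertexD i F (arrow k i :: m)) l
              + arrow k i * vertexH (i + 1) F l := by
          rw [← vertexH_mul_left, ← vertexH_add]
          congr 1
          funext m
          simp [listD_cons, vertexD, add_comm]
        rw [vertexH, h2, vertexH, listD_cons, vertexD, idem_e_self, one_smul, sub_mul, one_mul,
          smul_add]
        abel
      have h3 : ∀ i, idem k i * (idem k i - 1) = 0 := fun i => by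
        rw [mul_sub, idem_mul]; simp
      have h4 : ∀ i, idem k i * arrow k i = arrow k i := fun i => by rw [idem_mul]; simp
      have h5 : ∀ i, idem k i * vertexH i (listD F) (a :: l) =
          idem k i * vertexH i (vertexD i F) (a :: l)
            - a.arr i • (arrow k i * vertexH (i + 1) F l) := fun i => by
        rw [h1, mul_sub, mul_add, ← mul_assoc, h3, zero_mul, add_zero, mul_smul_comm, ← mul_assoc,
          h4]
      have h6 : listD (pathH F) (a :: l) = ∑ i, (a * idem k i * vertexH i F l
          + idem k i * tailD (vertexH i F) (a :: l)) := by
        rw [listD_cons]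
        change _ + tailD (fun m => ∑ i, idem k i * vertexH i F m) _ = _
        rw [tailD_sum, pathH, Finset.mul_sum, ← Finset.sum_add_distrib]
        simp only [tailD_mul_left, mul_assoc]
      rw [h6, pathH, ← Finset.sum_add_distrib]
      simp only [h5, Fin.sum_univ_two, mul_idem, vertexD, mul_add, add_mul, smul_mul_assoc,
        mul_smul_comm, zero_add, show (1 + 1 : Fin 2) = 0 from rfl]
      abel
  rw [h, Finset.sum_congr rfl fun i _ => key i, Finset.sum_sub_distrib, ← Finset.sum_mul, sum_idem,
    one_mul]

end TwoCycle

namespace TwoCycle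

variable {k : Type u} [Field k]

/-! ## The pairing of cochains and chains -/

variable (k) in
/-- The pairing `⟨f, a₀ ⊗ ⋯ ⊗ a_p⟩ = tr(f(a₁, …, a_p) a₀)` of functions and tuples. -/
def pairing (p : ℕ) : Fun (TwoCycle k) p →ₗ[k] Tup k (TwoCycle k) p →ₗ[k] k where
  toFun f := Finsupp.linearCombination k fun a => tr k (f (fun j => a j.succ) * a 0)
  map_add' f g := by
    ext a
    simp [-AddHom.toFun_eq_coe, add_mul]
  map_smul' c f := by
    ext a
    simp [-AddHom.toFun_eq_coe]

@[simp] lemma pairing_single {p : ℕ} (f : Fun (TwoCycle k) p) (a : Fin (p + 1) → TwoCycle k)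
    (c : k) : pairing k p f (Finsupp.single a c) = c * tr k (f (fun j => a j.succ) * a 0) := by
  simp [pairing]

lemma tr_apply (x : TwoCycle k) : tr k x = x.arr 0 + x.arr 1 := rfl

lemma tr_mul_comm (x y : TwoCycle k) : tr k (x * y) = tr k (y * nakayama k x) :=
  (frobeniusData k).form_ν x y

lemma nakayama_nakayama (x : TwoCycle k) : nakayama k (nakayama k x) = x := by
  ext i <;> simp [two_add]

@[simp] lemma tr_nakayama (x : TwoCycle k) : tr k (nakayama k x) = tr k x := by
  simp [tr_apply, add_comm]

@[simp] lemma nakayama_idem (i : Fin 2) : nakayama k (idem k i) = idem k (i + 1) := by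
  ext j <;> fin_cases i <;> fin_cases j <;> simp [idem]

@[simp] lemma nakayama_arrow (i : Fin 2) : nakayama k (arrow k i) = arrow k (i + 1) := by
  ext j <;> fin_cases i <;> fin_cases j <;> simp [arrow]

lemma eq_of_tr_mul {x y : TwoCycle k} (h : ∀ a, tr k (x * a) = tr k (y * a)) : x = y := by
  have he : ∀ i, x.e i = y.e i := fun i => by
    have := h (arrow k i)
    rw [mul_arrow, mul_arrow] at this
    fin_cases i <;> simpa [tr_apply, arrow] using this
  have ha : ∀ i, x.arr (i + 1) = y.arr (i + 1) := fun i => by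
    have := h (idem k i)
    rw [mul_idem, mul_idem] at this
    fin_cases i <;> simpa [tr_apply, arrow, idem] using this
  ext i
  · exact he i
  · have := ha (i + 1)
    rwa [two_add] at this

lemma eq_of_pairing {p : ℕ} {f g : Fun (TwoCycle k) p}
    (h : ∀ x, pairing k p f x = pairing k p g x) : f = g := by
  funext a
  refine eq_of_tr_mul fun b => ?_
  simpa using h (Finsupp.single (Fin.cons b a) 1)

/-- Every face matches a term of the coboundary without an extra sign; in the first face the twist
`ν⁻¹` is absorbed by `tr(xy) = tr(y ν(x))`. -/
lemma pairing_boundary (p : ℕ) (f : Fun (TwoCycle k) p) (x : Tup k (TwoCycle k) (p + 1)) :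
    pairing k p f (boundary (frobeniusData k) p x) = pairing k (p + 1) (coboundary k p f) x := by
  induction x using Finsupp.induction_linear with
  | zero => simp
  | add x y hx hy => simp only [map_add, hx, hy]
  | single a c =>
    rw [boundary, Finsupp.linearCombination_single, map_smul, map_add, map_add, map_sum]
    simp only [pairing_single, Fin.cons_zero, Fin.cons_succ, smul_eq_mul, one_mul]
    congr 1
    simp only [coboundary, LinearMap.coe_mk, AddHom.coe_mk, add_mul, map_add, Finset.sum_mul,
      map_sum, smul_mul_assoc, map_smul, smul_eq_mul]
    congr 1
    · congr 1
      · rw [← Fin.succ_zero_eq_one, mul_assoc, tr_mul_comm (a _), mul_assoc]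
        rfl
      · refine Finset.sum_congr rfl fun i _ => ?_
        congr 3
        simp [Fin.contractNth, -Fin.val_fin_lt]
        rfl
    · rw [mul_assoc]; rfl

/-- The functional on the space of chains given by a multilinear map on `Ā × ⋯ × Ā`. -/
def chainFunctional {p : ℕ}
    (g : MultilinearMap k (fun _ : Fin p => Bar k (TwoCycle k)) (TwoCycle k)) :
    Chain k (TwoCycle k) p →ₗ[k] k :=
  TensorProduct.lift (LinearMap.lcomp k k (PiTensorProduct.lift g) ∘ₗ
    ((LinearMap.mul k (TwoCycle k)).compr₂ (tr k)).flip)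

lemma chainFunctional_toChain {p : ℕ}
    (g : MultilinearMap k (fun _ : Fin p => Bar k (TwoCycle k)) (TwoCycle k))
    (x : Tup k (TwoCycle k) p) :
    chainFunctional g (toChain k (TwoCycle k) p x) = pairing k p (inflate k p g) x := by
  induction x using Finsupp.induction_linear with
  | zero => simp
  | add x y hx hy => simp only [map_add, hx, hy]
  | single a c => simp [toChain, chainFunctional, inflate, -Submodule.mkQ_apply]

/-- The families `(α_i, e_i)` and `(e_{i+1}, α_i)` are dual under the trace form, so the
coefficients of `f` are the values of `θ` with the dual basis element in the zeroth slot. -/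
lemma exists_chainFunctional {p : ℕ} (θ : Chain k (TwoCycle k) p →ₗ[k] k) :
    ∃ f ∈ cochains k (TwoCycle k) p, ∀ x, pairing k p f x = θ (toChain k (TwoCycle k) p x) := by
  let φ : ∀ a : TwoCycle k, MultilinearMap k (fun _ : Fin p => Bar k (TwoCycle k)) k :=
    fun a => (θ ∘ₗ TensorProduct.mk k _ _ a).compMultilinearMap (PiTensorProduct.tprod k)
  let g : MultilinearMap k (fun _ : Fin p => Bar k (TwoCycle k)) (TwoCycle k) :=
    ∑ i : Fin 2, ((φ (idem k (i + 1))).smulRight (arrow k i) + (φ (arrow k i)).smulRight (idem k i))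
  refine ⟨inflate k p g, ⟨g, rfl⟩, fun x => ?_⟩
  rw [← chainFunctional_toChain]
  congr 1
  refine TensorProduct.ext' fun a b => ?_
  induction b using PiTensorProduct.induction_on with
  | add b c hb hc => simp only [TensorProduct.tmul_add, map_add, hb, hc]
  | smul_tprod c b =>
    simp only [TensorProduct.tmul_smul, map_smul]
    congr 1
    have ha : a = ∑ i : Fin 2, (a.e (i + 1) • idem k (i + 1) + a.arr i • arrow k i) := by
      ext j <;> fin_cases j <;> simp [Fin.sum_univ_two, idem, arrow]
    conv_rhs => rw [ha]
    simp only [chainFunctional, TensorProduct.lift.tmul, LinearMap.comp_apply,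
      LinearMap.lcomp_apply, LinearMap.flip_apply,
      LinearMap.compr₂_apply, LinearMap.mul_apply', g, TensorProduct.sum_tmul,
      TensorProduct.add_tmul, ← TensorProduct.smul_tmul', map_sum, map_add, map_smul]
    simp [φ, Fin.sum_univ_two, tr_apply, arrow, idem]
    ring

lemma pairing_of_mem_relations {p : ℕ} {f : Fun (TwoCycle k) p}
    (hf : f ∈ cochains k (TwoCycle k) p) {x : Tup k (TwoCycle k) p}
    (hx : x ∈ relations k (TwoCycle k) p) : pairing k p f x = 0 := by
  obtain ⟨g, rfl⟩ := hf
  rw [← chainFunctional_toChain, LinearMap.mem_ker.1 hx, map_zero]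

lemma mem_relations {p : ℕ} {x : Tup k (TwoCycle k) p}
    (h : ∀ f ∈ cochains k (TwoCycle k) p, pairing k p f x = 0) :
    x ∈ relations k (TwoCycle k) p := by
  refine LinearMap.mem_ker.2 ((Module.forall_dual_apply_eq_zero_iff k _).1 fun θ => ?_)
  obtain ⟨f, hf, hθ⟩ := exists_chainFunctional θ
  rw [← hθ, h f hf]

/-- Each summand `e_i m α_{i+1}` or `α_i m e_i` is a radical element that starts and ends at `i`,
and there is no arrow from a vertex to itself. -/
lemma norm_eq_zero : norm (frobeniusData k) = 0 := by
  refine Finsupp.lhom_ext fun a c => ?_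
  rw [norm, Finsupp.linearCombination_single]
  funext b
  change c • ∑ i, basis k i * a 0 * (frobeniusData k).v i = 0
  rw [Fintype.sum_sum_type]
  ext j <;> fin_cases j <;>
    simp [basis_inl, basis_inr, frobeniusData, Fin.sum_univ_two, idem, arrow]

lemma mem_cycles_zero (x : Tup k (TwoCycle k) 0) : x ∈ cycles (frobeniusData k) 0 := by
  change _ ∈ LinearMap.ker _
  rw [norm_eq_zero]
  simp

lemma mem_cycles_succ {p : ℕ} {x : Tup k (TwoCycle k) (p + 1)} :
    x ∈ cycles (frobeniusData k) (p + 1) ↔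
      ∀ f ∈ cochains k (TwoCycle k) p, pairing k (p + 1) (coboundary k p f) x = 0 := by
  simp only [← pairing_boundary]
  exact ⟨fun hx f hf => pairing_of_mem_relations hf hx, fun h => mem_relations h⟩

lemma pairing_listD {p : ℕ} {x : Tup k (TwoCycle k) p} (hx : x ∈ cycles (frobeniusData k) p)
    {G : List (TwoCycle k) → TwoCycle k} (hG : IsNormalized k G) :
    pairing k p (restrict p (listD G)) x = 0 := by
  cases p with
  | zero =>
    have : restrict 0 (listD G) = 0 := by funext a; simp [restrict]
    rw [this]; simp
  | succ p =>
    rw [← coboundary_restrict (k := k)]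
    exact mem_cycles_succ.1 hx _ (restrict_mem_cochains p hG)

lemma mem_cycles {p : ℕ} {x : Tup k (TwoCycle k) p}
    (h : ∀ G, IsNormalized k G → pairing k p (restrict p (listD G)) x = 0) :
    x ∈ cycles (frobeniusData k) p := by
  cases p with
  | zero => exact mem_cycles_zero x
  | succ p =>
    refine mem_cycles_succ.2 fun f hf => ?_
    obtain ⟨G, hG, rfl⟩ := mem_cochains_iff.1 hf
    rw [coboundary_restrict]
    exact h G hG

/-- A chain that is not a boundary is separated from the boundaries by a functional. This functional
is the pairing with a cochain, which is a cocycle because it annihilates all boundaries and the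
pairing is nondegenerate. -/
lemma toChain_mem_chainBoundaries {p : ℕ} {x : Tup k (TwoCycle k) p}
    (h : ∀ f ∈ cocycles k (TwoCycle k) p, pairing k p f x = 0) :
    toChain k (TwoCycle k) p x ∈ chainBoundaries (frobeniusData k) p := by
  by_contra hx
  obtain ⟨θ, hθ, hθ'⟩ := Submodule.exists_le_ker_of_notMem hx
  obtain ⟨f, hf, hfθ⟩ := exists_chainFunctional θ
  refine hθ ?_
  rw [← hfθ]
  refine h f ⟨hf, LinearMap.mem_ker.2 (eq_of_pairing fun y => ?_)⟩
  rw [← pairing_boundary, hfθ, map_zero, LinearMap.zero_apply]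
  exact hθ' (Submodule.mem_map_of_mem (LinearMap.mem_range_self _ y))

lemma mem_cocycles {r : ℕ} {f : Fun (TwoCycle k) r} (hf : f ∈ cochains k (TwoCycle k) r)
    (h : ∀ x, pairing k (r + 1) (coboundary k r f) x = 0) : f ∈ cocycles k (TwoCycle k) r :=
  ⟨hf, LinearMap.mem_ker.2 (eq_of_pairing fun x => by rw [h]; simp)⟩

end TwoCycle

namespace TwoCycle

variable {k : Type u} [Field k]

/-! ## Dual generators of the cohomology and the homology -/

variable (k) in
/-- The value of the standard cocycle of degree `r` at the path starting at `i`. -/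
def repCoeff (r : ℕ) (i : Fin 2) : TwoCycle k :=
  if Even r then idem k i else (1 / 2 : k) • arrow k i

variable (k) in
/-- The first entry of the standard cycle of degree `r` along the path starting at `i`. -/
def cycCoeff (r : ℕ) (i : Fin 2) : TwoCycle k :=
  if Even r then (1 / 2 : k) • arrow k i else idem k (i + 1)

variable (k) in
/-- The standard cocycle of degree `r`, as a function on lists. -/
def listRep (r : ℕ) : List (TwoCycle k) → TwoCycle k :=
  fun l => ∑ i : Fin 2, pathCoeff i l • repCoeff k r i

variable (k) in
/-- The standard cocycle of degree `r`. -/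
def rep (r : ℕ) : Fun (TwoCycle k) r := restrict r (listRep k r)

variable (k) in
/-- The standard cycle of degree `r`, along the paths of length `r`. -/
def cyc (r : ℕ) : Tup k (TwoCycle k) r :=
  ∑ i : Fin 2, Finsupp.single
    (Fin.cons (cycCoeff k r i) fun j : Fin r => arrow k (shift i j)) 1

@[simp] lemma idem_succ_e (i : Fin 2) : (idem k (i + 1)).e i = 0 := by
  fin_cases i <;> simp [idem]

@[simp] lemma arrow_succ_arr (i : Fin 2) : (arrow k (i + 1)).arr i = 0 := by
  fin_cases i <;> simp [arrow]

lemma ofFn_arrow_shift (i : Fin 2) (r : ℕ) :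
    (List.ofFn fun j : Fin r => arrow k (shift i j)) = path k i r := by
  induction r generalizing i with
  | zero => simp
  | succ r ih => simp [List.ofFn_succ, ih]

lemma pairing_cyc (r : ℕ) (F : List (TwoCycle k) → TwoCycle k) :
    pairing k r (restrict r F) (cyc k r) =
      ∑ i : Fin 2, tr k (F (path k i r) * cycCoeff k r i) := by
  simp [cyc, restrict, ofFn_arrow_shift]

lemma pathCoeff_path_succ (i j : Fin 2) (n : ℕ) :
    pathCoeff i (path k j (n + 1)) = if i = j then 1 else 0 := by
  induction n generalizing i j with
  | zero => fin_cases i <;> fin_cases j <;> simp [arrow]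
  | succ n ih =>
    rw [path_succ, pathCoeff_cons, ih]
    fin_cases i <;> fin_cases j <;> simp [arrow]

lemma tr_repCoeff_mul_cycCoeff (r : ℕ) (i j : Fin 2) :
    tr k (repCoeff k r i * cycCoeff k r j) = if i = j then 1 / 2 else 0 := by
  unfold repCoeff cycCoeff
  split_ifs with h hij hij
  all_goals fin_cases i <;> fin_cases j <;> simp_all [tr_apply, idem, arrow]

/-- In degree `0` both paths are empty and `pathCoeff` does not distinguish them; the trace factor
does, so the product is diagonal in every degree. -/
lemma pathCoeff_path_mul_tr (r : ℕ) (i j : Fin 2) :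
    pathCoeff i (path k j r) * tr k (repCoeff k r i * cycCoeff k r j) =
      if i = j then 1 / 2 else 0 := by
  rw [tr_repCoeff_mul_cycCoeff]
  cases r with
  | zero => simp
  | succ r => rw [pathCoeff_path_succ]; split_ifs <;> simp

lemma pairing_rep_cyc (h2 : (2 : k) ≠ 0) (r : ℕ) : pairing k r (rep k r) (cyc k r) = 1 := by
  rw [rep, pairing_cyc]
  simp only [listRep, Finset.sum_mul, map_sum, smul_mul_assoc, map_smul, smul_eq_mul,
    pathCoeff_path_mul_tr]
  simp
  field_simp

lemma isNormalized_listRep (r : ℕ) : IsNormalized k (listRep k r) :=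
  IsNormalized.sum _ _ fun i _ => isNormalized_pathCoeff i _

/-- The coboundary of the cochain with value `e` at the endpoint of the path starting at `i`. -/
lemma tailD_pathCoeff_idem (i : Fin 2) (a : TwoCycle k) (l : List (TwoCycle k)) :
    tailD (fun m => pathCoeff i m • idem k (shift i m.length)) (a :: l) =
      -((a.e i * pathCoeff i l) • idem k (shift i l.length))
        + ((-1) ^ (l.length + 1) * pathCoeff i (a :: l)) • arrow k (shift i l.length) := by
  induction l generalizing i a with
  | nil =>
    simp only [tailD_singleton, pathCoeff_nil, one_smul, List.length_nil, shift_zero, idem_mul,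
      pathCoeff_cons]
    module
  | cons b m ih =>
    have h : (fun n : List (TwoCycle k) =>
        pathCoeff i (a :: n) • idem k (shift i (a :: n).length)) =
        fun n => a.arr i • pathCoeff (i + 1) n • idem k (shift (i + 1) n.length) := by
      funext n; simp [smul_smul]
    rw [tailD_cons_cons, h, tailD_smul, ih]
    simp only [pathCoeff_cons, mul_arr, List.length_cons, shift_succ]
    module

lemma tailD_pathCoeff_arrow (i : Fin 2) (a : TwoCycle k) (l : List (TwoCycle k)) :
    tailD (fun m => pathCoeff i m • arrow k (shift i (m.length + 1))) (a :: l) =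
      -((a.e i * pathCoeff i l) • arrow k (shift i (l.length + 1))) := by
  induction l generalizing i a with
  | nil => simp [arrow_mul, two_add]
  | cons b m ih =>
    have h : (fun n : List (TwoCycle k) =>
        pathCoeff i (a :: n) • arrow k (shift i ((a :: n).length + 1))) =
        fun n => a.arr i • pathCoeff (i + 1) n • arrow k (shift (i + 1) (n.length + 1)) := by
      funext n; simp [smul_smul]
    rw [tailD_cons_cons, h, tailD_smul, ih]
    simp only [pathCoeff_cons, mul_arr, List.length_cons, shift_succ]
    module

lemma tailD_congr {A : Type*} [Ring A] {F G : List A → A} {l : List A}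
    (h : ∀ m : List A, m.length + 1 = l.length → F m = G m) : tailD F l = tailD G l := by
  induction l generalizing F G with
  | nil => rfl
  | cons a l ih =>
    cases l with
    | nil => simp [h [] rfl]
    | cons b l =>
      rw [tailD_cons_cons, tailD_cons_cons, h _ (by simp), ih fun m hm => h (a :: m) (by simpa using hm)]

/-- The inner contractions cancel, leaving the two ends: multiplication by the first arrow brings `z
(i + 1)`, multiplication by the last one brings `-z i`, the sign being that of odd length. -/
lemma listD_idem (z : Fin 2 → k) {l : List (TwoCycle k)} (hl : Odd l.length) :
    listD (fun m => ∑ i : Fin 2, pathCoeff i m • z i • idem k i) l =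
      ∑ i : Fin 2, (z (i + 1) - z i) • pathCoeff i l • arrow k i := by
  obtain ⟨a, l, rfl⟩ := List.exists_cons_of_length_pos hl.pos
  have hl' : Even l.length := by simpa [Nat.odd_add_one] using hl
  have h : ∀ i, tailD (fun m => pathCoeff i m • z i • idem k i) (a :: l) =
      z i • tailD (fun m => pathCoeff i m • idem k (shift i m.length)) (a :: l) := by
    intro i
    rw [← tailD_smul]
    refine tailD_congr fun m hm => ?_
    rw [shift_even i (by simp at hm; rwa [hm]), smul_comm]
  rw [listD_cons, tailD_sum]
  simp only [h, tailD_pathCoeff_idem, shift_even _ hl', pow_succ, hl'.neg_one_pow]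
  simp only [Fin.sum_univ_two, mul_add, mul_smul_comm, mul_idem, pathCoeff_cons, zero_add,
    show (1 + 1 : Fin 2) = 0 from rfl]
  module

lemma listD_arrow {l : List (TwoCycle k)} (hl : Even l.length) (c : k) :
    listD (fun m => ∑ i : Fin 2, pathCoeff i m • c • arrow k i) l = 0 := by
  cases l with
  | nil => rfl
  | cons a l =>
    have hl' : Odd l.length := by
      rw [List.length_cons, Nat.even_add_one, Nat.not_even_iff_odd] at hl
      exact hl
    have h : ∀ i, tailD (fun m => pathCoeff i m • c • arrow k i) (a :: l) =
        c • tailD (fun m => pathCoeff i m • arrow k (shift i (m.length + 1))) (a :: l) := by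
      intro i
      rw [← tailD_smul]
      refine tailD_congr fun m hm => ?_
      have hm' : Even (m.length + 1) := by rw [hm]; exact hl
      rw [shift_even i hm', smul_comm]
    rw [listD_cons, tailD_sum]
    simp only [h, tailD_pathCoeff_arrow, shift_even _ hl'.add_one]
    simp only [Fin.sum_univ_two, mul_add, mul_smul_comm, mul_arrow]
    module

lemma listD_listRep {r : ℕ} {l : List (TwoCycle k)} (hl : l.length = r + 1) :
    listD (listRep k r) l = 0 := by
  by_cases hr : Even r
  · have := listD_idem (fun _ => (1 : k)) (l := l) (by rw [hl]; exact hr.add_one)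
    simp only [one_smul, sub_self, zero_smul, Finset.sum_const_zero] at this
    have h : listRep k r = fun m => ∑ i : Fin 2, pathCoeff i m • idem k i := by
      funext m; simp only [listRep, repCoeff, if_pos hr]
    rw [h, this]
  · have := listD_arrow (l := l) (by rw [hl, Nat.even_add_one]; exact hr) (1 / 2 : k)
    have h : listRep k r = fun m => ∑ i : Fin 2, pathCoeff i m • (1 / 2 : k) • arrow k i := by
      funext m; simp only [listRep, repCoeff, if_neg hr]
    rw [h, this]

lemma rep_mem_cocycles (r : ℕ) : rep k r ∈ cocycles k (TwoCycle k) r :=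
  mem_cocycles_iff.2 ⟨_, isNormalized_listRep r, rfl, fun _ hl => listD_listRep hl⟩

/-- Consecutive arrows multiply to zero, so only the term that multiplies by the last arrow
survives. -/
lemma tailD_path (F : List (TwoCycle k) → TwoCycle k) (i : Fin 2) (n : ℕ) (hF : IsNormalized k F) :
    tailD F (path k i (n + 1)) =
      (-1 : k) ^ (n + 1) • (F (path k i n) * arrow k (shift i n)) := by
  induction n generalizing i F with
  | zero => simp
  | succ n ih =>
    rw [path_succ, path_succ, tailD_cons_cons, ← path_succ, ih _ _ (hF.cons _), arrow_mul]
    simp [hF.head_zero, pow_succ]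

/-- This is the coefficient of `α_i` in the cocycle condition on the path of length `r + 1`, where
only the two end terms are present. -/
lemma e_path_succ {r : ℕ} {F : List (TwoCycle k) → TwoCycle k} (hF : IsNormalized k F)
    (hF' : ∀ l : List (TwoCycle k), l.length = r + 1 → listD F l = 0) (hr : Even r) (i : Fin 2) :
    (F (path k (i + 1) r)).e (i + 1) = (F (path k i r)).e i := by
  have h := hF' (path k i (r + 1)) (by simp)
  rw [path_succ, listD_cons, ← path_succ, tailD_path F i r hF, shift_even i hr, arrow_mul,
    mul_arrow, pow_succ, hr.neg_one_pow] at h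
  have := congrArg (fun x => x.arr i) h
  simp only [add_arr, smul_arr, Pi.add_apply, Pi.smul_apply, arrow_arr_self, smul_eq_mul,
    zero_arr, Pi.zero_apply] at this
  linear_combination this

/-- Up to a coboundary, a cocycle is a multiple of the standard cocycle. -/
lemma exists_eq_smul_listRep (h2 : (2 : k) ≠ 0) {r : ℕ} {F : List (TwoCycle k) → TwoCycle k}
    (hF : IsNormalized k F) (hF' : ∀ l : List (TwoCycle k), l.length = r + 1 → listD F l = 0) :
    ∃ G, IsNormalized k G ∧ ∀ l : List (TwoCycle k), l.length = r →
      F l = pairing k r (restrict r F) (cyc k r) • listRep k r l + listD G l := by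
  have hP : ∀ l : List (TwoCycle k), l.length = r →
      F l = ∑ i : Fin 2, idem k i * vertexP i F l + listD (pathH F) l := by
    intro l hl
    have h : pathH (listD F) l = 0 := Finset.sum_eq_zero fun i _ => by
      -- The zero function is written as a product with `0`, so that compatibility of the homotopy
      -- with left multiplication shows that it is sent to zero.
      rw [vertexH_congr i (G := fun _ => (0 : TwoCycle k) * 0)
        (fun m hm => by rw [hF' m (by omega), mul_zero]), vertexH_mul_left]
      simp
    have := listD_pathH hF l
    rw [h, add_zero] at this
    rw [this]; abel
  by_cases hr : Even r
  · refine ⟨pathH F, isNormalized_pathH hF, fun l hl => ?_⟩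
    rw [hP l hl]
    congr 1
    have he : (F (path k 1 r)).e 1 = (F (path k 0 r)).e 0 := e_path_succ hF hF' hr 0
    have hv : ∀ i, idem k i * vertexP i F l = pathCoeff i l • (F (path k 0 r)).e 0 • idem k i := by
      intro i
      have : (F (path k i r)).e i = (F (path k 0 r)).e 0 := by fin_cases i <;> simp [he]
      simp [vertexP, hl, shift_even i hr, mul_idem, idem_mul, this, smul_smul]
    have hc : pairing k r (restrict r F) (cyc k r) = (F (path k 0 r)).e 0 := by
      rw [pairing_cyc]
      simp only [cycCoeff, if_pos hr, mul_smul_comm, mul_arrow, map_smul, smul_eq_mul,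
        Fin.sum_univ_two, he]
      simp [tr_apply, arrow]
      field_simp
      ring
    simp only [hc, hv, listRep, repCoeff, if_pos hr, Finset.smul_sum]
    exact Finset.sum_congr rfl fun i _ => smul_comm _ _ _
  · have hr' : Odd r := Nat.not_even_iff_odd.1 hr
    set d : k := (F (path k 0 r)).arr 0 - (F (path k 1 r)).arr 1 with hd
    -- Chosen so that `z 1 - z 0 = d / 2`: the coboundary of `listD_idem` then adds `±d / 2` to the
    -- mean of the two coefficients and restores both.
    let z : Fin 2 → k := ![-(d / 4), d / 4]
    refine ⟨fun l => pathH F l + ∑ i : Fin 2, pathCoeff i l • z i • idem k i,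
      (isNormalized_pathH hF).add_fun
        (IsNormalized.sum _ _ fun i _ => isNormalized_pathCoeff i _), fun l hl => ?_⟩
    rw [hP l hl, listD_add, listD_idem z (by rwa [hl])]
    have hv : ∀ i, idem k i * vertexP i F l =
        pathCoeff i l • (F (path k i r)).arr i • arrow k i := by
      intro i
      simp [vertexP, hl, shift_odd i hr', mul_idem, idem_mul, two_add, smul_smul]
    have hc : pairing k r (restrict r F) (cyc k r) =
        (F (path k 0 r)).arr 0 + (F (path k 1 r)).arr 1 := by
      rw [pairing_cyc]
      simp only [cycCoeff, if_neg hr, mul_idem, two_add, Fin.sum_univ_two]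
      simp [tr_apply, arrow, idem]
    have h4 : (4 : k) ≠ 0 := by
      rw [show (4 : k) = 2 * 2 by norm_num]; exact mul_ne_zero h2 h2
    simp only [hv, hc, listRep, repCoeff, if_neg hr, Fin.sum_univ_two, z, hd]
    simp only [Matrix.cons_val_zero, Matrix.cons_val_one, zero_add, smul_smul, smul_add,
      show (1 + 1 : Fin 2) = 0 from rfl]
    match_scalars <;> field_simp <;> ring

/-- The pairing of a cocycle with a cycle, in terms of the dual generators. -/
lemma pairing_eq_mul (h2 : (2 : k) ≠ 0) {r : ℕ} {f : Fun (TwoCycle k) r}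
    (hf : f ∈ cocycles k (TwoCycle k) r) {x : Tup k (TwoCycle k) r}
    (hx : x ∈ cycles (frobeniusData k) r) :
    pairing k r f x = pairing k r f (cyc k r) * pairing k r (rep k r) x := by
  obtain ⟨F, hF, rfl, hF'⟩ := mem_cocycles_iff.1 hf
  obtain ⟨G, hG, h⟩ := exists_eq_smul_listRep h2 hF hF'
  have h' : restrict r F =
      pairing k r (restrict r F) (cyc k r) • rep k r + restrict r (listD G) := by
    funext a
    exact h _ (by simp)
  conv_lhs => rw [h']
  simp [pairing_listD hx hG]

/-- On a path a coboundary has only its two end terms. If the degree is odd, these cancel between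
the two paths after taking traces; if it is positive and even, the coefficient `α_i` together with
the arrow already present gives a product of two radical elements. -/
lemma cyc_mem_cycles (r : ℕ) : cyc k r ∈ cycles (frobeniusData k) r := by
  refine mem_cycles fun G hG => ?_
  rw [pairing_cyc]
  cases r with
  | zero => simp
  | succ r =>
    simp only [path_succ, listD_cons]
    simp only [← path_succ, tailD_path G _ r hG]
    by_cases hr : Even r
    · have hr' : ¬ Even (r + 1) := by rw [Nat.even_add_one]; simpa using hr
      simp only [cycCoeff, if_neg hr', shift_even _ hr, pow_succ, hr.neg_one_pow, arrow_mul, mul_arrow,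
        Fin.sum_univ_two]
      simp [tr_apply, arrow, idem]
    · have hr' : Even (r + 1) := by rwa [Nat.even_add_one]
      simp only [cycCoeff, if_pos hr', arrow_mul, mul_arrow, add_mul, smul_mul_assoc,
        mul_smul_comm, arrow_e, Pi.zero_apply, zero_smul, smul_zero, add_zero, map_zero,
        Finset.sum_const_zero]

end TwoCycle

namespace TwoCycle

variable {k : Type u} [Field k]

/-! ## Products with chains and their adjoints -/

lemma pairing_eq_sum {p : ℕ} (f : Fun (TwoCycle k) p) (x : Tup k (TwoCycle k) p) :
    pairing k p f x = x.sum fun a c => c * tr k (f (fun j => a j.succ) * a 0) := by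
  simp [pairing, Finsupp.linearCombination_apply]

lemma pairing_capRight {m q : ℕ} (f : Fun (TwoCycle k) q) (x : Tup k (TwoCycle k) (m + q))
    (g : Fun (TwoCycle k) m) :
    pairing k q f (capRight (frobeniusData k) x g) = pairing k (m + q) (cup g f) x := by
  rw [pairing_eq_sum _ x, capRight, map_finsuppSum]
  refine Finsupp.sum_congr fun a _ => ?_
  simp only [pairing_single, Fin.cons_zero, Fin.cons_succ, cup]
  rw [mul_assoc, tr_mul_comm (g _), mul_assoc]
  rfl

lemma pairing_capLeft {m q : ℕ} (f : Fun (TwoCycle k) q) (x : Tup k (TwoCycle k) (q + m))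
    (g : Fun (TwoCycle k) m) :
    pairing k q f (capLeft g x) = pairing k (q + m) (cup f g) x := by
  rw [pairing_eq_sum _ x, capLeft, map_finsuppSum]
  refine Finsupp.sum_congr fun a _ => ?_
  simp only [pairing_single, Fin.cons_zero, Fin.cons_succ, cup, mul_assoc]

lemma pairing_negMul {p q : ℕ} (f : Fun (TwoCycle k) (q + (p + 1))) (x : Tup k (TwoCycle k) p)
    (y : Tup k (TwoCycle k) q) :
    pairing k _ f (negMul (frobeniusData k) x y) = x.sum fun a c => y.sum fun b d => (c * d) *
      ∑ i, tr k (f (Fin.append (Fin.tail b) (Fin.cons ((frobeniusData k).u i * nakayama k (a 0))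
        (Fin.tail a) : Fin (p + 1) → TwoCycle k)) * ((frobeniusData k).v i * b 0)) := by
  simp only [negMul, map_finsuppSum, map_sum, pairing_single, Fin.cons_zero, Fin.cons_succ,
    Finset.mul_sum]
  rfl

/-- The coefficient `b₀` that the pairing multiplies on the right joins `v_i` to form the zeroth
entry `v_i b₀` of the product of chains, so multiplication of cochains by `x` on the right is the
transpose of multiplication of chains by `x` on the left. -/
lemma pairing_mixLeft {s p : ℕ} (f : Fun (TwoCycle k) (s + (p + 1))) (x : Tup k (TwoCycle k) p)
    (y : Tup k (TwoCycle k) s) :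
    pairing k s (mixLeft (frobeniusData k) f x) y =
      pairing k _ f (negMul (frobeniusData k) x y) := by
  rw [pairing_negMul, Finsupp.sum_comm, pairing_eq_sum]
  refine Finsupp.sum_congr fun b _ => ?_
  simp only [mixLeft, Finsupp.sum, Finset.sum_mul, map_sum, Finset.mul_sum, smul_mul_assoc,
    map_smul, smul_eq_mul, mul_assoc]
  refine Finset.sum_congr rfl fun a _ => Finset.sum_congr rfl fun i _ => ?_
  rw [mul_left_comm]
  rfl

lemma sum_u_v {M : Type*} [AddCommMonoid M] (Φ : TwoCycle k → TwoCycle k → M) :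
    ∑ i, Φ ((frobeniusData k).u i) ((frobeniusData k).v i) =
      ∑ i : Fin 2, (Φ (idem k i) (arrow k (i + 1)) + Φ (arrow k i) (idem k i)) := by
  rw [Fintype.sum_sum_type, ← Finset.sum_add_distrib]
  refine Finset.sum_congr rfl fun i _ => ?_
  change Φ (basis k _) (arrow k (i + 1)) + Φ (basis k _) (idem k i) = _
  rw [basis_inl, basis_inr]

/-- The Casimir identity `∑ z u_i ⊗ v_i = ∑ u_i ⊗ v_i z`, in the form in which it is applied. -/
lemma sum_mul_u_v (Y : TwoCycle k →ₗ[k] TwoCycle k) (z : TwoCycle k) :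
    ∑ i, Y (z * (frobeniusData k).u i) * (frobeniusData k).v i =
      ∑ i, Y ((frobeniusData k).u i) * ((frobeniusData k).v i * z) := by
  rw [sum_u_v fun u v => Y (z * u) * v, sum_u_v fun u v => Y u * (v * z)]
  simp only [mul_idem, mul_arrow, idem_mul, arrow_mul, map_add, map_smul, add_mul, mul_add,
    smul_mul_assoc, mul_smul_comm, Fin.sum_univ_two, zero_add, show (1 + 1 : Fin 2) = 0 from rfl]
  abel

/-- The twisted symmetry `∑ u_i ν(b) ⊗ v_i = ∑ v_i ⊗ b ν(u_i)` of the Casimir element, again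
evaluated through a linear map. -/
lemma sum_u_mul_v (Y : TwoCycle k →ₗ[k] TwoCycle k) (b : TwoCycle k) :
    ∑ i, Y ((frobeniusData k).u i * nakayama k b) * (frobeniusData k).v i =
      ∑ i, Y ((frobeniusData k).v i) * (b * nakayama k ((frobeniusData k).u i)) := by
  rw [sum_u_v fun u v => Y (u * nakayama k b) * v, sum_u_v fun u v => Y v * (b * nakayama k u)]
  simp only [nakayama_idem, nakayama_arrow, mul_idem, mul_arrow, idem_mul, arrow_mul, map_add,
    map_smul, add_mul, mul_add, nakayama_e, nakayama_arr,
    smul_mul_assoc, mul_smul_comm, Fin.sum_univ_two, zero_add, show (1 + 1 : Fin 2) = 0 from rfl]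
  abel

lemma sum_u_mul_mul_v (x : TwoCycle k) :
    ∑ i, (frobeniusData k).u i * x * (frobeniusData k).v i = 0 := by
  rw [sum_u_v fun u v => u * x * v]
  ext j <;> fin_cases j <;> simp [Fin.sum_univ_two, idem, arrow]

lemma sum_tr_mixRight (Y : TwoCycle k →ₗ[k] TwoCycle k) (a b : TwoCycle k) :
    ∑ i, tr k ((frobeniusData k).u i * nakayama k a * Y ((frobeniusData k).v i) * b) =
      ∑ i, tr k (Y ((frobeniusData k).u i * nakayama k b) * ((frobeniusData k).v i * a)) := by
  have h := congrArg (fun x => tr k (x * a)) (sum_u_mul_v Y b)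
  simp only [Finset.sum_mul, map_sum, mul_assoc] at h
  simp only [mul_assoc]
  rw [h]
  refine Finset.sum_congr rfl fun i _ => ?_
  rw [← mul_assoc _ (nakayama k a), tr_mul_comm, _root_.map_mul (nakayama k), nakayama_nakayama]
  simp only [mul_assoc]

/-- Here `v_i` and `u_i` have to exchange places, which uses the symmetry of the Casimir element and
hence linearity of `f` in the slot of `v_i`; this is why `f` has to be a cochain. -/
lemma pairing_mixRight {s p : ℕ} {f : Fun (TwoCycle k) (p + (s + 1))}
    (hf : f ∈ cochains k (TwoCycle k) (p + (s + 1))) (x : Tup k (TwoCycle k) p)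
    (y : Tup k (TwoCycle k) s) :
    pairing k s (mixRight (frobeniusData k) x f) y =
      pairing k _ f (negMul (frobeniusData k) y x) := by
  obtain ⟨F, hF, rfl⟩ := mem_cochains_iff.1 hf
  rw [pairing_negMul, pairing_eq_sum]
  refine Finsupp.sum_congr fun b _ => ?_
  simp only [mixRight, Finsupp.sum, Finset.sum_mul, map_sum, Finset.mul_sum, smul_mul_assoc,
    map_smul, smul_eq_mul]
  refine Finset.sum_congr rfl fun a _ => ?_
  simp only [← Finset.mul_sum, mul_assoc]
  congr 2
  let Y : TwoCycle k →ₗ[k] TwoCycle k :=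
    { toFun := fun z => F (List.ofFn (Fin.tail a) ++ z :: List.ofFn (Fin.tail b))
      map_add' := fun _ _ => hF.add _ _ _ _
      map_smul' := fun _ _ => hF.smul _ _ _ _ }
  have h := sum_tr_mixRight Y (a 0) (b 0)
  simp only [restrict, List.ofFn_fin_append, List.ofFn_cons]
  simp only [mul_assoc] at h
  exact h

/-! ## The Leibniz rule for products with chains -/

/-- Splits the coboundary at the seam between `z` and `w`. The left part, with the right entries
frozen, has a last term that the full coboundary lacks; the summand `G (b ++ w :: l) * z`
compensates for it. -/
lemma tailD_append (G : List (TwoCycle k) → TwoCycle k) (b : List (TwoCycle k)) (z w : TwoCycle k)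
    (l : List (TwoCycle k)) :
    tailD G (b ++ z :: w :: l) = tailD (fun m => G (m ++ w :: l)) (b ++ [z]) +
      (-1 : k) ^ b.length • (G (b ++ w :: l) * z - G (b ++ (z * w) :: l)
        - tailD (fun m => G (b ++ z :: m)) (w :: l)) := by
  induction b generalizing G with
  | nil =>
    simp [tailD_cons_cons]
    abel
  | cons c b ih =>
    cases b with
    | nil =>
      have := ih fun m => G (c :: m)
      simp only [List.nil_append, List.length_nil, pow_zero, one_smul, List.cons_append] at this ⊢
      rw [tailD_cons_cons, this, tailD_cons_cons]
      simp
      abel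
    | cons d b =>
      have := ih fun m => G (c :: m)
      simp only [List.cons_append, List.length_cons, pow_succ, mul_neg, mul_one, neg_smul,
        neg_neg] at this ⊢
      rw [tailD_cons_cons, this, tailD_cons_cons]
      simp only [List.append_assoc, List.cons_append, List.nil_append]
      abel

lemma tailD_mul_right (F : List (TwoCycle k) → TwoCycle k) (b : List (TwoCycle k))
    (z v : TwoCycle k) :
    tailD (fun m => F m * v) (b ++ [z]) = tailD F (b ++ [z]) * v +
      (-1 : k) ^ b.length • (F b * z * v - F b * v * z) := by
  induction b generalizing F with
  | nil =>
    simp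
    abel
  | cons c b ih =>
    cases b with
    | nil =>
      simp only [List.cons_append, List.nil_append, tailD_cons_cons, tailD_singleton,
        List.length_cons, List.length_nil]
      simp [add_mul]
    | cons d b =>
      have := ih fun m => F (c :: m)
      simp only [List.cons_append, List.length_cons, pow_succ, mul_neg, mul_one, neg_smul,
        neg_neg] at this ⊢
      rw [tailD_cons_cons, this, tailD_cons_cons, sub_mul, neg_mul]
      abel

/-- The product `G ⋆ (a₀ ⊗ a)`, as a function on lists. -/
def listMixLeft (G : List (TwoCycle k) → TwoCycle k) (a₀ : TwoCycle k) (a : List (TwoCycle k)) :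
    List (TwoCycle k) → TwoCycle k :=
  fun l => ∑ i, G (l ++ ((frobeniusData k).u i * nakayama k a₀) :: a) * (frobeniusData k).v i

/-- The product `(b₀ ⊗ b) ⋆ G`, as a function on lists. -/
def listMixRight (G : List (TwoCycle k) → TwoCycle k) (b₀ : TwoCycle k) (b : List (TwoCycle k)) :
    List (TwoCycle k) → TwoCycle k :=
  fun l => ∑ i, (frobeniusData k).u i * nakayama k b₀ * G (b ++ (frobeniusData k).v i :: l)

variable {G : List (TwoCycle k) → TwoCycle k}

lemma isNormalized_listMixLeft (hG : IsNormalized k G) (a₀ : TwoCycle k)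
    (a : List (TwoCycle k)) : IsNormalized k (listMixLeft G a₀ a) :=
  IsNormalized.sum _ _ fun _ _ => (hG.append_right _).mul_right _

lemma isNormalized_listMixRight (hG : IsNormalized k G) (b₀ : TwoCycle k)
    (b : List (TwoCycle k)) : IsNormalized k (listMixRight G b₀ b) :=
  IsNormalized.sum _ _ fun i _ => by
    simpa using (hG.append_left (b ++ [(frobeniusData k).v i])).mul_left
      ((frobeniusData k).u i * nakayama k b₀)

/-- The part of the Leibniz rule to the right of the inserted `u_i ν(a₀)`, the entries before it
being absorbed into `G`. The twisted trace identity exchanges `u_i` and `v_i` and carries the terms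
over to the coboundary of `b₀ ⋆ G`. -/
lemma sum_tr_tailD (hG : IsNormalized k G) (a₀ b₀ : TwoCycle k) (a : List (TwoCycle k)) :
    ∑ i, tr k (tailD G (((frobeniusData k).u i * nakayama k a₀) :: a)
        * ((frobeniusData k).v i * b₀)) =
      -tr k (listD (listMixRight G b₀ []) a * a₀) := by
  cases a with
  | nil =>
    have h := congrArg (fun x => -tr k (G [] * x * b₀)) (sum_u_mul_mul_v (nakayama k a₀))
    simp only [Finset.mul_sum, Finset.sum_mul, map_sum, mul_zero, zero_mul, map_zero, neg_zero,
      ← mul_assoc, ← Finset.sum_neg_distrib] at h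
    simpa [← mul_assoc] using h
  | cons c a =>
    let Y₁ : TwoCycle k →ₗ[k] TwoCycle k :=
      { toFun := fun z => G (z :: a)
        map_add' := fun _ _ => hG.head_add _ _ _
        map_smul' := fun _ _ => hG.head_smul _ _ _ }
    let Y₂ : TwoCycle k →ₗ[k] TwoCycle k :=
      { toFun := fun z => tailD (fun m => G (z :: m)) (c :: a)
        map_add' := fun _ _ => by simp only [hG.head_add, tailD_add]
        map_smul' := fun _ _ => by simp only [hG.head_smul, tailD_smul, RingHom.id_apply] }
    have h₁ := sum_tr_mixRight Y₁ b₀ (a₀ * nakayama k c)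
    have h₂ := sum_tr_mixRight Y₂ b₀ a₀
    have e₁ : ∀ x, tr k (c * x * a₀) = tr k (x * (a₀ * nakayama k c)) := fun x => by
      rw [mul_assoc, tr_mul_comm, mul_assoc]
    simp only [map_mul, nakayama_nakayama] at h₁
    simp only [tailD_cons_cons, sub_mul, neg_mul, map_sub, map_neg, Finset.sum_sub_distrib,
      Finset.sum_neg_distrib, listD_cons, add_mul, map_add, e₁]
    have e₂ : tailD (listMixRight G b₀ []) (c :: a) =
        ∑ i, (frobeniusData k).u i * nakayama k b₀ * Y₂ ((frobeniusData k).v i) := by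
      unfold listMixRight
      rw [tailD_sum]
      simp only [tailD_mul_left]
      rfl
    rw [e₂]
    simp only [listMixRight, Finset.sum_mul, map_sum, neg_add, sub_eq_add_neg]
    congr 2
    · simp only [← mul_assoc (_ : TwoCycle k) (nakayama k a₀) c] at h₁
      exact h₁.symm
    · exact h₂.symm

/-- The transpose of the Leibniz rule for the boundary of a product of chains: `⟨δG, x ⋆ y⟩ = ⟨δ(G ⋆
x), y⟩ ± ⟨δ(y ⋆ G), x⟩`. The terms inside either factor match directly, and those at the seam cancel
by the Casimir identity. -/
lemma sum_tr_listD (hG : IsNormalized k G) (a₀ b₀ : TwoCycle k) (a b : List (TwoCycle k)) :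
    ∑ i, tr k (listD G (b ++ ((frobeniusData k).u i * nakayama k a₀) :: a)
        * ((frobeniusData k).v i * b₀)) =
      tr k (listD (listMixLeft G a₀ a) b * b₀)
        + (-1) ^ (b.length + 1) * tr k (listD (listMixRight G b₀ b) a * a₀) := by
  have hT := sum_tr_tailD (hG.append_left b) a₀ b₀ a
  have hR : listMixRight (fun l => G (b ++ l)) b₀ [] = listMixRight G b₀ b := rfl
  rw [hR] at hT
  rcases List.eq_nil_or_concat b with rfl | ⟨b', z, rfl⟩
  -- With `b` empty, the first term of the coboundary is a norm and vanishes.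
  · have h := congrArg (fun x => tr k (x * b₀)) (sum_u_mul_mul_v (nakayama k a₀ * G a))
    simp only [Finset.sum_mul, map_sum, zero_mul, map_zero, ← mul_assoc] at h
    simp only [List.nil_append] at hT ⊢
    simp only [listD_cons, add_mul, map_add, Finset.sum_add_distrib, hT, listD_nil]
    simp only [← mul_assoc, h]
    simp
  · let Y : TwoCycle k →ₗ[k] TwoCycle k :=
      { toFun := fun w => G (b' ++ (w * nakayama k a₀) :: a)
        map_add' := fun _ _ => by rw [add_mul, hG.add]
        map_smul' := fun _ _ => by rw [smul_mul_assoc, hG.smul]; rfl }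
    have hY := sum_mul_u_v Y z
    have key : ∑ i, tailD G (b' ++ z :: ((frobeniusData k).u i * nakayama k a₀) :: a)
          * (frobeniusData k).v i =
        tailD (listMixLeft G a₀ a) (b' ++ [z]) - (-1 : k) ^ b'.length •
          ∑ i, tailD (fun m => G (b' ++ z :: m)) (((frobeniusData k).u i * nakayama k a₀) :: a)
            * (frobeniusData k).v i := by
      have hM : tailD (listMixLeft G a₀ a) (b' ++ [z]) = ∑ i,
          tailD (fun l => G (l ++ ((frobeniusData k).u i * nakayama k a₀) :: a)
            * (frobeniusData k).v i) (b' ++ [z]) := tailD_sum _ _ _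
      rw [hM]
      simp only [tailD_append, tailD_mul_right, add_mul, sub_mul, smul_mul_assoc, smul_sub,
        Finset.sum_add_distrib, Finset.sum_sub_distrib, Finset.smul_sum]
      -- The contraction of `z` into `u_i ν(a₀)` equals the multiplication of `v_i` by `z` on the
      -- right, which is the last term of the coboundary of `G ⋆ x`.
      have hY' : ∑ i, (-1 : k) ^ b'.length • (G (b' ++ (z * ((frobeniusData k).u i
            * nakayama k a₀)) :: a) * (frobeniusData k).v i) =
          ∑ i, (-1 : k) ^ b'.length • (G (b' ++ ((frobeniusData k).u i * nakayama k a₀) :: a)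
            * (frobeniusData k).v i * z) := by
        rw [← Finset.smul_sum, ← Finset.smul_sum]
        congr 1
        simpa [Y, mul_assoc] using hY
      rw [hY']
      abel
    have key' := congrArg (fun x => tr k (x * b₀)) key
    simp only [sub_mul, Finset.sum_mul, map_sub, map_sum, smul_mul_assoc, map_smul, smul_eq_mul,
      mul_assoc] at key'
    simp only [List.concat_eq_append, List.append_assoc, List.cons_append, List.nil_append,
      List.length_append, List.length_cons, List.length_nil] at hT ⊢
    rw [hT] at key'
    obtain ⟨c, d, hcd⟩ := List.exists_cons_of_ne_nil (List.append_ne_nil_of_right_ne_nil b' (List.cons_ne_nil z []))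
    have h1 : ∀ w, listD G (b' ++ z :: w) = c * G (d ++ w) + tailD G (b' ++ z :: w) := fun w => by
      rw [show b' ++ z :: w = c :: (d ++ w) by
        rw [← List.cons_append, ← hcd, List.append_assoc]; rfl, listD_cons]
    have h2 : listD (listMixLeft G a₀ a) (b' ++ [z]) =
        c * listMixLeft G a₀ a d + tailD (listMixLeft G a₀ a) (b' ++ [z]) := by
      rw [hcd, listD_cons]
    simp only [h1, h2, add_mul, map_add, Finset.sum_add_distrib, key', listMixLeft, Finset.mul_sum,
      Finset.sum_mul, map_sum, mul_assoc, zero_add, pow_succ]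
    ring

end TwoCycle

namespace TwoCycle

variable {k : Type u} [Field k]

/-! ## Products of cocycles and cycles -/

section

variable {G : List (TwoCycle k) → TwoCycle k} {p q : ℕ}

lemma pairing_listD_negMul (hG : IsNormalized k G) (x : Tup k (TwoCycle k) p)
    (y : Tup k (TwoCycle k) q) :
    pairing k _ (restrict _ (listD G)) (negMul (frobeniusData k) x y) =
      (x.sum fun a c => c *
        pairing k q (restrict q (listD (listMixLeft G (a 0) (List.ofFn (Fin.tail a))))) y)
      + (-1) ^ (q + 1) * y.sum fun b d => d *
        pairing k p (restrict p (listD (listMixRight G (b 0) (List.ofFn (Fin.tail b))))) x := by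
  simp only [pairing_negMul, restrict, List.ofFn_fin_append, List.ofFn_cons, sum_tr_listD hG]
  simp only [pairing_eq_sum, Finsupp.sum, List.length_ofFn, mul_add, Finset.sum_add_distrib]
  congr 1
  · refine Finset.sum_congr rfl fun a _ => ?_
    rw [Finset.mul_sum]
    exact Finset.sum_congr rfl fun b _ => mul_assoc _ _ _
  · rw [Finset.sum_comm, Finset.mul_sum]
    refine Finset.sum_congr rfl fun b _ => ?_
    rw [Finset.mul_sum, Finset.mul_sum]
    refine Finset.sum_congr rfl fun a _ => ?_
    simp only [restrict]
    change _ = _ * (_ * (_ * tr k (listD _ (List.ofFn (Fin.tail a)) * _)))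
    ring

lemma pairing_listD_negMul_left (hG : IsNormalized k G) {x : Tup k (TwoCycle k) p}
    (hx : x ∈ cycles (frobeniusData k) p) (y : Tup k (TwoCycle k) q) :
    pairing k _ (restrict _ (listD G)) (negMul (frobeniusData k) x y) =
      x.sum fun a c => c *
        pairing k q (restrict q (listD (listMixLeft G (a 0) (List.ofFn (Fin.tail a))))) y := by
  rw [pairing_listD_negMul hG]
  simp [pairing_listD hx (isNormalized_listMixRight hG _ _)]

lemma pairing_listD_negMul_right (hG : IsNormalized k G) (x : Tup k (TwoCycle k) p)
    {y : Tup k (TwoCycle k) q} (hy : y ∈ cycles (frobeniusData k) q) :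
    pairing k _ (restrict _ (listD G)) (negMul (frobeniusData k) x y) =
      (-1) ^ (q + 1) * y.sum fun b d => d *
        pairing k p (restrict p (listD (listMixRight G (b 0) (List.ofFn (Fin.tail b))))) x := by
  rw [pairing_listD_negMul hG]
  simp [pairing_listD hy (isNormalized_listMixLeft hG _ _)]

end

lemma negMul_mem_cycles {p q : ℕ} {x : Tup k (TwoCycle k) p}
    (hx : x ∈ cycles (frobeniusData k) p) {y : Tup k (TwoCycle k) q}
    (hy : y ∈ cycles (frobeniusData k) q) :
    negMul (frobeniusData k) x y ∈ cycles (frobeniusData k) (q + (p + 1)) := by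
  refine mem_cycles fun G hG => ?_
  rw [pairing_listD_negMul_left hG hx]
  simp [pairing_listD hy (isNormalized_listMixLeft hG _ _)]

/-- In the Leibniz identity the term with `δG` vanishes because `G` is a cocycle, and the one paired
with `x` because `x` is a cycle; the rest says that the coboundary of `G ⋆ x` pairs to zero with
every chain. -/
lemma mixLeft_mem_cocycles {s p : ℕ} {f : Fun (TwoCycle k) (s + (p + 1))}
    (hf : f ∈ cocycles k (TwoCycle k) (s + (p + 1))) {x : Tup k (TwoCycle k) p}
    (hx : x ∈ cycles (frobeniusData k) p) :
    mixLeft (frobeniusData k) f x ∈ cocycles k (TwoCycle k) s := by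
  obtain ⟨G, hG, rfl, hG'⟩ := mem_cocycles_iff.1 hf
  have e : mixLeft (frobeniusData k) (restrict (s + (p + 1)) G) x = restrict s fun l =>
      ∑ a ∈ x.support, x a • listMixLeft G (a 0) (List.ofFn (Fin.tail a)) l := by
    funext b
    simp only [mixLeft, restrict, List.ofFn_fin_append, List.ofFn_cons, Finsupp.sum]
    rfl
  rw [e]
  refine mem_cocycles (restrict_mem_cochains s (IsNormalized.sum _ _ fun a _ =>
    (isNormalized_listMixLeft hG _ _).smul_fun _)) fun y => ?_
  have h := pairing_listD_negMul_left hG hx y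
  have h0 : restrict (s + 1 + (p + 1)) (listD G) = 0 := by
    funext a
    exact hG' _ (by simp; omega)
  rw [h0, map_zero, LinearMap.zero_apply] at h
  rw [h, coboundary_restrict, Finsupp.sum]
  have h1 : restrict (s + 1) (listD fun l =>
      ∑ a ∈ x.support, x a • listMixLeft G (a 0) (List.ofFn (Fin.tail a)) l) =
      ∑ a ∈ x.support,
        x a • restrict (s + 1) (listD (listMixLeft G (a 0) (List.ofFn (Fin.tail a)))) := by
    funext b
    simp only [restrict, listD_sum, listD_smul, Finset.sum_apply, Pi.smul_apply]
  rw [h1]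
  simp

lemma mixRight_mem_cocycles {s p : ℕ} {x : Tup k (TwoCycle k) p}
    (hx : x ∈ cycles (frobeniusData k) p) {f : Fun (TwoCycle k) (p + (s + 1))}
    (hf : f ∈ cocycles k (TwoCycle k) (p + (s + 1))) :
    mixRight (frobeniusData k) x f ∈ cocycles k (TwoCycle k) s := by
  obtain ⟨G, hG, rfl, hG'⟩ := mem_cocycles_iff.1 hf
  have e : mixRight (frobeniusData k) x (restrict (p + (s + 1)) G) = restrict s fun l =>
      ∑ a ∈ x.support, x a • listMixRight G (a 0) (List.ofFn (Fin.tail a)) l := by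
    funext b
    simp only [mixRight, restrict, List.ofFn_fin_append, List.ofFn_cons, Finsupp.sum]
    rfl
  rw [e]
  refine mem_cocycles (restrict_mem_cochains s (IsNormalized.sum _ _ fun a _ =>
    (isNormalized_listMixRight hG _ _).smul_fun _)) fun y => ?_
  have h := pairing_listD_negMul_right hG y hx
  have h0 : restrict (p + (s + 1 + 1)) (listD G) = 0 := by
    funext a
    exact hG' _ (by simp; omega)
  rw [h0, map_zero, LinearMap.zero_apply] at h
  have h' := (mul_eq_zero.1 h.symm).resolve_left (pow_ne_zero _ (by simp))
  rw [← h', coboundary_restrict, Finsupp.sum]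
  have h1 : restrict (s + 1) (listD fun l =>
      ∑ a ∈ x.support, x a • listMixRight G (a 0) (List.ofFn (Fin.tail a)) l) =
      ∑ a ∈ x.support,
        x a • restrict (s + 1) (listD (listMixRight G (a 0) (List.ofFn (Fin.tail a)))) := by
    funext b
    simp only [restrict, listD_sum, listD_smul, Finset.sum_apply, Pi.smul_apply]
  rw [h1]
  simp

/-- By adjunction, pairing the product with `δG` is pairing `x` with `f ∪ δG`, which is `±δ(f ∪ G)`
since `f` is a cocycle. In degree `0` every chain is a cycle because the norm vanishes. -/
lemma capRight_mem_cycles {m q : ℕ} {x : Tup k (TwoCycle k) (m + q)}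
    (hx : x ∈ cycles (frobeniusData k) (m + q)) {f : Fun (TwoCycle k) m}
    (hf : f ∈ cocycles k (TwoCycle k) m) :
    capRight (frobeniusData k) x f ∈ cycles (frobeniusData k) q := by
  cases q with
  | zero => exact mem_cycles_zero _
  | succ q =>
    refine mem_cycles fun G hG => ?_
    obtain ⟨F, hF, rfl, hF'⟩ := mem_cocycles_iff.1 hf
    have h : cup (restrict m F) (restrict (q + 1) (listD G)) =
        (-1 : k) ^ m • restrict (m + (q + 1)) (listD (listCup m F G)) := by
      rw [cup_restrict]
      funext a
      simp only [restrict, Pi.smul_apply]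
      rw [listD_listCup (k := k) _ _ _ (by simp), hF' _ (by simp), zero_mul, zero_add,
        smul_smul, ← mul_pow]
      simp [listCup]
    rw [pairing_capRight, h, map_smul, LinearMap.smul_apply, pairing_listD hx (hF.listCup m hG),
      smul_zero]

lemma capLeft_mem_cycles {m q : ℕ} {f : Fun (TwoCycle k) m} (hf : f ∈ cocycles k (TwoCycle k) m)
    {x : Tup k (TwoCycle k) (q + m)} (hx : x ∈ cycles (frobeniusData k) (q + m)) :
    capLeft f x ∈ cycles (frobeniusData k) q := by
  cases q with
  | zero => exact mem_cycles_zero _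
  | succ q =>
    refine mem_cycles fun G hG => ?_
    obtain ⟨F, hF, rfl, hF'⟩ := mem_cocycles_iff.1 hf
    have h : cup (restrict (q + 1) (listD G)) (restrict m F) =
        restrict (q + 1 + m) (listD (listCup q G F)) := by
      rw [cup_restrict]
      funext a
      simp only [restrict]
      rw [listD_listCup (k := k) _ _ _ (by simp; omega), hF' (List.drop q _) (by simp; omega),
        mul_zero, smul_zero, add_zero]
      rfl
    rw [pairing_capLeft, h, pairing_listD hx (hG.listCup q hF)]

/-! ## Structure constants -/

lemma shift_eq_ite (i : Fin 2) (n : ℕ) : shift i n = if Even n then i else i + 1 := by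
  split_ifs with h
  · exact shift_even i h
  · exact shift_odd i (Nat.not_even_iff_odd.1 h)

lemma pathCoeff_path_self (i : Fin 2) (n : ℕ) : pathCoeff i (path k i n) = 1 := by
  cases n with
  | zero => rfl
  | succ n => rw [pathCoeff_path_succ, if_pos rfl]

lemma path_add (i : Fin 2) (m n : ℕ) : path k i (m + n) = path k i m ++ path k (shift i m) n := by
  induction m generalizing i with
  | zero => simp
  | succ m ih => rw [Nat.add_right_comm]; simp [ih]

variable (k) in
/-- The structure constants of the cohomology in the standard basis: the sign `0` or `1` according
to whether both degrees are odd. -/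
def oddConst (m n : ℤ) : k := if Even m ∨ Even n then 1 else 0

lemma inv_two_add (h2 : (2 : k) ≠ 0) : (2⁻¹ + 2⁻¹ : k) = 1 := by
  rw [← two_mul, mul_inv_cancel₀ h2]

/-- Two odd cocycles take values in the radical, whose square is zero; in the other cases the
product of the coefficients is the coefficient of the standard cocycle in the total degree. -/
lemma pairing_cup_rep (h2 : (2 : k) ≠ 0) (m n : ℕ) :
    pairing k (m + n) (cup (rep k m) (rep k n)) (cyc k (m + n)) = oddConst k m n := by
  rw [rep, rep, cup_restrict, pairing_cyc]
  have h : ∀ i, listCup m (listRep k m) (listRep k n) (path k i (m + n)) =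
      listRep k m (path k i m) * listRep k n (path k (shift i m) n) := fun i => by
    rw [listCup, path_add, List.take_left' (by simp), List.drop_left' (by simp)]
  simp only [h, listRep, repCoeff, cycCoeff, oddConst, Int.even_coe_nat, Nat.even_add, shift_eq_ite]
  by_cases hm : Even m <;> by_cases hn : Even n <;>
    simp [hm, hn, Fin.sum_univ_two, pathCoeff_path_self, tr_apply, idem, arrow, inv_two_add h2]

lemma sum_cyc {N : Type*} [AddCommMonoid N] (r : ℕ) (h : (Fin (r + 1) → TwoCycle k) → k → N)
    (h0 : ∀ a, h a 0 = 0) (hadd : ∀ a c d, h a (c + d) = h a c + h a d) :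
    (cyc k r).sum h = ∑ i : Fin 2, h (Fin.cons (cycCoeff k r i) fun j => arrow k (shift i j)) 1 := by
  rw [cyc, ← Finsupp.sum_finsetSum_index h0 hadd]
  exact Finset.sum_congr rfl fun i _ => by rw [Finsupp.sum_single_index (h0 _)]

lemma pairing_rep_negMul (h2 : (2 : k) ≠ 0) (p q : ℕ) :
    pairing k _ (rep k (q + (p + 1))) (negMul (frobeniusData k) (cyc k p) (cyc k q)) =
      oddConst k (p + 1) (q + 1) := by
  rw [pairing_negMul, sum_cyc _ _ (by simp) (by simp [Finsupp.sum, add_mul, Finset.sum_add_distrib])]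
  have h : ∀ h : (Fin (q + 1) → TwoCycle k) → k,
      ((cyc k q).sum fun b d => 1 * d * h b) =
        ∑ i : Fin 2, h (Fin.cons (cycCoeff k q i) fun j => arrow k (shift i j)) := fun h => by
    rw [sum_cyc _ _ (by simp) (by intros; ring)]; simp
  simp only [h, rep, restrict, List.ofFn_fin_append, List.ofFn_cons, Fin.tail_cons, Fin.cons_zero,
    ofFn_arrow_shift, listRep, pathCoeff_append, length_path, pathCoeff_cons]
  have hu : ∀ i, (frobeniusData k).u (.inl i) = idem k i := basis_inl k
  have hu' : ∀ i, (frobeniusData k).u (.inr i) = arrow k i := basis_inr k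
  have hv : ∀ i, (frobeniusData k).v (.inl i) = arrow k (i + 1) := fun _ => rfl
  have hv' : ∀ i, (frobeniusData k).v (.inr i) = idem k i := fun _ => rfl
  simp only [repCoeff, cycCoeff, oddConst, Nat.even_add, Int.even_add, Int.even_coe_nat,
    shift_eq_ite, Nat.not_even_one, Int.not_even_one, Fintype.sum_sum_type, hu, hu', hv, hv',
    Fin.sum_univ_two]
  by_cases hp : Even p <;> by_cases hq : Even q <;>
    simp [hp, hq, pathCoeff_path_self, tr_apply, idem, arrow, inv_two_add h2]

/-! ## The products of arbitrary cocycles and cycles -/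

variable {m n p q s : ℕ}

/-- Each factor in turn is moved to one side by adjunction and replaced by a multiple of the
standard cocycle with the rank one formula, until only `pairing_cup_rep` remains. -/
lemma pairing_cup (h2 : (2 : k) ≠ 0) {f : Fun (TwoCycle k) m} (hf : f ∈ cocycles k (TwoCycle k) m)
    {g : Fun (TwoCycle k) n} (hg : g ∈ cocycles k (TwoCycle k) n) :
    pairing k (m + n) (cup f g) (cyc k (m + n)) =
      pairing k m f (cyc k m) * pairing k n g (cyc k n) * oddConst k m n := by
  have hc := cyc_mem_cycles (k := k) (m + n)
  rw [← pairing_capRight, pairing_eq_mul h2 hg (capRight_mem_cycles hc hf), pairing_capRight,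
    ← pairing_capLeft, pairing_eq_mul h2 hf (capLeft_mem_cycles (rep_mem_cocycles n) hc),
    pairing_capLeft, pairing_cup_rep h2]
  ring

lemma pairing_rep_capRight (h2 : (2 : k) ≠ 0) {x : Tup k (TwoCycle k) (m + q)}
    (hx : x ∈ cycles (frobeniusData k) (m + q)) {f : Fun (TwoCycle k) m}
    (hf : f ∈ cocycles k (TwoCycle k) m) :
    pairing k q (rep k q) (capRight (frobeniusData k) x f) =
      pairing k (m + q) (rep k (m + q)) x * pairing k m f (cyc k m) * oddConst k m q := by
  rw [pairing_capRight, pairing_eq_mul h2 (cup_mem_cocycles hf (rep_mem_cocycles q)) hx,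
    pairing_cup h2 hf (rep_mem_cocycles q), pairing_rep_cyc h2]
  ring

lemma pairing_rep_capLeft (h2 : (2 : k) ≠ 0) {f : Fun (TwoCycle k) m}
    (hf : f ∈ cocycles k (TwoCycle k) m) {x : Tup k (TwoCycle k) (q + m)}
    (hx : x ∈ cycles (frobeniusData k) (q + m)) :
    pairing k q (rep k q) (capLeft f x) =
      pairing k m f (cyc k m) * pairing k (q + m) (rep k (q + m)) x * oddConst k q m := by
  rw [pairing_capLeft, pairing_eq_mul h2 (cup_mem_cocycles (rep_mem_cocycles q) hf) hx,
    pairing_cup h2 (rep_mem_cocycles q) hf, pairing_rep_cyc h2]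
  ring

/-- The same reduction, with the two mixed products serving as adjoints of the product of chains. -/
lemma pairing_rep_negMul_cycles (h2 : (2 : k) ≠ 0) {x : Tup k (TwoCycle k) p}
    (hx : x ∈ cycles (frobeniusData k) p) {y : Tup k (TwoCycle k) q}
    (hy : y ∈ cycles (frobeniusData k) q) :
    pairing k _ (rep k (q + (p + 1))) (negMul (frobeniusData k) x y) =
      pairing k p (rep k p) x * pairing k q (rep k q) y * oddConst k (p + 1) (q + 1) := by
  have hr := rep_mem_cocycles (k := k) (q + (p + 1))
  have hc := cyc_mem_cycles (k := k) q
  rw [← pairing_mixLeft, pairing_eq_mul h2 (mixLeft_mem_cocycles hr hx) hy, pairing_mixLeft,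
    ← pairing_mixRight hr.1, pairing_eq_mul h2 (mixRight_mem_cocycles hc hr) hx,
    pairing_mixRight hr.1, pairing_rep_negMul h2]
  ring

lemma pairing_mixLeft_cyc (h2 : (2 : k) ≠ 0) {f : Fun (TwoCycle k) (s + (p + 1))}
    (hf : f ∈ cocycles k (TwoCycle k) (s + (p + 1))) {x : Tup k (TwoCycle k) p}
    (hx : x ∈ cycles (frobeniusData k) p) :
    pairing k s (mixLeft (frobeniusData k) f x) (cyc k s) =
      pairing k _ f (cyc k _) * pairing k p (rep k p) x * oddConst k (p + 1) (s + 1) := by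
  have hc := cyc_mem_cycles (k := k) s
  rw [pairing_mixLeft, pairing_eq_mul h2 hf (negMul_mem_cycles hx hc),
    pairing_rep_negMul_cycles h2 hx hc, pairing_rep_cyc h2]
  ring

lemma pairing_mixRight_cyc (h2 : (2 : k) ≠ 0) {x : Tup k (TwoCycle k) p}
    (hx : x ∈ cycles (frobeniusData k) p) {f : Fun (TwoCycle k) (p + (s + 1))}
    (hf : f ∈ cocycles k (TwoCycle k) (p + (s + 1))) :
    pairing k s (mixRight (frobeniusData k) x f) (cyc k s) =
      pairing k p (rep k p) x * pairing k _ f (cyc k _) * oddConst k (s + 1) (p + 1) := by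
  have hc := cyc_mem_cycles (k := k) s
  rw [pairing_mixRight hf.1, pairing_eq_mul h2 hf (negMul_mem_cycles hc hx),
    pairing_rep_negMul_cycles h2 hc hx, pairing_rep_cyc h2]
  ring

end TwoCycle

/-! ## The twisted Connes operator and the Hochschild boundary -/

section Sequences

variable {A : Type*} [Ring A] (σ : A → A)

/-- The first `N` terms are those of `W` from `i` on, continued by the twist. -/
def rotSeq (N i : ℕ) (W : ℕ → A) : ℕ → A := fun t =>
  if t + i < N then W (t + i) else σ (W (t + i - N))

/-- The sequence `W` with the terms `j` and `j + 1` multiplied. -/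
def mergeSeq (j : ℕ) (W : ℕ → A) : ℕ → A := fun t =>
  if t < j then W t else if t = j then W t * W (t + 1) else W (t + 1)

variable {σ}

/-- The merged entries have not yet passed the end of the sequence. -/
lemma mergeSeq_rotSeq_of_le {p i j t : ℕ} (W : ℕ → A) (h : i + j ≤ p) (ht : t < p + 1) :
    mergeSeq j (rotSeq σ (p + 2) i W) t = rotSeq σ (p + 1) i (mergeSeq (i + j) W) t := by
  simp only [mergeSeq, rotSeq]
  split_ifs <;> first
    | omega
    | rfl
    | (congr 1; omega)
    | (congr 2; omega)

/-- The merged entries straddle the end: the last entry meets the twist of the first, which is the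
face `a₀ ν⁻¹(a₁)`. -/
lemma mergeSeq_rotSeq_of_eq {p i j t : ℕ} (W : ℕ → A) (h : i + 1 + j = p + 1) (ht : t < p + 1) :
    mergeSeq j (rotSeq σ (p + 2) (i + 1) W) t =
      rotSeq σ (p + 1) i (mergeSeq p (rotSeq σ (p + 2) 1 W)) t := by
  simp only [mergeSeq, rotSeq]
  split_ifs <;> first
    | omega
    | rfl
    | (congr 1 <;> first | omega | (congr 1; omega) | (congr 2; omega))

/-- Both merged entries are already twisted, so multiplicativity of `σ` is needed. -/
lemma mergeSeq_rotSeq_of_gt (hσ : ∀ a b, σ (a * b) = σ a * σ b) {p i j s t : ℕ} (W : ℕ → A)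
    (h : i + 1 + j = s + (p + 2)) (hj : j ≤ p) (ht : t < p + 1) :
    mergeSeq j (rotSeq σ (p + 2) (i + 1) W) t = rotSeq σ (p + 1) i (mergeSeq s W) t := by
  simp only [mergeSeq, rotSeq]
  split_ifs <;> first
    | omega
    | rfl
    | (rw [hσ]; congr 2 <;> first | omega | (congr 1; omega))
    | (congr 1 <;> first | omega | (congr 1; omega))

lemma twistedRotate_seq {n : ℕ} (i : Fin (n + 1)) (W : ℕ → A) :
    twistedRotate σ i (fun t : Fin (n + 1) => W t) = fun t : Fin (n + 1) =>
      rotSeq σ (n + 1) i W t := by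
  funext t
  simp only [twistedRotate, rotSeq, Fin.val_add]
  split_ifs with h
  · rw [Nat.mod_eq_of_lt h]
  · rw [Nat.mod_eq_sub_mod (by omega), Nat.mod_eq_of_lt (by omega)]

/-- The bijection between the terms of the boundary of the Connes operator and those of the Connes
operator of the boundary. -/
lemma sum_connes_terms {M : Type*} [AddCommMonoid M] (p : ℕ) (g h : ℕ → ℕ → M)
    (h₁ : ∀ i j, i + j ≤ p → g i j = h (i + j) i)
    (h₂ : ∀ i j, i + 1 + j = p + 1 → g (i + 1) j = h (p + 1) i)
    (h₃ : ∀ i j s, i + 1 + j = s + (p + 2) → i ≤ p → j ≤ p → g (i + 1) j = h s i) :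
    ∑ i ∈ Finset.range (p + 2), ∑ j ∈ Finset.range (p + 1), g i j =
      ∑ s ∈ Finset.range (p + 2), ∑ i ∈ Finset.range (p + 1), h s i := by
  rw [← Finset.sum_product', ← Finset.sum_product']
  -- The three branches are the three positions of the merged pair relative to the end; `s = p + 1`
  -- labels the face across the end.
  refine Finset.sum_bij'
    (fun x _ => if x.1 + x.2 ≤ p then (x.1 + x.2, x.1) else
      if x.1 + x.2 = p + 1 then (p + 1, x.1 - 1) else (x.1 + x.2 - (p + 2), x.1 - 1))
    (fun x _ => if x.1 = p + 1 then (x.2 + 1, p - x.2) else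
      if x.2 ≤ x.1 then (x.2, x.1 - x.2) else (x.2 + 1, x.1 + (p + 1) - x.2)) ?_ ?_ ?_ ?_ ?_
  · rintro ⟨i, j⟩ hij
    simp only [Finset.mem_product, Finset.mem_range] at hij
    split_ifs <;> simp only [Finset.mem_product, Finset.mem_range] <;> omega
  · rintro ⟨s, i⟩ hsi
    simp only [Finset.mem_product, Finset.mem_range] at hsi
    dsimp only
    split_ifs <;> simp only [Finset.mem_product, Finset.mem_range] <;> omega
  · rintro ⟨i, j⟩ hij
    simp only [Finset.mem_product, Finset.mem_range] at hij
    by_cases a : i + j ≤ p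
    · simp only [if_pos a]
      rw [if_neg (by omega), if_pos (by omega), Nat.add_sub_cancel_left]
    · by_cases b : i + j = p + 1
      · simp only [if_neg a, if_pos b, if_true, Prod.mk.injEq]
        omega
      · simp only [if_neg a, if_neg b]
        rw [if_neg (by omega), if_neg (by omega), Prod.mk.injEq]
        omega
  · rintro ⟨s, i⟩ hsi
    simp only [Finset.mem_product, Finset.mem_range] at hsi
    by_cases a : s = p + 1
    · simp only [if_pos a]
      rw [if_neg (by omega), if_pos (by omega), Prod.mk.injEq]
      omega
    · by_cases b : i ≤ s
      · simp only [if_neg a, if_pos b]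
        rw [if_pos (by omega), Prod.mk.injEq]
        omega
      · simp only [if_neg a, if_neg b]
        rw [if_neg (by omega), if_neg (by omega), Prod.mk.injEq]
        omega
  · rintro ⟨i, j⟩ hij
    simp only [Finset.mem_product, Finset.mem_range] at hij
    dsimp only
    split_ifs with a b
    · exact h₁ i j a
    · obtain ⟨i, rfl⟩ : ∃ i', i = i' + 1 := ⟨i - 1, by omega⟩
      exact h₂ i j b
    · obtain ⟨i, rfl⟩ : ∃ i', i = i' + 1 := ⟨i - 1, by omega⟩
      exact h₃ i j _ (by omega) (by omega) (by omega)

end Sequences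

/-! ### The homotopy formula for the twisted Connes operator. -/

section Connes

variable {k A : Type u} {ι : Type*} [Field k] [Ring A] [Algebra k A] [DecidableEq ι]
  (F : FrobeniusData k A ι)

/-- The action of the inverse Nakayama automorphism on all entries of tuples. -/
def twist (p : ℕ) : Tup k A p →ₗ[k] Tup k A p := Finsupp.lmapDomain k k fun a => F.ν.symm ∘ a

lemma connes_eq_linearCombination {p : ℕ} (x : Tup k A p) :
    connes F x = Finsupp.linearCombination k (fun a => ∑ i : Fin (p + 1),
      (-1 : k) ^ (((i : ℕ) + 1) * p) • Finsupp.single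
        (Fin.cons 1 (twistedRotate F.ν.symm i (Fin.snoc (Fin.tail a) (a 0))) :
          Fin (p + 2) → A) (1 : k)) x := by
  simp [connes, Finsupp.linearCombination_apply, Finset.smul_sum, Finsupp.smul_single]

/-- The tuple `(W n, W 0, …, W (n - 1))`. -/
def seqTuple (n : ℕ) (W : ℕ → A) : Fin (n + 1) → A := Fin.cons (W n) fun t : Fin n => W t

lemma exists_seqTuple {n : ℕ} (a : Fin (n + 1) → A) : ∃ W, a = seqTuple n W := by
  refine ⟨fun m => if h : m < n then a (Fin.succ ⟨m, h⟩) else a 0, ?_⟩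
  funext t
  refine Fin.cases ?_ (fun t => ?_) t <;> simp [seqTuple]

lemma snoc_seqTuple (n : ℕ) (W : ℕ → A) :
    (Fin.snoc (Fin.tail (seqTuple n W)) (seqTuple n W 0) : Fin (n + 1) → A) =
      fun t : Fin (n + 1) => W t := by
  funext t
  refine Fin.lastCases ?_ (fun t => ?_) t <;> simp [seqTuple]

/-- The sequences of the terms of the boundary of `seqTuple (p + 1) W`. -/
def faceSeq (p : ℕ) (W : ℕ → A) (s : ℕ) : ℕ → A :=
  if s = p + 1 then mergeSeq p (rotSeq F.ν.symm (p + 2) 1 W) else mergeSeq s W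

variable (k) in
/-- The signs of the terms of the boundary of `seqTuple (p + 1) W`. -/
def faceSign (p s : ℕ) : k := if s = p + 1 then 1 else (-1) ^ (s + 1)

/-- In the cyclic order `a₁, …, a_{p+1}, a₀` the face `a₀ ν⁻¹(a₁)` multiplies across the end; it is
therefore listed last, as `s = p + 1`, although it carries the sign `1`. -/
lemma boundary_seqTuple (p : ℕ) (W : ℕ → A) :
    boundary F p (Finsupp.single (seqTuple (p + 1) W) 1) = ∑ s ∈ Finset.range (p + 2),
      faceSign k p s • Finsupp.single (seqTuple p (faceSeq F p W s)) (1 : k) := by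
  rw [boundary, Finsupp.linearCombination_single, one_smul, Finset.sum_range_succ,
    Finset.sum_range_succ, Finset.sum_range, add_comm _ (faceSign k p (p + 1) • _), add_assoc]
  congr 1
  · rw [faceSign, if_pos rfl, one_smul]
    congr 1
    funext t
    refine Fin.cases ?_ (fun t => ?_) t
    · simp [seqTuple, faceSeq, mergeSeq, rotSeq]
    · simp [seqTuple, faceSeq, mergeSeq, rotSeq]
  · congr 1
    · refine Finset.sum_congr rfl fun i _ => ?_
      rw [faceSign, if_neg (by omega), faceSeq, if_neg (by omega), Finsupp.smul_single, smul_eq_mul,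
        mul_one]
      congr 1
      funext t
      have hi := i.isLt
      refine Fin.cases ?_ (fun t => ?_) t
      · simp [seqTuple, mergeSeq, Fin.contractNth]
        rw [if_neg (by omega), if_neg (by omega)]
      · simp [seqTuple, mergeSeq, Fin.contractNth, -Fin.val_fin_lt]
    · rw [faceSign, if_neg (by omega), faceSeq, if_neg (by omega), Finsupp.smul_single, smul_eq_mul,
        mul_one]
      congr 1
      funext t
      refine Fin.cases ?_ (fun t => ?_) t
      · simp [seqTuple, mergeSeq]
      · simp [seqTuple, mergeSeq]

/-- The tuple `(W (i - 1), W i, …)` of length `p + 2` in the twisted periodic continuation. -/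
def windowTuple (p : ℕ) (W : ℕ → A) (i : ℕ) : Fin (p + 2) → A :=
  Fin.cons (rotSeq F.ν.symm (p + 2) i W (p + 1))
    fun t : Fin (p + 1) => rotSeq F.ν.symm (p + 2) i W t

/-- Since the zeroth entry is `1`, the two outer faces merely move an end entry into the zeroth
slot: they are consecutive windows of the twisted periodic sequence, and a sum over `i` will
telescope. -/
lemma boundary_cons_one (p i : ℕ) (hi : i < p + 2) (W : ℕ → A) :
    boundary F (p + 1) (Finsupp.single (Fin.cons 1 fun t : Fin (p + 2) =>
        rotSeq F.ν.symm (p + 2) i W t : Fin (p + 3) → A) 1) =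
      Finsupp.single (windowTuple F p W (i + 1)) 1
      + ∑ j ∈ Finset.range (p + 1), (-1 : k) ^ (j + 1) • Finsupp.single
          (Fin.cons 1 fun t : Fin (p + 1) =>
            mergeSeq j (rotSeq F.ν.symm (p + 2) i W) t : Fin (p + 2) → A) (1 : k)
      + (-1 : k) ^ p • Finsupp.single (windowTuple F p W i) 1 := by
  rw [boundary, Finsupp.linearCombination_single, one_smul, Finset.sum_range]
  congr 1
  · congr 1
    · congr 1
      funext t
      refine Fin.cases ?_ (fun t => ?_) t
      · simp [windowTuple, rotSeq, hi]
        rw [if_neg (by omega)]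
        congr 2
        omega
      · simp [windowTuple, rotSeq, add_assoc, add_comm 1]
    · refine Finset.sum_congr rfl fun j _ => ?_
      rw [Finsupp.smul_single, smul_eq_mul, mul_one]
      congr 1
      funext t
      refine Fin.cases ?_ (fun t => ?_) t
      · simp [Fin.contractNth]
      · simp [mergeSeq, Fin.contractNth, -Fin.val_fin_lt]
  · rw [Finsupp.smul_single, smul_eq_mul, mul_one, pow_succ, pow_succ, mul_assoc, neg_one_mul,
      neg_neg, mul_one]
    congr 1
    funext t
    refine Fin.cases ?_ (fun t => ?_) t <;> simp [windowTuple, ← Fin.succ_last]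

lemma boundary_connes_zero (x : Tup k A 0) :
    boundary F 0 (connes F x) = twist F 0 x - x := by
  rw [connes_eq_linearCombination]
  induction x using Finsupp.induction_linear with
  | zero => simp
  | add x y hx hy => simp only [map_add, hx, hy]; abel
  | single a c =>
    rw [Finsupp.linearCombination_single, twist, Finsupp.lmapDomain_apply,
      Finsupp.mapDomain_single]
    have h1 : ∀ {x y : Fin 1 → A}, x 0 = y 0 → x = y := fun h => by
      funext t
      rw [Subsingleton.elim t 0, h]
    have hsnoc : (Fin.snoc (Fin.tail a) (a 0) : Fin 1 → A) = a := h1 (Fin.snoc_last _ _)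
    simp only [hsnoc]
    simp [boundary, sub_eq_add_neg, ← Finsupp.single_neg]
    congr 2 <;> exact h1 (by simp [twistedRotate])

lemma twist_seqTuple (n : ℕ) (W : ℕ → A) :
    twist F n (Finsupp.single (seqTuple n W) 1) =
      Finsupp.single (seqTuple n fun m => F.ν.symm (W m)) (1 : k) := by
  rw [twist, Finsupp.lmapDomain_apply, Finsupp.mapDomain_single]
  congr 1
  funext t
  refine Fin.cases ?_ (fun t => ?_) t <;> simp [seqTuple]

/-- The identity `∂B + B∂ = ν⁻¹ - 1`, where `ν⁻¹` acts on all entries. The outer faces of `B`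
telescope to the twisted and the original tuple; the inner faces are, up to sign, the rotations of
the faces of the tuple. -/
lemma boundary_connes {p : ℕ} (x : Tup k A (p + 1)) :
    boundary F (p + 1) (connes F x) =
      twist F (p + 1) x - x - connes F (boundary F p x) := by
  rw [connes_eq_linearCombination, connes_eq_linearCombination]
  induction x using Finsupp.induction_linear with
  | zero => simp
  | add x y hx hy => simp only [map_add, hx, hy]; abel
  | single a c =>
    obtain ⟨W, rfl⟩ := exists_seqTuple a
    rw [← mul_one c, ← smul_eq_mul, ← Finsupp.smul_single]
    simp only [map_smul, ← smul_sub]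
    congr 1
    simp only [boundary_seqTuple, map_sum, map_smul, Finsupp.linearCombination_single, one_smul,
      snoc_seqTuple]
    have hr : ∀ (n : ℕ) (i : Fin (n + 1)) (V : ℕ → A),
        twistedRotate F.ν.symm i (fun t : Fin (n + 1) => V t) =
          fun t : Fin (n + 1) => rotSeq F.ν.symm (n + 1) i V t :=
      fun n i V => twistedRotate_seq i V
    simp only [hr]
    rw [← Finset.sum_range fun i => (-1 : k) ^ ((i + 1) * (p + 1)) • boundary F (p + 1)
      (Finsupp.single (Fin.cons 1 fun t : Fin (p + 2) => rotSeq F.ν.symm (p + 2) i W t :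
        Fin (p + 3) → A) 1)]
    have hs : ∀ s, (∑ i : Fin (p + 1), (-1 : k) ^ (((i : ℕ) + 1) * p) • Finsupp.single
        (Fin.cons 1 fun t : Fin (p + 1) => rotSeq F.ν.symm (p + 1) i (faceSeq F p W s) t :
          Fin (p + 2) → A) (1 : k)) =
        ∑ i ∈ Finset.range (p + 1), (-1 : k) ^ ((i + 1) * p) • Finsupp.single
        (Fin.cons 1 fun t : Fin (p + 1) => rotSeq F.ν.symm (p + 1) i (faceSeq F p W s) t :
          Fin (p + 2) → A) (1 : k) := fun s => by rw [Finset.sum_range]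
    simp only [hs]
    have hsplit : ∀ i ∈ Finset.range (p + 2),
        (-1 : k) ^ ((i + 1) * (p + 1)) • boundary F (p + 1)
          (Finsupp.single (Fin.cons 1 fun t : Fin (p + 2) => rotSeq F.ν.symm (p + 2) i W t :
            Fin (p + 3) → A) 1) =
        ((-1 : k) ^ ((i + 1) * (p + 1)) • Finsupp.single (windowTuple F p W (i + 1)) 1
          - (-1 : k) ^ (i * (p + 1)) • Finsupp.single (windowTuple F p W i) 1)
        - ∑ j ∈ Finset.range (p + 1), (-1 : k) ^ ((i + 1) * (p + 1) + j) • Finsupp.single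
          (Fin.cons 1 fun t : Fin (p + 1) => mergeSeq j (rotSeq F.ν.symm (p + 2) i W) t :
            Fin (p + 2) → A) (1 : k) := by
      intro i hi
      rw [boundary_cons_one F p i (Finset.mem_range.1 hi), smul_add, smul_add, smul_smul,
        Finset.smul_sum]
      have e1 : (-1 : k) ^ ((i + 1) * (p + 1)) * (-1) ^ p = -(-1) ^ (i * (p + 1)) := by
        rw [← pow_add, show (i + 1) * (p + 1) + p = i * (p + 1) + 1 + 2 * p by ring, pow_add,
          pow_mul (-1 : k) 2, neg_one_sq, one_pow, mul_one, pow_succ, mul_neg_one]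
      have e2 : ∀ j, (-1 : k) ^ ((i + 1) * (p + 1)) * (-1) ^ (j + 1) =
          -(-1) ^ ((i + 1) * (p + 1) + j) := fun j => by
        rw [pow_add, pow_succ]; ring
      simp only [smul_smul, e1, e2, neg_smul, Finset.sum_neg_distrib]
      abel
    -- Only the windows at `0` and `p + 2` remain, that is, the tuple and its twist.
    rw [Finset.sum_congr rfl hsplit, Finset.sum_sub_distrib,
      Finset.sum_range_sub fun i => (-1 : k) ^ (i * (p + 1)) •
        Finsupp.single (windowTuple F p W i) (1 : k)]
    congr 1
    · have e : (-1 : k) ^ ((p + 2) * (p + 1)) = 1 := by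
        rw [mul_comm]
        exact Even.neg_one_pow (Nat.even_mul_succ_self (p + 1))
      rw [e, one_smul, zero_mul, pow_zero, one_smul, twist_seqTuple]
      congr 2
      · funext t
        refine Fin.cases ?_ (fun t => ?_) t <;> simp [windowTuple, seqTuple, rotSeq]
      · funext t
        refine Fin.cases ?_ (fun t => ?_) t
        · simp [windowTuple, seqTuple, rotSeq]
        · have := t.isLt
          simp [windowTuple, seqTuple, rotSeq]
          intro h
          omega
    · simp only [Finset.smul_sum, smul_smul]
      have hcongr : ∀ {X Y : ℕ → A}, (∀ t, t < p + 1 → X t = Y t) →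
          (Fin.cons 1 fun t : Fin (p + 1) => X t : Fin (p + 2) → A) =
            Fin.cons 1 fun t : Fin (p + 1) => Y t := fun h => by
        congr 1
        funext t
        exact h t t.isLt
      -- The exponents on the two sides differ at most by the even number `2 (p + 1)`, which comes
      -- from a full turn of the rotation.
      refine sum_connes_terms p _ _ (fun i j hij => ?_) (fun i j hij => ?_)
        fun i j s hij hi hj => ?_
      · rw [faceSign, if_neg (by omega), faceSeq, if_neg (by omega),
          hcongr fun t ht => mergeSeq_rotSeq_of_le W hij ht]
        congr 1
        rw [← pow_add]
        congr 1
        ring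
      · rw [faceSign, if_pos rfl, faceSeq, if_pos rfl,
          hcongr fun t ht => mergeSeq_rotSeq_of_eq W hij ht]
        congr 1
        rw [one_mul, show (i + 1 + 1) * (p + 1) + j = (i + 1) * p + 2 * (p + 1) by
          linear_combination hij, pow_add, pow_mul (-1 : k) 2, neg_one_sq, one_pow, mul_one]
      · rw [faceSign, if_neg (by omega), faceSeq, if_neg (by omega),
          hcongr fun t ht => mergeSeq_rotSeq_of_gt (map_mul F.ν.symm) W hij hj ht]
        congr 1
        rw [← pow_add, show (i + 1 + 1) * (p + 1) + j = s + 1 + (i + 1) * p + 2 * (p + 1) by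
          linear_combination hij, pow_add, pow_mul (-1 : k) 2, neg_one_sq, one_pow, mul_one]

end Connes

/-! ## The Batalin-Vilkovisky operator -/

section Rotation

/-- The rotation of a list by `i` steps, applying `σ` to the entries that have passed the end. -/
def listRotate {A : Type*} (σ : A → A) (i : ℕ) (l : List A) : List A :=
  l.drop i ++ (l.take i).map σ

lemma ofFn_twistedRotate {A : Type*} (σ : A → A) {n : ℕ} (i : Fin (n + 1)) (w : Fin (n + 1) → A) :
    List.ofFn (twistedRotate σ i w) = listRotate σ i (List.ofFn w) := by
  have hi := i.isLt
  apply List.ext_getElem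
  · simp [listRotate]
  · intro t ht ht'
    have htn : t < n + 1 := by simpa using ht
    simp only [listRotate, List.getElem_append, List.getElem_ofFn, twistedRotate, List.length_drop,
      List.length_ofFn, List.getElem_drop, List.getElem_map, List.getElem_take]
    by_cases h : t + i < n + 1
    · rw [if_pos h, dif_pos (by omega)]
      congr 1
      apply Fin.ext
      rw [Fin.val_add, Nat.mod_eq_of_lt h]
      exact add_comm _ _
    · rw [if_neg h, dif_neg (by omega)]
      congr 2
      apply Fin.ext
      rw [Fin.val_add, Nat.mod_eq_sub_mod (by simp; omega), Nat.mod_eq_of_lt (by simp; omega)]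
      simp; omega

variable {k A : Type u} [Field k] [Ring A] [Algebra k A]

lemma IsNormalized.map {F : List A → A} (hF : IsNormalized k F) (σ : A →ₐ[k] A) :
    IsNormalized k fun l => F (l.map σ) where
  add l a b m := by simp [hF.add]
  smul c l a m := by simp [hF.smul]
  one l m := by simp [hF.one]

lemma IsNormalized.listRotate {F : List A → A} (hF : IsNormalized k F) (σ : A →ₐ[k] A) (i : ℕ) :
    IsNormalized k fun l => F (listRotate σ i l) := by
  have h₁ : ∀ l : List A, i ≤ l.length → ∀ x m, TateHochschild.listRotate σ i (l ++ x :: m) =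
      l.drop i ++ x :: (m ++ (l.take i).map σ) := fun l h x m => by
    simp [TateHochschild.listRotate, List.drop_append_of_le_length h,
      List.take_append_of_le_length h]
  have h₂ : ∀ l : List A, ¬ i ≤ l.length → ∃ j, ∀ x m,
      TateHochschild.listRotate σ i (l ++ x :: m) =
      (m.drop j ++ l.map σ) ++ σ x :: (m.take j).map σ := fun l h => by
    obtain ⟨j, rfl⟩ : ∃ j, i = l.length + (j + 1) := ⟨i - l.length - 1, by omega⟩
    exact ⟨j, fun x m => by simp [TateHochschild.listRotate, List.drop_append, List.take_append,
      List.drop_eq_nil_of_le, List.take_of_length_le]⟩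
  constructor
  · intro l a b m
    by_cases h : i ≤ l.length
    · simp only [h₁ l h, hF.add]
    · obtain ⟨j, hj⟩ := h₂ l h
      simp only [hj, map_add, hF.add]
  · intro c l a m
    by_cases h : i ≤ l.length
    · simp only [h₁ l h, hF.smul]
    · obtain ⟨j, hj⟩ := h₂ l h
      simp only [hj, map_smul, hF.smul]
  · intro l m
    by_cases h : i ≤ l.length
    · simp only [h₁ l h, hF.one]
    · obtain ⟨j, hj⟩ := h₂ l h
      simp only [hj, map_one, hF.one]

end Rotation

/-! ### Adjointness of the operator on cochains and the Connes operator. -/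

namespace TwoCycle

variable {k : Type u} [Field k]

lemma isNormalized_tr_listRotate {F : List (TwoCycle k) → TwoCycle k} (hF : IsNormalized k F)
    (i : ℕ) (x : TwoCycle k) :
    IsNormalized k fun l => tr k (F (listRotate (nakayama k) i l)) • x :=
  (hF.listRotate (nakayama k).toAlgHom i).comp ((tr k).smulRight x)

/-- The sum over all rotations of a list that defines the operator `Δ`, multiplied by `x`. -/
def cyclicSum (r : ℕ) (F : List (TwoCycle k) → TwoCycle k) (x : TwoCycle k)
    (l : List (TwoCycle k)) : TwoCycle k :=
  ∑ i : Fin (r + 1), (-1 : k) ^ (((i : ℕ) + 1) * r) •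
    (tr k (F (listRotate (nakayama k) i l)) • x)

lemma isNormalized_cyclicSum (r : ℕ) {F : List (TwoCycle k) → TwoCycle k} (hF : IsNormalized k F)
    (x : TwoCycle k) : IsNormalized k (cyclicSum r F x) :=
  IsNormalized.sum _ _ fun i _ => (isNormalized_tr_listRotate hF i x).smul_fun _

lemma ofFn_snoc {α : Type*} {n : ℕ} (a : Fin n → α) (x : α) :
    List.ofFn (Fin.snoc a x : Fin (n + 1) → α) = List.ofFn a ++ [x] := by
  rw [List.ofFn_succ_last]
  simp

lemma bvCochain_restrict (r : ℕ) (F : List (TwoCycle k) → TwoCycle k) :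
    bvCochain (frobeniusData k) (restrict (r + 1) F) = restrict r fun l =>
      ∑ j, cyclicSum r F ((frobeniusData k).v j) (l ++ [(frobeniusData k).u j]) := by
  funext a
  simp only [bvCochain, restrict, cyclicSum, Finset.sum_smul, mul_smul, ofFn_twistedRotate,
    ofFn_snoc]
  refine Finset.sum_congr rfl fun j _ => Finset.sum_congr rfl fun i _ => ?_
  congr 2
  change tr k (_ * 1) = _
  rw [mul_one]
  rfl

lemma bvCochain_mem_cochains {r : ℕ} {f : Fun (TwoCycle k) (r + 1)}
    (hf : f ∈ cochains k (TwoCycle k) (r + 1)) :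
    bvCochain (frobeniusData k) f ∈ cochains k (TwoCycle k) r := by
  obtain ⟨F, hF, rfl⟩ := mem_cochains_iff.1 hf
  rw [bvCochain_restrict]
  exact restrict_mem_cochains r (IsNormalized.sum _ _ fun j _ =>
    (isNormalized_cyclicSum r hF _).append_right _)

lemma eq_sum_tr_smul (x : TwoCycle k) :
    x = ∑ j, tr k ((frobeniusData k).v j * x) • (frobeniusData k).u j := by
  have hu : ∀ i, (frobeniusData k).u (.inl i) = idem k i := basis_inl k
  have hu' : ∀ i, (frobeniusData k).u (.inr i) = arrow k i := basis_inr k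
  have hv : ∀ i, (frobeniusData k).v (.inl i) = arrow k (i + 1) := fun _ => rfl
  have hv' : ∀ i, (frobeniusData k).v (.inr i) = idem k i := fun _ => rfl
  rw [Fintype.sum_sum_type]
  simp only [hu, hu', hv, hv', Fin.sum_univ_two]
  ext j <;> fin_cases j <;> simp [tr_apply, idem, arrow]

/-- The operator `Δ` is adjoint to the Connes operator. -/
lemma pairing_bvCochain {r : ℕ} {f : Fun (TwoCycle k) (r + 1)}
    (hf : f ∈ cochains k (TwoCycle k) (r + 1)) (x : Tup k (TwoCycle k) r) :
    pairing k r (bvCochain (frobeniusData k) f) x =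
      pairing k (r + 1) f (connes (frobeniusData k) x) := by
  obtain ⟨F, hF, rfl⟩ := mem_cochains_iff.1 hf
  rw [connes_eq_linearCombination, bvCochain_restrict]
  induction x using Finsupp.induction_linear with
  | zero => simp
  | add x y hx hy => simp only [map_add, hx, hy]
  | single a c =>
    rw [Finsupp.linearCombination_single, map_smul, pairing_single, smul_eq_mul, map_sum]
    congr 1
    simp only [map_smul, pairing_single, one_mul, Fin.cons_zero, Fin.cons_succ, mul_one, restrict,
      ofFn_twistedRotate, ofFn_snoc, Finset.sum_mul, cyclicSum, smul_mul_assoc, map_sum,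
      smul_eq_mul]
    rw [Finset.sum_comm]
    refine Finset.sum_congr rfl fun i _ => ?_
    rw [← Finset.mul_sum]
    congr 1
    -- Normalized functions take values in `A`, so the scalar is carried as a multiple of `1` and
    -- read off below as the coefficient of an idempotent; linearity in the last entry then allows
    -- the expansion of `a₀` in the dual bases.
    have hT := isNormalized_tr_listRotate hF i 1
    let T : TwoCycle k →ₗ[k] TwoCycle k :=
      { toFun := fun y => tr k (F (listRotate (nakayama k) i (List.ofFn (Fin.tail a) ++ [y]))) • 1
        map_add' := fun y z => hT.add _ y z []
        map_smul' := fun c y => hT.smul c _ y [] }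
    have h := congrArg T (eq_sum_tr_smul (a 0))
    rw [map_sum] at h
    simp only [map_smul] at h
    have h' := congrArg (fun y : TwoCycle k => y.e 0) h
    simp only [Fin.sum_univ_two, Fintype.sum_sum_type, add_e, Pi.add_apply, smul_e, Pi.smul_apply,
      T, LinearMap.coe_mk, AddHom.coe_mk, one_e, smul_eq_mul, mul_one] at h'
    simp only [Fintype.sum_sum_type, Fin.sum_univ_two]
    refine Eq.trans ?_ h'.symm
    simp only [mul_comm]
    rfl

end TwoCycle

namespace TwoCycle

variable {k : Type u} [Field k]

/-! ## Invariant cochains and chains -/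

/-- As `ν² = 1` and `2` is invertible, every entry is the sum of its parts with eigenvalues `1` and
`-1`. -/
lemma eq_of_eigenvectors (h2 : (2 : k) ≠ 0) {V : Type*} [AddCommGroup V] [Module k V] {n : ℕ}
    {M N : MultilinearMap k (fun _ : Fin n => TwoCycle k) V}
    (h : ∀ (μ : Fin n → k) (a : Fin n → TwoCycle k), (∀ i, nakayama k (a i) = μ i • a i) →
      M a = N a) : M = N := by
  ext a
  have ha : a = (fun i => (2⁻¹ : k) • (a i + nakayama k (a i))) +
      fun i => (2⁻¹ : k) • (a i - nakayama k (a i)) := by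
    funext i
    rw [Pi.add_apply, ← smul_add, add_add_sub_cancel, ← two_smul k, smul_smul,
      inv_mul_cancel₀ h2, one_smul]
  rw [ha, M.map_add_univ, N.map_add_univ]
  refine Finset.sum_congr rfl fun s _ => h (s.piecewise 1 (-1)) _ fun i => ?_
  by_cases hi : i ∈ s
  · simp [hi, nakayama_nakayama, add_comm]
  · simp [hi, nakayama_nakayama, ← smul_neg]

/-- The multilinear map on `A` given by a normalized cochain. -/
def toMultilinear {r : ℕ}
    (g : MultilinearMap k (fun _ : Fin r => Bar k (TwoCycle k)) (TwoCycle k)) :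
    MultilinearMap k (fun _ : Fin r => TwoCycle k) (TwoCycle k) :=
  g.compLinearMap fun _ => (Submodule.span k {(1 : TwoCycle k)}).mkQ

/-- Invariance, defined through eigenspaces, amounts to commuting with `ν` because the eigenvectors
span; this form is suited to the homotopy formula. -/
lemma map_nakayama_of_isInvariant (h2 : (2 : k) ≠ 0) {r : ℕ} {f : Fun (TwoCycle k) r}
    (hf : f ∈ cochains k (TwoCycle k) r) (hi : IsInvariant (frobeniusData k) f)
    (a : Fin r → TwoCycle k) : f (fun i => nakayama k (a i)) = nakayama k (f a) := by
  obtain ⟨g, rfl⟩ := hf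
  have := eq_of_eigenvectors h2
    (M := (toMultilinear g).compLinearMap fun _ => (nakayama k).toLinearMap)
    (N := (nakayama k).toLinearMap.compMultilinearMap (toMultilinear g)) fun μ a ha => by
      change toMultilinear g (fun i => nakayama k (a i)) = nakayama k (inflate k r g a)
      simp only [ha]
      rw [MultilinearMap.map_smul_univ]
      exact (hi μ a ha).symm
  exact congrArg (fun M : MultilinearMap k (fun _ : Fin r => TwoCycle k) (TwoCycle k) => M a) this

lemma isInvariant_of_map_nakayama {r : ℕ} {f : Fun (TwoCycle k) r}
    (hf : f ∈ cochains k (TwoCycle k) r)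
    (h : ∀ a, f (fun i => nakayama k (a i)) = nakayama k (f a)) :
    IsInvariant (frobeniusData k) f := by
  intro μ a ha
  obtain ⟨g, rfl⟩ := hf
  refine (h a).symm.trans ?_
  have ha' : (fun i => nakayama k (a i)) = fun i => μ i • a i := funext ha
  rw [ha']
  exact (toMultilinear g).map_smul_univ μ a

/-- The pairing with a cochain, as a multilinear map on tuples. -/
def pairingMultilinear {p : ℕ}
    (g : MultilinearMap k (fun _ : Fin p => Bar k (TwoCycle k)) (TwoCycle k)) :
    MultilinearMap k (fun _ : Fin (p + 1) => TwoCycle k) k :=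
  LinearMap.uncurryLeft
    { toFun := fun y => (tr k ∘ₗ LinearMap.mulRight k y).compMultilinearMap (toMultilinear g)
      map_add' := fun y z => by ext a; simp [mul_add]
      map_smul' := fun c y => by ext a; simp }

lemma pairingMultilinear_apply {p : ℕ}
    (g : MultilinearMap k (fun _ : Fin p => Bar k (TwoCycle k)) (TwoCycle k))
    (a : Fin (p + 1) → TwoCycle k) :
    pairingMultilinear g a = pairing k p (inflate k p g) (Finsupp.single a 1) := by
  rw [pairing_single, one_mul]
  rfl

lemma twist_single {p : ℕ} (a : Fin (p + 1) → TwoCycle k) (c : k) :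
    twist (frobeniusData k) p (Finsupp.single a c) =
      Finsupp.single (fun i => nakayama k (a i)) c := by
  rw [twist, Finsupp.lmapDomain_apply, Finsupp.mapDomain_single]
  rfl

lemma pairing_twist {p : ℕ} (F : List (TwoCycle k) → TwoCycle k) (x : Tup k (TwoCycle k) p) :
    pairing k p (restrict p F) (twist (frobeniusData k) p x) =
      pairing k p (restrict p fun l => nakayama k (F (l.map (nakayama k)))) x := by
  induction x using Finsupp.induction_linear with
  | zero => simp
  | add x y hx hy => simp only [map_add, hx, hy]
  | single a c =>
    rw [twist_single, pairing_single, pairing_single, ← tr_nakayama, map_mul, nakayama_nakayama]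
    simp only [restrict, List.map_ofFn]
    rfl

lemma isNormalized_nakayama {F : List (TwoCycle k) → TwoCycle k} (hF : IsNormalized k F) :
    IsNormalized k fun l => nakayama k (F (l.map (nakayama k))) :=
  (hF.map (nakayama k).toAlgHom).comp (nakayama k).toLinearMap

lemma pairing_twist_of_isInvariant (h2 : (2 : k) ≠ 0) {p : ℕ} {f : Fun (TwoCycle k) p}
    (hf : f ∈ cochains k (TwoCycle k) p) (hi : IsInvariant (frobeniusData k) f)
    (x : Tup k (TwoCycle k) p) :
    pairing k p f (twist (frobeniusData k) p x) = pairing k p f x := by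
  have h := map_nakayama_of_isInvariant h2 hf hi
  obtain ⟨F, hF, rfl⟩ := mem_cochains_iff.1 hf
  rw [pairing_twist]
  congr 2
  funext a
  have := congrArg (nakayama k) (h a)
  rw [nakayama_nakayama] at this
  rw [← this]
  simp only [restrict, List.map_ofFn]
  rfl

lemma pairing_twist_of_mem_invariantTuples {p : ℕ} {f : Fun (TwoCycle k) p}
    (hf : f ∈ cochains k (TwoCycle k) p) {x : Tup k (TwoCycle k) p}
    (hx : x ∈ invariantTuples (frobeniusData k) p) :
    pairing k p f (twist (frobeniusData k) p x) = pairing k p f x := by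
  obtain ⟨y, hy, z, hz, rfl⟩ := Submodule.mem_sup.1 hx
  simp only [map_add]
  congr 1
  · obtain ⟨F, hF, rfl⟩ := mem_cochains_iff.1 hf
    rw [pairing_twist, pairing_of_mem_relations hf hy,
      pairing_of_mem_relations (restrict_mem_cochains p (isNormalized_nakayama hF)) hy]
  · obtain ⟨g, rfl⟩ := hf
    refine (Submodule.span_le (p := LinearMap.eqLocus
      (pairing k p (inflate k p g) ∘ₗ twist (frobeniusData k) p)
      (pairing k p (inflate k p g)))).2 ?_ hz
    rintro _ ⟨μ, a, ha, hμ, rfl⟩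
    change pairing k p _ (twist _ p _) = pairing k p _ _
    rw [twist_single, ← pairingMultilinear_apply, ← pairingMultilinear_apply]
    have ha' : (fun i => nakayama k (a i)) = fun i => μ i • a i := funext ha
    rw [ha', MultilinearMap.map_smul_univ, hμ, one_smul]

/-- The sum of a tuple and its twist is invariant. -/
lemma single_add_twist_mem_invariantTuples (h2 : (2 : k) ≠ 0) {p : ℕ}
    (a : Fin (p + 1) → TwoCycle k) :
    Finsupp.single a 1 + twist (frobeniusData k) p (Finsupp.single a 1) ∈
      invariantTuples (frobeniusData k) p := by
  by_contra hx
  have hx' : toChain k (TwoCycle k) p (Finsupp.single a 1 +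
      twist (frobeniusData k) p (Finsupp.single a 1)) ∉
      (invariantTuples (frobeniusData k) p).map (toChain k (TwoCycle k) p) := fun h => by
    obtain ⟨y, hy, hyx⟩ := h
    refine hx ((Submodule.sub_mem_iff_left _ hy).1 (Submodule.mem_sup_left ?_))
    rw [relations, LinearMap.mem_ker, map_sub, hyx, sub_self]
  obtain ⟨θ, hθ, hθ'⟩ := Submodule.exists_le_ker_of_notMem hx'
  obtain ⟨f, ⟨g, rfl⟩, hfθ⟩ := exists_chainFunctional θ
  refine hθ ?_
  rw [← hfθ, map_add, twist_single, ← pairingMultilinear_apply, ← pairingMultilinear_apply]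
  -- On eigenvectors the product of the eigenvalues is `±1`. If it is `1`, the tuple is invariant
  -- and the separating functional kills it; if it is `-1`, the twist changes the sign. Hence the
  -- functional kills the sum of a tuple and its twist.
  have h0 : -pairingMultilinear g =
      (pairingMultilinear g).compLinearMap fun _ => (nakayama k).toLinearMap := by
    refine eq_of_eigenvectors h2 fun μ a ha => ?_
    change -pairingMultilinear g a = pairingMultilinear g fun i => nakayama k (a i)
    simp only [ha]
    rw [MultilinearMap.map_smul_univ, smul_eq_mul]
    by_cases hz : pairingMultilinear g a = 0
    · rw [hz, neg_zero, mul_zero]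
    · have hμ : ∀ i, μ i * μ i = 1 := fun i => by
        have hai : a i ≠ 0 := fun h => hz ((pairingMultilinear g).map_coord_zero i h)
        have h := nakayama_nakayama (a i)
        rw [ha, map_smul, ha, smul_smul] at h
        exact smul_left_injective k hai (h.trans (one_smul k _).symm)
      have hprod : (∏ i, μ i) * ∏ i, μ i = 1 := by
        rw [← Finset.prod_mul_distrib, Finset.prod_eq_one fun i _ => hμ i]
      rcases mul_self_eq_one_iff.1 hprod with h | h
      · refine absurd ?_ hz
        rw [pairingMultilinear_apply, hfθ]
        exact hθ' (Submodule.mem_map_of_mem (Submodule.mem_sup_right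
          (Submodule.subset_span ⟨μ, a, ha, h, rfl⟩)))
      · rw [h, neg_one_mul]
  have := congrArg (fun M : MultilinearMap k (fun _ : Fin (p + 1) => TwoCycle k) k => M a) h0
  exact neg_eq_iff_add_eq_zero.1 this

/-- In the homotopy formula the twist cancels the identity on an invariant chain, and `B∂x` pairs to
zero because `Δ` is adjoint to `B` and the boundary of `x` is a relation. -/
lemma connes_mem_cycles {p : ℕ} {x : Tup k (TwoCycle k) p} (hx : x ∈ cycles (frobeniusData k) p)
    (hi : x ∈ invariantTuples (frobeniusData k) p) :
    connes (frobeniusData k) x ∈ cycles (frobeniusData k) (p + 1) := by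
  refine mem_cycles_succ.2 fun f hf => ?_
  rw [← pairing_boundary]
  cases p with
  | zero => rw [boundary_connes_zero, map_sub, pairing_twist_of_mem_invariantTuples hf hi, sub_self]
  | succ p =>
    rw [boundary_connes, map_sub, map_sub, pairing_twist_of_mem_invariantTuples hf hi, sub_self,
      ← pairing_bvCochain hf, pairing_of_mem_relations (bvCochain_mem_cochains hf) hx, sub_zero]

/-- The transposed argument: `⟨δΔf, x⟩ = ⟨f, B∂x⟩`, and the homotopy formula turns this into `⟨f, νx
- x⟩ - ⟨δf, Bx⟩`, both terms of which vanish. -/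
lemma bvCochain_mem_cocycles (h2 : (2 : k) ≠ 0) {r : ℕ} {f : Fun (TwoCycle k) (r + 1)}
    (hf : f ∈ cocycles k (TwoCycle k) (r + 1)) (hi : IsInvariant (frobeniusData k) f) :
    bvCochain (frobeniusData k) f ∈ cocycles k (TwoCycle k) r := by
  refine mem_cocycles (bvCochain_mem_cochains hf.1) fun x => ?_
  have h := boundary_connes (frobeniusData k) x
  replace h := (eq_sub_iff_add_eq'.2 (eq_sub_iff_add_eq.1 h))
  rw [← pairing_boundary, pairing_bvCochain hf.1, h, map_sub, map_sub,
    pairing_twist_of_isInvariant h2 hf.1 hi, pairing_boundary, LinearMap.mem_ker.1 hf.2]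
  simp

/-! ## The values of the operator on the standard generators -/

lemma pathCoeff_map_nakayama (i : Fin 2) (l : List (TwoCycle k)) :
    pathCoeff i (l.map (nakayama k)) = pathCoeff (i + 1) l := by
  induction l generalizing i with
  | nil => rfl
  | cons a l ih => simp [ih]

lemma nakayama_repCoeff (r : ℕ) (i : Fin 2) :
    nakayama k (repCoeff k r i) = repCoeff k r (i + 1) := by
  unfold repCoeff
  split_ifs <;> simp

lemma nakayama_cycCoeff (r : ℕ) (i : Fin 2) :
    nakayama k (cycCoeff k r i) = cycCoeff k r (i + 1) := by
  unfold cycCoeff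
  split_ifs <;> simp

lemma isInvariant_rep (r : ℕ) : IsInvariant (frobeniusData k) (rep k r) := by
  refine isInvariant_of_map_nakayama (rep_mem_cocycles r).1 fun a => ?_
  have h : List.ofFn (fun i => nakayama k (a i)) = (List.ofFn a).map (nakayama k) := by
    rw [List.map_ofFn]; rfl
  rw [rep, restrict, restrict, h]
  simp [listRep, pathCoeff_map_nakayama, nakayama_repCoeff, Fin.sum_univ_two, add_comm,
    -List.map_ofFn]

lemma cyc_mem_invariantTuples (h2 : (2 : k) ≠ 0) (r : ℕ) :
    cyc k r ∈ invariantTuples (frobeniusData k) r := by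
  convert single_add_twist_mem_invariantTuples h2
    (Fin.cons (cycCoeff k r 0) fun j : Fin r => arrow k (shift 0 j) :
      Fin (r + 1) → TwoCycle k) using 1
  rw [cyc, Fin.sum_univ_two, twist_single]
  congr 2
  funext t
  refine Fin.cases ?_ (fun t => ?_) t
  · simp [nakayama_cycCoeff]
  · have : ∀ (i : Fin 2) n, shift i n + 1 = shift (i + 1) n := fun i n => by
      rw [shift_eq_ite, shift_eq_ite]; split_ifs <;> rfl
    simp [this]

lemma map_nakayama_path (i : Fin 2) (n : ℕ) :
    (path k i n).map (nakayama k) = path k (i + 1) n := by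
  induction n generalizing i with
  | zero => rfl
  | succ n ih => simp [ih]

/-- The vertices alternate, so in a path of odd length the twisted initial arrows continue the path
exactly where it ends. -/
lemma listRotate_path (i : Fin 2) {n t : ℕ} (hn : Odd n) (ht : t ≤ n) :
    listRotate (nakayama k) t (path k i n) = path k (shift i t) n := by
  obtain ⟨m, rfl⟩ := Nat.exists_eq_add_of_le ht
  have hs : shift (shift i t) m = i + 1 := by
    simp only [shift_eq_ite]
    rw [Nat.odd_add] at hn
    by_cases ht : Even t <;> by_cases hm : Even m <;>
      simp_all [← Nat.not_even_iff_odd]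
  rw [path_add, listRotate, List.drop_append_of_le_length (by simp),
    List.take_append_of_le_length (by simp), List.drop_of_length_le (by simp),
    List.take_of_length_le (by simp), List.nil_append, map_nakayama_path, add_comm t m, path_add, hs]

/-- The pairing of the standard cocycle with the Connes operator of the standard cycle. -/
lemma pairing_rep_connes_cyc (h2 : (2 : k) ≠ 0) (p : ℕ) :
    pairing k (p + 1) (rep k (p + 1)) (connes (frobeniusData k) (cyc k p)) =
      if Even p then ((p + 1 : ℕ) : k) / 2 else 0 := by
  have h : pairing k (p + 1) (rep k (p + 1)) (connes (frobeniusData k) (cyc k p)) =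
      ∑ i : Fin 2, ∑ t : Fin (p + 1), (-1 : k) ^ (((t : ℕ) + 1) * p) *
        tr k (listRep k (p + 1) (listRotate (nakayama k) t (path k i p ++ [cycCoeff k p i]))) := by
    simp only [connes_eq_linearCombination, cyc, map_sum, Finsupp.linearCombination_single,
      one_smul, map_smul, pairing_single, rep, restrict, Fin.cons_zero, Fin.cons_succ,
      ofFn_twistedRotate, ofFn_snoc, Fin.tail_cons, ofFn_arrow_shift, mul_one, one_mul,
      smul_eq_mul]
    rfl
  rw [h]
  split_ifs with hp
  -- Each rotation is again a path, with one factor `1 / 2` from the cycle and one from the cocycle;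
  -- the `2 (p + 1)` equal terms add up to `(p + 1) / 2`.
  · have key : ∀ i : Fin 2, ∀ t : Fin (p + 1), (-1 : k) ^ (((t : ℕ) + 1) * p) *
        tr k (listRep k (p + 1) (listRotate (nakayama k) t (path k i p ++ [cycCoeff k p i]))) =
          2⁻¹ * 2⁻¹ := fun i t => by
      have hT := (isNormalized_tr_listRotate (isNormalized_listRep (k := k) (p + 1)) t 1).smul
        (2⁻¹) (path k i p) (arrow k i) []
      have hT' := congrArg (fun y : TwoCycle k => y.e 0) hT
      simp only [smul_e, Pi.smul_apply, one_e, smul_eq_mul, mul_one] at hT'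
      have hpath : path k i p ++ [arrow k i] = path k i (p + 1) := by
        rw [path_add, shift_even i hp]; rfl
      rw [(hp.mul_left _).neg_one_pow, one_mul, cycCoeff, if_pos hp, one_div, hT', hpath,
        listRotate_path i hp.add_one t.isLt.le, listRep]
      simp only [pathCoeff_path_succ, ite_smul, one_smul, zero_smul, Finset.sum_ite_eq',
        Finset.mem_univ, if_true, repCoeff, if_neg (Nat.not_even_iff_odd.2 hp.add_one), map_smul]
      generalize shift i t = j
      fin_cases j <;> simp [tr_apply, arrow]
    simp only [key, Finset.sum_const, Finset.card_univ, Fintype.card_fin, nsmul_eq_mul]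
    push_cast
    field_simp
  -- For odd `p` the standard cocycle of degree `p + 1` takes values in the span of the idempotents,
  -- where the trace is zero.
  · refine Finset.sum_eq_zero fun i _ => Finset.sum_eq_zero fun t _ => ?_
    have hp' : Even (p + 1) := (Nat.not_even_iff_odd.1 hp).add_one
    simp [listRep, repCoeff, hp', tr_apply, idem]

lemma pairing_bvCochain_cyc (h2 : (2 : k) ≠ 0) {r : ℕ} {f : Fun (TwoCycle k) (r + 1)}
    (hf : f ∈ cocycles k (TwoCycle k) (r + 1)) :
    pairing k r (bvCochain (frobeniusData k) f) (cyc k r) =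
      pairing k (r + 1) f (cyc k (r + 1)) * if Even r then ((r + 1 : ℕ) : k) / 2 else 0 := by
  rw [pairing_bvCochain hf.1, pairing_eq_mul h2 hf (connes_mem_cycles (cyc_mem_cycles r)
    (cyc_mem_invariantTuples h2 r)), pairing_rep_connes_cyc h2]

lemma pairing_rep_connes (h2 : (2 : k) ≠ 0) {p : ℕ} {x : Tup k (TwoCycle k) p}
    (hx : x ∈ cycles (frobeniusData k) p) :
    pairing k (p + 1) (rep k (p + 1)) (connes (frobeniusData k) x) =
      (if Even p then ((p + 1 : ℕ) : k) / 2 else 0) * pairing k p (rep k p) x := by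
  have hrep := rep_mem_cocycles (k := k) (p + 1)
  rw [← pairing_bvCochain hrep.1,
    pairing_eq_mul h2 (bvCochain_mem_cocycles h2 hrep (isInvariant_rep _)) hx,
    pairing_bvCochain_cyc h2 hrep, pairing_rep_cyc h2, one_mul]

end TwoCycle

namespace TwoCycle

variable {k : Type u} [Field k]

/-! ## The basis of the complete cohomology -/

/-- Makes the pairing with `cyc r` a well-defined coordinate on cohomology; in degree `0` there are
no nonzero coboundaries. -/
lemma coboundaries_le (r : ℕ) : coboundaries (frobeniusData k) r ≤
    LinearMap.ker ((pairing k r).flip (cyc k r)) := by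
  cases r with
  | zero =>
    rintro _ ⟨x, rfl⟩
    rw [norm_eq_zero]
    simp
  | succ r =>
    rintro _ ⟨f, hf, rfl⟩
    exact mem_cycles_succ.1 (cyc_mem_cycles (r + 1)) f hf

/-- The functional on chains given by the pairing with the standard cocycle. -/
lemma exists_rep_functional (p : ℕ) : ∃ θ : Chain k (TwoCycle k) p →ₗ[k] k,
    (∀ x, θ (toChain k (TwoCycle k) p x) = pairing k p (rep k p) x) ∧
    chainBoundaries (frobeniusData k) p ≤ LinearMap.ker θ := by
  obtain ⟨⟨g, hg⟩, h⟩ := rep_mem_cocycles (k := k) p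
  refine ⟨chainFunctional g, fun x => by rw [chainFunctional_toChain, hg], ?_⟩
  rintro _ ⟨_, ⟨x, rfl⟩, rfl⟩
  rw [LinearMap.mem_ker, chainFunctional_toChain, hg, pairing_boundary, LinearMap.mem_ker.1 h]
  simp

/-- The coordinate on the complete cohomology in degree `n`. -/
def coord : ∀ n : ℤ, HH (frobeniusData k) n →ₗ[k] k
  | .ofNat r => ((coboundaries (frobeniusData k) r).liftQ _ (coboundaries_le r)).comp
      (Submodule.subtype ((cocycles k (TwoCycle k) r).map (coboundaries (frobeniusData k) r).mkQ))
  | .negSucc p => ((chainBoundaries (frobeniusData k) p).liftQ _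
      (exists_rep_functional p).choose_spec.2).comp
      (Submodule.subtype ((chainCycles (frobeniusData k) p).map
        (chainBoundaries (frobeniusData k) p).mkQ))

/-- The coordinates on the complete cohomology. -/
def coords : Complete (frobeniusData k) →ₗ[k] ℤ →₀ k :=
  DirectSum.toModule k ℤ _ fun n => Finsupp.lsingle n ∘ₗ coord n

lemma coords_cls {r : ℕ} (f : Fun (TwoCycle k) r) (hf : f ∈ cocycles k (TwoCycle k) r) :
    coords (cls (frobeniusData k) f hf) = Finsupp.single (r : ℤ) (pairing k r f (cyc k r)) := by
  exact DirectSum.toModule_lof k (M := HH (frobeniusData k)) (Int.ofNat r) _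

lemma coords_negCls {p : ℕ} (x : Tup k (TwoCycle k) p) (hx : x ∈ cycles (frobeniusData k) p) :
    coords (negCls (frobeniusData k) x hx) =
      Finsupp.single (-((p : ℤ) + 1)) (pairing k p (rep k p) x) := by
  rw [← (exists_rep_functional p).choose_spec.1 x, ← Int.negSucc_eq]
  exact DirectSum.toModule_lof k (M := HH (frobeniusData k)) (Int.negSucc p) _

/-- The standard generator of the complete cohomology in degree `n`. -/
def gen : ℤ → Complete (frobeniusData k)
  | .ofNat r => cls (frobeniusData k) (rep k r) (rep_mem_cocycles r)
  | .negSucc p => negCls (frobeniusData k) (cyc k p) (cyc_mem_cycles p)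

lemma coords_gen (h2 : (2 : k) ≠ 0) (n : ℤ) : coords (k := k) (gen n) = Finsupp.single n 1 := by
  cases n with
  | ofNat r => rw [gen, coords_cls, pairing_rep_cyc h2]; rfl
  | negSucc p => rw [gen, coords_negCls, pairing_rep_cyc h2, Int.negSucc_eq]

lemma mem_coboundaries {r : ℕ} {f g : Fun (TwoCycle k) r} {G : List (TwoCycle k) → TwoCycle k}
    (hG : IsNormalized k G) (h : f = g + restrict r (listD G)) :
    f - g ∈ coboundaries (frobeniusData k) r := by
  rw [h, add_sub_cancel_left]
  cases r with
  | zero =>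
    have : restrict 0 (listD G) = 0 := by funext a; simp [restrict]
    rw [this]
    exact Submodule.zero_mem _
  | succ r => exact ⟨_, restrict_mem_cochains r hG, coboundary_restrict r G⟩

lemma cls_eq (h2 : (2 : k) ≠ 0) {r : ℕ} (f : Fun (TwoCycle k) r)
    (hf : f ∈ cocycles k (TwoCycle k) r) :
    cls (frobeniusData k) f hf = pairing k r f (cyc k r) • gen (r : ℤ) := by
  refine Eq.trans (congrArg (DirectSum.lof k ℤ (HH (frobeniusData k)) (Int.ofNat r)) ?_)
    (map_smul (DirectSum.lof k ℤ (HH (frobeniusData k)) (Int.ofNat r)) _ _)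
  refine Subtype.ext ?_
  change (coboundaries (frobeniusData k) r).mkQ f =
    pairing k r f (cyc k r) • (coboundaries (frobeniusData k) r).mkQ (rep k r)
  rw [← map_smul]
  refine (Submodule.Quotient.eq _).2 ?_
  obtain ⟨F, hF, rfl, hD⟩ := mem_cocycles_iff.1 hf
  obtain ⟨G, hG, h⟩ := exists_eq_smul_listRep h2 hF hD
  exact mem_coboundaries hG (funext fun a => h _ (by simp))

/-- By the rank one formula the difference of the two cycles pairs to zero with all cocycles, so it
is a boundary by duality. -/
lemma negCls_eq (h2 : (2 : k) ≠ 0) {p : ℕ} (x : Tup k (TwoCycle k) p)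
    (hx : x ∈ cycles (frobeniusData k) p) :
    negCls (frobeniusData k) x hx = pairing k p (rep k p) x • gen (-((p : ℤ) + 1)) := by
  rw [← Int.negSucc_eq]
  refine Eq.trans (congrArg (DirectSum.lof k ℤ (HH (frobeniusData k)) (Int.negSucc p)) ?_)
    (map_smul (DirectSum.lof k ℤ (HH (frobeniusData k)) (Int.negSucc p)) _ _)
  refine Subtype.ext ?_
  change (chainBoundaries (frobeniusData k) p).mkQ (toChain k (TwoCycle k) p x) =
    pairing k p (rep k p) x • (chainBoundaries (frobeniusData k) p).mkQ
      (toChain k (TwoCycle k) p (cyc k p))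
  rw [← map_smul, ← map_smul]
  refine (Submodule.Quotient.eq _).2 ?_
  rw [← map_sub]
  refine toChain_mem_chainBoundaries fun f hf => ?_
  rw [map_sub, map_smul, pairing_eq_mul h2 hf hx, smul_eq_mul, mul_comm, sub_self]

lemma lof_induction {n : ℤ} {P : Complete (frobeniusData k) → Prop}
    (hcls : ∀ (r : ℕ) (f : Fun (TwoCycle k) r) (hf : f ∈ cocycles k (TwoCycle k) r), (r : ℤ) = n →
      P (cls (frobeniusData k) f hf))
    (hneg : ∀ (p : ℕ) (x : Tup k (TwoCycle k) p) (hx : x ∈ cycles (frobeniusData k) p),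
      -((p : ℤ) + 1) = n → P (negCls (frobeniusData k) x hx))
    (y : HH (frobeniusData k) n) : P (DirectSum.lof k ℤ (HH (frobeniusData k)) n y) := by
  cases n with
  | ofNat r =>
    obtain ⟨_, ⟨f, hf, rfl⟩⟩ := y
    exact hcls r f hf rfl
  | negSucc p =>
    obtain ⟨_, ⟨_, ⟨x, hx, rfl⟩, rfl⟩⟩ := y
    exact hneg p x hx (Int.negSucc_eq p).symm

/-- The standard generators are a basis of the complete cohomology. -/
def genBasis (h2 : (2 : k) ≠ 0) : Module.Basis ℤ k (Complete (frobeniusData k)) :=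
  .ofRepr (LinearEquiv.ofLinearMap coords (Finsupp.linearCombination k gen)
    (by
      ext n : 2
      simp [coords_gen h2])
    (by
      refine DirectSum.linearMap_ext k fun n => LinearMap.ext fun y => ?_
      refine lof_induction (P := fun y => Finsupp.linearCombination k gen (coords y) = y)
        (fun r f hf _ => ?_) (fun p x hx _ => ?_) y
      · rw [coords_cls, Finsupp.linearCombination_single, cls_eq h2]
      · rw [coords_negCls, Finsupp.linearCombination_single, negCls_eq h2]))

@[simp] lemma genBasis_apply (h2 : (2 : k) ≠ 0) (n : ℤ) : genBasis h2 n = gen n := by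
  simp [genBasis, Module.Basis.coe_ofRepr]

lemma gen_ne_zero (h2 : (2 : k) ≠ 0) (n : ℤ) : gen (k := k) n ≠ 0 := by
  rw [← genBasis_apply h2]
  exact (genBasis h2).ne_zero n

lemma degree_eq_span (h2 : (2 : k) ≠ 0) (n : ℤ) :
    degree (frobeniusData k) n = Submodule.span k {gen n} := by
  apply le_antisymm
  · rintro _ ⟨y, rfl⟩
    refine lof_induction (P := fun y => y ∈ Submodule.span k {gen n}) (fun r f hf h => ?_)
      (fun p x hx h => ?_) y
    · rw [cls_eq h2, h]
      exact Submodule.smul_mem _ _ (Submodule.mem_span_singleton_self _)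
    · rw [negCls_eq h2, h]
      exact Submodule.smul_mem _ _ (Submodule.mem_span_singleton_self _)
  · rw [Submodule.span_le, Set.singleton_subset_iff]
    cases n <;> exact LinearMap.mem_range_self _ _

/-! ## The product and the operator on the complete cohomology -/

/-- The product on the complete cohomology. -/
def starProduct (h2 : (2 : k) ≠ 0) :
    Complete (frobeniusData k) →ₗ[k] Complete (frobeniusData k) →ₗ[k] Complete (frobeniusData k) :=
  (genBasis h2).constr k fun m => (genBasis h2).constr k fun n => oddConst k m n • gen (m + n)

@[simp] lemma starProduct_gen (h2 : (2 : k) ≠ 0) (m n : ℤ) :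
    starProduct h2 (gen m) (gen n) = oddConst k m n • gen (m + n) := by
  rw [← genBasis_apply h2 m, ← genBasis_apply h2 n, starProduct, Module.Basis.constr_basis,
    Module.Basis.constr_basis]

/-- The Batalin-Vilkovisky operator on the complete cohomology. -/
def bvOperator (h2 : (2 : k) ≠ 0) : Complete (frobeniusData k) →ₗ[k] Complete (frobeniusData k) :=
  (genBasis h2).constr k fun n => if Even n then 0 else ((n : k) / 2) • gen (n - 1)

lemma bvOperator_gen (h2 : (2 : k) ≠ 0) (n : ℤ) :
    bvOperator h2 (gen n) = if Even n then 0 else ((n : k) / 2) • gen (n - 1) := by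
  rw [← genBasis_apply h2 n, bvOperator, Module.Basis.constr_basis]

lemma oddConst_congr {a b c d : ℤ} (h : Even a ∨ Even b ↔ Even c ∨ Even d) :
    oddConst k a b = oddConst k c d := by
  simp only [oddConst, h]

/-- In each of the six cases both sides are multiples of the same generator, and the coefficients
agree by the structure constants for arbitrary cocycles and cycles. -/
lemma isStarProduct_starProduct (h2 : (2 : k) ≠ 0) :
    IsStarProduct (frobeniusData k) (starProduct h2) where
  cup {m n} f hf g hg := ⟨cup_mem_cocycles hf hg, by
    rw [cls_eq h2, cls_eq h2, cls_eq h2, pairing_cup h2 hf hg]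
    simp only [map_smul, LinearMap.smul_apply, starProduct_gen, smul_smul, Nat.cast_add]
    congr 1
    ring⟩
  capRight {m q} x hx f hf := ⟨capRight_mem_cycles hx hf, by
    rw [cls_eq h2, negCls_eq h2, negCls_eq h2, pairing_rep_capRight h2 hx hf]
    simp only [map_smul, LinearMap.smul_apply, starProduct_gen, smul_smul]
    -- For odd `m` the degree `-(m + q + 1)` has the parity of `q`, so the two conditions on
    -- parities agree.
    rw [show -(((m + q : ℕ) : ℤ) + 1) + m = -((q : ℤ) + 1) by push_cast; ring,
      oddConst_congr (a := -(((m + q : ℕ) : ℤ) + 1)) (c := m) (d := q)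
        (by push_cast; simp only [even_neg, parity_simps]; tauto)]
    congr 1
    ring⟩
  capLeft {m q} f hf x hx := ⟨capLeft_mem_cycles hf hx, by
    rw [cls_eq h2, negCls_eq h2, negCls_eq h2, pairing_rep_capLeft h2 hf hx]
    simp only [map_smul, LinearMap.smul_apply, starProduct_gen, smul_smul]
    rw [show (m : ℤ) + -(((q + m : ℕ) : ℤ) + 1) = -((q : ℤ) + 1) by push_cast; ring,
      oddConst_congr (b := -(((q + m : ℕ) : ℤ) + 1)) (c := q) (d := m)
        (by push_cast; simp only [even_neg, parity_simps]; tauto)]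
    congr 1
    ring⟩
  mixLeft {s p} f hf x hx := ⟨mixLeft_mem_cocycles hf hx, by
    rw [cls_eq h2, negCls_eq h2, cls_eq h2, pairing_mixLeft_cyc h2 hf hx]
    simp only [map_smul, LinearMap.smul_apply, starProduct_gen, smul_smul]
    rw [show ((s + (p + 1) : ℕ) : ℤ) + -((p : ℤ) + 1) = s by push_cast; ring,
      oddConst_congr (a := ((s + (p + 1) : ℕ) : ℤ)) (c := (p : ℤ) + 1) (d := (s : ℤ) + 1)
        (by push_cast; simp only [even_neg, parity_simps]; tauto)]
    congr 1
    ring⟩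
  mixRight {s p} x hx f hf := ⟨mixRight_mem_cocycles hx hf, by
    rw [cls_eq h2, negCls_eq h2, cls_eq h2, pairing_mixRight_cyc h2 hx hf]
    simp only [map_smul, LinearMap.smul_apply, starProduct_gen, smul_smul]
    rw [show -((p : ℤ) + 1) + ((p + (s + 1) : ℕ) : ℤ) = s by push_cast; ring,
      oddConst_congr (b := ((p + (s + 1) : ℕ) : ℤ)) (c := (s : ℤ) + 1) (d := (p : ℤ) + 1)
        (by push_cast; simp only [even_neg, parity_simps]; tauto)]
    congr 1
    ring⟩
  negMul {p q} x hx y hy := ⟨negMul_mem_cycles hx hy, by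
    rw [negCls_eq h2, negCls_eq h2, negCls_eq h2, pairing_rep_negMul_cycles h2 hx hy]
    simp only [map_smul, LinearMap.smul_apply, starProduct_gen, smul_smul]
    rw [show -((p : ℤ) + 1) + -((q : ℤ) + 1) = -(((q + (p + 1) : ℕ) : ℤ) + 1) by push_cast; ring,
      oddConst_congr (c := (p : ℤ) + 1) (d := (q : ℤ) + 1) (by simp only [even_neg])]
    congr 1
    ring⟩

/-- The generators span, and each pair of degrees falls under one of the six clauses, applied to the
standard representatives. -/
lemma starProduct_unique (h2 : (2 : k) ≠ 0)
    {S S' : Complete (frobeniusData k) →ₗ[k] Complete (frobeniusData k) →ₗ[k]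
      Complete (frobeniusData k)}
    (hS : IsStarProduct (frobeniusData k) S) (hS' : IsStarProduct (frobeniusData k) S') :
    S = S' := by
  refine (genBasis h2).ext fun m => (genBasis h2).ext fun n => ?_
  rw [genBasis_apply, genBasis_apply]
  cases m with
  | ofNat m =>
    cases n with
    | ofNat n =>
      obtain ⟨_, h⟩ := hS.cup (rep k m) (rep_mem_cocycles m) (rep k n) (rep_mem_cocycles n)
      obtain ⟨_, h'⟩ := hS'.cup (rep k m) (rep_mem_cocycles m) (rep k n) (rep_mem_cocycles n)
      exact h.trans h'.symm
    | negSucc p =>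
      rcases le_or_gt m p with hmp | hmp
      · obtain ⟨q, rfl⟩ := Nat.exists_eq_add_of_le' hmp
        obtain ⟨_, h⟩ := hS.capLeft (rep k m) (rep_mem_cocycles m) _ (cyc_mem_cycles (q + m))
        obtain ⟨_, h'⟩ := hS'.capLeft (rep k m) (rep_mem_cocycles m) _ (cyc_mem_cycles (q + m))
        exact h.trans h'.symm
      · obtain ⟨s, rfl⟩ := Nat.exists_eq_add_of_le' (Nat.succ_le_of_lt hmp)
        obtain ⟨_, h⟩ := hS.mixLeft _ (rep_mem_cocycles (s + (p + 1))) _ (cyc_mem_cycles p)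
        obtain ⟨_, h'⟩ := hS'.mixLeft _ (rep_mem_cocycles (s + (p + 1))) _ (cyc_mem_cycles p)
        exact h.trans h'.symm
  | negSucc p =>
    cases n with
    | ofNat m =>
      rcases le_or_gt m p with hmp | hmp
      · obtain ⟨q, rfl⟩ := Nat.exists_eq_add_of_le hmp
        obtain ⟨_, h⟩ := hS.capRight _ (cyc_mem_cycles (m + q)) _ (rep_mem_cocycles m)
        obtain ⟨_, h'⟩ := hS'.capRight _ (cyc_mem_cycles (m + q)) _ (rep_mem_cocycles m)
        exact h.trans h'.symm
      · obtain ⟨s, rfl⟩ : ∃ s, m = p + (s + 1) := ⟨m - (p + 1), by omega⟩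
        obtain ⟨_, h⟩ := hS.mixRight _ (cyc_mem_cycles p) _ (rep_mem_cocycles (p + (s + 1)))
        obtain ⟨_, h'⟩ := hS'.mixRight _ (cyc_mem_cycles p) _ (rep_mem_cocycles (p + (s + 1)))
        exact h.trans h'.symm
    | negSucc q =>
      obtain ⟨_, h⟩ := hS.negMul _ (cyc_mem_cycles p) _ (cyc_mem_cycles q)
      obtain ⟨_, h'⟩ := hS'.negMul _ (cyc_mem_cycles p) _ (cyc_mem_cycles q)
      exact h.trans h'.symm

/-- In degree `n = -p-1` with `p` even, the sign `(-1)^n` turns the factor `(p + 1) / 2` of `B` into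
`n / 2`, so that one formula serves positive and negative degrees. -/
lemma isBVOperator_bvOperator (h2 : (2 : k) ≠ 0) :
    IsBVOperator (frobeniusData k) (bvOperator h2) where
  pos {r} f hf hi := ⟨bvCochain_mem_cocycles h2 hf hi, by
    rw [cls_eq h2, cls_eq h2, map_smul, bvOperator_gen, pairing_bvCochain_cyc h2 hf]
    have hr : Even ((r + 1 : ℕ) : ℤ) ↔ ¬ Even r := by
      rw [Int.even_coe_nat, Nat.even_add_one]
    simp only [hr, ite_not]
    split_ifs
    · rw [smul_smul, Int.cast_natCast, Nat.cast_add (R := ℤ), Nat.cast_one, add_sub_cancel_right]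
    · simp⟩
  zero f hf := by
    rw [cls_eq h2, map_smul, bvOperator_gen, if_pos (by simp), smul_zero]
  neg {p} x hx hi := ⟨Submodule.smul_mem _ _ (connes_mem_cycles hx hi), by
    rw [negCls_eq h2, negCls_eq h2, map_smul, bvOperator_gen, map_smul, pairing_rep_connes h2 hx]
    have hp : Even (-((p : ℤ) + 1)) ↔ ¬ Even p := by
      rw [even_neg, Int.even_add_one, Int.even_coe_nat]
    simp only [hp, ite_not]
    split_ifs with h
    · rw [smul_smul, smul_eq_mul, h.add_one.neg_one_pow,
        show -((p : ℤ) + 1) - 1 = -(((p + 1 : ℕ) : ℤ) + 1) by push_cast; ring]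
      congr 1
      push_cast
      ring
    · simp⟩

/-- The definition constrains the operator only through invariant representatives; uniqueness holds
because `rep` and `cyc` are invariant. -/
lemma bvOperator_unique (h2 : (2 : k) ≠ 0)
    {Δ Δ' : Complete (frobeniusData k) →ₗ[k] Complete (frobeniusData k)}
    (hΔ : IsBVOperator (frobeniusData k) Δ) (hΔ' : IsBVOperator (frobeniusData k) Δ') :
    Δ = Δ' := by
  refine (genBasis h2).ext fun n => ?_
  rw [genBasis_apply]
  rcases n with (_ | r) | p
  · exact (hΔ.zero _ (rep_mem_cocycles 0)).trans (hΔ'.zero _ (rep_mem_cocycles 0)).symm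
  · obtain ⟨_, h⟩ := hΔ.pos _ (rep_mem_cocycles (r + 1)) (isInvariant_rep _)
    obtain ⟨_, h'⟩ := hΔ'.pos _ (rep_mem_cocycles (r + 1)) (isInvariant_rep _)
    exact h.trans h'.symm
  · obtain ⟨_, h⟩ := hΔ.neg _ (cyc_mem_cycles p) (cyc_mem_invariantTuples h2 p)
    obtain ⟨_, h'⟩ := hΔ'.neg _ (cyc_mem_cycles p) (cyc_mem_invariantTuples h2 p)
    exact h.trans h'.symm

/-! ## The generators `α`, `β`, `α⁻¹` -/

lemma one_eq_gen (h2 : (2 : k) ≠ 0) : one k = gen 0 := by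
  have h : pairing k 0 (oneCochain k) (cyc k 0) = 1 := by
    simp only [cyc, cycCoeff, oneCochain, map_sum, pairing_single]
    simpa [tr_apply, arrow] using inv_two_add h2
  rw [one, cls_eq h2, h, one_smul]
  rfl

lemma alpha_eq_gen (h2 : (2 : k) ≠ 0) : alpha k = gen 2 := by
  have h : pairing k 2 (alphaCochain k) (cyc k 2) = 1 := by
    simp only [cyc, map_sum, pairing_single, alphaCochain, Fin.cons_zero, Fin.cons_succ]
    simpa [cycCoeff, tr_apply, arrow, idem] using inv_two_add h2
  rw [alpha, cls_eq h2, h, one_smul]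
  rfl

/-- The defining cochain of `β` does not commute with `ν`. Its class is that of the symmetric
cocycle `α_i ↦ (1 / 2) α_i`, from which `Δ β` can be computed. -/
lemma beta_eq_gen (h2 : (2 : k) ≠ 0) : beta k = gen 1 := by
  have h : pairing k 1 (betaCochain k) (cyc k 1) = 1 := by
    simp [cyc, cycCoeff, betaCochain, tr_apply, arrow, idem]
  rw [beta, cls_eq h2, h, one_smul]
  rfl

lemma alphaInv_eq_gen (h2 : (2 : k) ≠ 0) : alphaInv k = gen (-2) := by
  have h : pairing k 1 (rep k 1) (gammaTuple k) = 1 := by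
    simpa [gammaTuple, rep, restrict, listRep, repCoeff, tr_apply, arrow, idem]
      using inv_two_add h2
  rw [alphaInv, negCls_eq h2, h, one_smul]
  rfl

lemma alphaPow_eq_gen (h2 : (2 : k) ≠ 0) (n : ℤ) : alphaPow (starProduct h2) n = gen (2 * n) := by
  have hodd : ∀ m n : ℤ, Even m → oddConst k m n = 1 := fun m n hm => if_pos (Or.inl hm)
  have key : ∀ (m : ℤ), Even m → ∀ n : ℕ,
      (starProduct h2 (gen (k := k) m))^[n] (gen 0) = gen (m * n) := fun m hm n => by
    induction n with
    | zero => simp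
    | succ n ih =>
      rw [Function.iterate_succ_apply', ih, starProduct_gen, hodd _ _ hm, one_smul]
      congr 1
      push_cast
      ring
  cases n with
  | ofNat n =>
    rw [alphaPow, alpha_eq_gen h2, one_eq_gen h2, key 2 even_two]
    rfl
  | negSucc n =>
    rw [alphaPow, alphaInv_eq_gen h2, one_eq_gen h2, key (-2) (by decide), Int.negSucc_eq]
    push_cast
    rw [neg_mul, mul_neg]

lemma starProduct_gen_two_mul_gen_one (h2 : (2 : k) ≠ 0) (n : ℤ) :
    starProduct h2 (gen (2 * n)) (gen 1) = gen (2 * n + 1) := by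
  rw [starProduct_gen, oddConst, if_pos (Or.inl (even_two_mul n)), one_smul]

/-! ## The bracket -/

variable (m n : ℤ)

lemma bracket_even_even (h2 : (2 : k) ≠ 0) : bracket (frobeniusData k) (starProduct h2)
    (bvOperator h2) (2 * m) (2 * n) (gen (2 * m)) (gen (2 * n)) = 0 := by
  simp [bracket, bvOperator_gen, ← mul_add]

lemma bracket_even_odd (h2 : (2 : k) ≠ 0) : bracket (frobeniusData k) (starProduct h2)
    (bvOperator h2) (2 * m) (2 * n + 1) (gen (2 * m)) (gen (2 * n + 1)) =
      (m : k) • gen (2 * (m + n)) := by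
  have e₁ : (2 * m * (2 * n + 1) + 2 * m + (2 * n + 1)).negOnePow = -1 :=
    Int.negOnePow_odd _ ⟨2 * m * n + 2 * m + n, by ring⟩
  have e₂ : (2 * m + 1).negOnePow = -1 := Int.negOnePow_odd _ (odd_two_mul_add_one m)
  have p₁ : ¬ Even (2 * m + (2 * n + 1)) := by simp [parity_simps]
  have p₂ : ¬ Even (2 * n + 1) := by simp [parity_simps]
  simp only [bracket, starProduct_gen, bvOperator_gen, oddConst, even_two_mul, true_or, if_true,
    one_smul, if_neg p₁, if_neg p₂, e₁, e₂, Units.neg_smul, map_smul, LinearMap.zero_apply,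
    smul_zero, map_zero, add_zero]
  rw [show 2 * m + (2 * n + 1) - 1 = 2 * (m + n) by ring,
    show 2 * m + (2 * n + 1 - 1) = 2 * (m + n) by ring, ← neg_smul, ← add_smul, ← neg_smul]
  congr 1
  push_cast
  field_simp
  ring

lemma bracket_odd_even (h2 : (2 : k) ≠ 0) : bracket (frobeniusData k) (starProduct h2)
    (bvOperator h2) (2 * m + 1) (2 * n) (gen (2 * m + 1)) (gen (2 * n)) =
      -(n : k) • gen (2 * (m + n)) := by
  have e₁ : ((2 * m + 1) * (2 * n) + (2 * m + 1) + 2 * n).negOnePow = -1 :=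
    Int.negOnePow_odd _ ⟨2 * m * n + 2 * n + m, by ring⟩
  have e₂ : (2 * m + 1 + 1).negOnePow = 1 := Int.negOnePow_even _ ⟨m + 1, by ring⟩
  have e₃ : (2 * m + 1).negOnePow = -1 := Int.negOnePow_odd _ (odd_two_mul_add_one m)
  have p₁ : ¬ Even (2 * m + 1 + 2 * n) := by simp [parity_simps]
  have p₂ : ¬ Even (2 * m + 1) := by simp [parity_simps]
  simp only [bracket, starProduct_gen, bvOperator_gen, oddConst, even_two_mul, or_true, if_true,
    one_smul, if_neg p₁, if_neg p₂, e₁, e₂, e₃, Units.neg_smul, map_smul, LinearMap.smul_apply,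
    map_zero, add_zero]
  rw [show 2 * m + 1 + 2 * n - 1 = 2 * (m + n) by ring,
    show 2 * m + 1 - 1 + 2 * n = 2 * (m + n) by ring, ← neg_smul, ← add_smul, ← neg_smul]
  congr 1
  push_cast
  field_simp
  ring

/-- The product of two odd generators vanishes, so only the two terms with `Δ` on a single factor
contribute, giving `(2m + 1) / 2 - (2n + 1) / 2`. -/
lemma bracket_odd_odd (h2 : (2 : k) ≠ 0) : bracket (frobeniusData k) (starProduct h2)
    (bvOperator h2) (2 * m + 1) (2 * n + 1) (gen (2 * m + 1)) (gen (2 * n + 1)) =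
      ((m - n : ℤ) : k) • gen (2 * (m + n) + 1) := by
  have e₁ : ((2 * m + 1) * (2 * n + 1) + (2 * m + 1) + (2 * n + 1)).negOnePow = -1 :=
    Int.negOnePow_odd _ ⟨2 * m * n + 2 * n + 2 * m + 1, by ring⟩
  have e₃ : (2 * m + 1).negOnePow = -1 := Int.negOnePow_odd _ (odd_two_mul_add_one m)
  have p₁ : ∀ m : ℤ, ¬ Even (2 * m + 1) := fun m => by simp [parity_simps]
  have p₂ : ∀ m : ℤ, Even (2 * m + 1 - 1) := fun m => by simp
  simp only [bracket, starProduct_gen, bvOperator_gen, oddConst, p₁, p₂, or_self, true_or, or_true,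
    if_true, if_false, one_smul, zero_smul, e₁, e₃, Units.neg_smul, map_smul,
    LinearMap.smul_apply, smul_zero, map_zero, zero_add]
  rw [show 2 * m + 1 + (2 * n + 1 - 1) = 2 * (m + n) + 1 by ring,
    show 2 * m + 1 - 1 + (2 * n + 1) = 2 * (m + n) + 1 by ring, ← neg_smul, ← add_smul, ← neg_smul]
  congr 1
  push_cast
  field_simp
  ring

end TwoCycle

end TateHochschild

end

/-! ### The main theorem. -/

theorem mainTheorem10 (k : Type*) [Field k] [IsAlgClosed k] (hk : ringChar k ≠ 2) :
    ∃ (S : Complete (frobeniusData k) →ₗ[k] Complete (frobeniusData k) →ₗ[k] Complete (frobeniusData k))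
      (Δ : Complete (frobeniusData k) →ₗ[k] Complete (frobeniusData k)),
      -- the `⋆`-product and the BV operator are well defined on the complete cohomology
      IsStarProduct (frobeniusData k) S ∧ (∀ S', IsStarProduct (frobeniusData k) S' → S' = S) ∧
      IsBVOperator (frobeniusData k) Δ ∧ (∀ Δ', IsBVOperator (frobeniusData k) Δ' → Δ' = Δ) ∧
      -- `α⁻¹` is inverse to `α`, and the `α^n`, `α^n β` are a basis of the complete cohomology
      S (alpha k) (alphaInv k) = one k ∧ S (alphaInv k) (alpha k) = one k ∧
      (∀ n : ℤ, alphaPow S n ≠ 0 ∧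
        degree (frobeniusData k) (2 * n) = Submodule.span k {alphaPow S n}) ∧
      (∀ n : ℤ, S (alphaPow S n) (beta k) ≠ 0 ∧
        degree (frobeniusData k) (2 * n + 1) = Submodule.span k {S (alphaPow S n) (beta k)}) ∧
      -- the BV differential
      (∀ n : ℤ, Δ (S (alphaPow S n) (beta k)) = (((2 * n + 1 : ℤ) : k) / 2) • alphaPow S n) ∧
      (∀ n : ℤ, Δ (alphaPow S n) = 0) ∧
      -- the brackets of the generators
      bracket (frobeniusData k) S Δ 2 1 (alpha k) (beta k) = alpha k ∧
      bracket (frobeniusData k) S Δ 1 (-2) (beta k) (alphaInv k) = alphaInv k ∧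
      bracket (frobeniusData k) S Δ 1 2 (beta k) (alpha k) = -alpha k ∧
      bracket (frobeniusData k) S Δ (-2) 1 (alphaInv k) (beta k) = -alphaInv k ∧
      bracket (frobeniusData k) S Δ 2 2 (alpha k) (alpha k) = 0 ∧
      bracket (frobeniusData k) S Δ 2 (-2) (alpha k) (alphaInv k) = 0 ∧
      bracket (frobeniusData k) S Δ (-2) 2 (alphaInv k) (alpha k) = 0 ∧
      bracket (frobeniusData k) S Δ (-2) (-2) (alphaInv k) (alphaInv k) = 0 ∧
      bracket (frobeniusData k) S Δ 1 1 (beta k) (beta k) = 0 ∧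
      -- the induced brackets of all basis elements
      (∀ m n : ℤ, bracket (frobeniusData k) S Δ (2 * m) (2 * n) (alphaPow S m) (alphaPow S n) = 0) ∧
      (∀ m n : ℤ, bracket (frobeniusData k) S Δ (2 * m) (2 * n + 1)
          (alphaPow S m) (S (alphaPow S n) (beta k)) = (m : k) • alphaPow S (m + n)) ∧
      (∀ m n : ℤ, bracket (frobeniusData k) S Δ (2 * m + 1) (2 * n)
          (S (alphaPow S m) (beta k)) (alphaPow S n) = -(n : k) • alphaPow S (m + n)) ∧
      (∀ m n : ℤ, bracket (frobeniusData k) S Δ (2 * m + 1) (2 * n + 1)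
          (S (alphaPow S m) (beta k)) (S (alphaPow S n) (beta k)) =
        ((m - n : ℤ) : k) • S (alphaPow S (m + n)) (beta k)) := by

  have h2 : (2 : k) ≠ 0 := Ring.two_ne_zero hk
  have bee := fun m n => bracket_even_even m n h2
  have beo := fun m n => bracket_even_odd m n h2
  have boe := fun m n => bracket_odd_even m n h2
  have boo := fun m n => bracket_odd_odd m n h2
  refine ⟨starProduct h2, bvOperator h2, isStarProduct_starProduct h2,
    fun S' hS' => starProduct_unique h2 hS' (isStarProduct_starProduct h2), isBVOperator_bvOperator h2,
    fun Δ' hΔ' => bvOperator_unique h2 hΔ' (isBVOperator_bvOperator h2), ?_⟩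
  -- Every remaining claim becomes a statement about the generators `gen n`.
  simp only [alphaPow_eq_gen, alpha_eq_gen h2, beta_eq_gen h2,
    alphaInv_eq_gen h2, one_eq_gen h2, starProduct_gen_two_mul_gen_one]
  refine ⟨?_, ?_, fun n => ⟨gen_ne_zero h2 _, degree_eq_span h2 _⟩,
    fun n => ⟨gen_ne_zero h2 _, degree_eq_span h2 _⟩, fun n => ?_, fun n => ?_,
    ?_, ?_, ?_, ?_, ?_, ?_, ?_, ?_, ?_, bee, beo, boe, boo⟩
  · rw [starProduct_gen, oddConst, if_pos (Or.inl even_two), one_smul]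
    rfl
  · rw [starProduct_gen, oddConst, if_pos (Or.inr even_two), one_smul]
    rfl
  · rw [bvOperator_gen, if_neg (by simp [parity_simps]), add_sub_cancel_right]
  · rw [bvOperator_gen, if_pos (even_two_mul n)]
  -- The brackets of `α`, `β`, `α⁻¹` are the cases `m, n ∈ {-1, 0, 1}` of the four general formulas.
  · simpa using beo 1 0
  · simpa using boe 0 (-1)
  · simpa using boe 0 1
  · simpa using beo (-1) 0
  · simpa using bee 1 1
  · simpa using bee 1 (-1)
  · simpa using bee (-1) 1
  · simpa using bee (-1) (-1)
  · simpa using boo 0 0
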